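/- Let $\lambda_P>0$, $\theta=\lambda_P^2$. The Moyal algebra $\mathcal A=(\mathcal S(\mathbb R^2),\star)$ is the space of complex Schwartz functions with the product $$(f\star g)(x)=\frac1{(\pi\theta)^2}\int_{\mathbb R^2}\int_{\mathbb R^2} f(x+u)\,g(x+v)\,e^{-\frac{2i}{\theta}(u_2v_1-u_1v_2)}\,du\,dv ,$$ acting on $L^2(\mathbb R^2)$ by $\mathcal L(f)\psi=f\star\psi$ and on $L^2(\mathbb R^2)\otimes\mathbb C^2$ by $\mathcal L(f)\otimes 1$. Let $D=-i\sum_{\mu=1}^2\gamma^\mu\partial_\mu$ be the Euclidean Dirac operator on $L^2(\mathbb R^2)\otimes\mathbb C^2$. A state of $\mathcal A$ is (the restriction to $\mathcal A$ of) a positive linear functional of norm one on the $C^*$-closure of $\mathcal A$, i.e. the norm closure of $\mathcal L(\mathcal A)$. The spectral distance between two states is $$d_D(\varphi_1,\varphi_2)=\sup\{|\varphi_1(f)-\varphi_2(f)| : f\in\mathcal A,\ \|[D,\mathcal L(f)\otimes 1]\|\le 1\}\in[0,\infty].$$ For $\kappa\in\mathbb R^2\simeq\mathbb C$ put $(\alpha_\kappa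 f)(x)=f(x+\kappa)$ and $(\alpha_\kappa\varphi)(f)=\varphi(\alpha_\kappa f)$. For $m\in\mathbb N=\{0,1,2,\dots\}$ let $\omega_m(f)=\langle m|\pi_S(f)|m\rangle$, where $\pi_S(f)=\int_{\mathbb R^2}\hat f(k)\,e^{\frac i\theta(\mathfrak q k_1+\mathfrak p k_2)}\,dk$ is the Schrödinger representation on $L^2(\mathbb R)$ (with $\mathfrak q$ multiplication by $x$, $\mathfrak p=-i\theta\,\frac{d}{dx}$, and $\hat f$ normalised by $f(x)=\int\hat f(k)e^{\frac i\theta x\cdot k}dk$), and $|m\rangle$ is the $m$-th normalised eigenfunction of the harmonic oscillator Hamiltonian $\frac12(\mathfrak q^2+\mathfrak p^2)$. 1. For every state $\varphi$ of $\mathcal A$ and every $\kappa\in\mathbb R^2$, $\alpha_\kappa\varphi$ is a state and $d_D(\varphi,\alpha_\kappa\varphi)=|\kappa|$. 2. The spectral distance takes every value in $[0,\infty]$: for every $r\in[0,\infty]$ there are states $\varphi_1,\varphi_2$ of $\mathcal A$ with $d_D(\varphi_1,\varphi_2)=r$. 3. Every $\omega_m$ is a state, and for all $m\le n$ $$d_D(\omega_m,\omega_n)=\frac{\lambda_P}{\sqrt2}\sum_{k=m+1}^n\frac1{\sqrt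 k}.$$ In particular, the distance between eigenstates is additive: $d_D(\omega_m,\omega_p)=d_D(\omega_m,\omega_n)+d_D(\omega_n,\omega_p)$ for all $m\le n\le p$. -/

import Mathlib

open MeasureTheory Filter
open scoped ENNReal SchwartzMap LineDeriv ComplexOrder FourierTransform

noncomputable section

namespace Moyal

/-- The plane `ℝ²` with its Euclidean norm. -/
abbrev Plane : Type := EuclideanSpace ℝ (Fin 2)

/-- The Hilbert space `L²(ℝ²)`. -/
abbrev L2 : Type := Lp ℂ 2 (volume : Measure Plane)

/-- The Hilbert space `L²(ℝ²) ⊗ ℂ²` of square integrable spinors. -/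
abbrev Spinor : Type := PiLp 2 (fun _ : Fin 2 => L2)

/-! ### The Moyal product and the left regular representation -/

/-- The twist `exp (-(2i/θ) u Θ₀⁻¹ v)`, where `Θ₀ = !![0, 1; -1, 0]`, so that
`u Θ₀⁻¹ v = u₂ v₁ - u₁ v₂`. -/
def twist (θ : ℝ) (u v : Plane) : ℂ :=
  Complex.exp (-(2 * Complex.I / θ) * ((u 1 * v 0 - u 0 * v 1 : ℝ) : ℂ))

/-- The Moyal product
`(f ⋆ g)(x) = (πθ)⁻² ∫∫ f(x + u) g(x + v) exp (-(2i/θ) u Θ₀⁻¹ v) du dv`. The integral over `u`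
is performed first: for `f` a Schwartz function, both integrals then converge absolutely for every
square integrable `g`. -/
def moyalMul (θ : ℝ) (f g : Plane → ℂ) (x : Plane) : ℂ :=
  (1 / (Real.pi * θ) : ℂ) ^ 2 * ∫ v, ∫ u, f (x + u) * g (x + v) * twist θ u v

theorem norm_twist (θ : ℝ) (u v : Plane) : ‖twist θ u v‖ = 1 := by
  have : (-(2 * Complex.I / θ) * ((u 1 * v 0 - u 0 * v 1 : ℝ) : ℂ))
      = ((-(2 / θ) * (u 1 * v 0 - u 0 * v 1) : ℝ) : ℂ) * Complex.I := by
    push_cast; ring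
  rw [twist, this, Complex.norm_exp_ofReal_mul_I]

theorem continuous_twist (θ : ℝ) : Continuous fun p : Plane × Plane => twist θ p.1 p.2 := by
  unfold twist
  fun_prop

theorem twist_sub (θ : ℝ) (y x v : Plane) : twist θ (y - x) v = twist θ y v * twist θ (-x) v := by
  simp only [twist, ← Complex.exp_add]
  congr 1
  simp
  ring

/-- The linear map `v ↦ (πθ)⁻¹ (-v₂, v₁)`. -/
def freq (θ : ℝ) : Plane →ₗ[ℝ] Plane where
  toFun v := (1 / (Real.pi * θ)) • !₂[-v 1, v 0]
  map_add' v w := by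
    ext i; fin_cases i <;> simp <;> ring
  map_smul' c v := by
    ext i; fin_cases i <;> simp <;> ring

/-- For `θ ≠ 0`, the linear map `freq θ` is invertible. -/
def freqEquiv (θ : ℝ) (hθ : θ ≠ 0) : Plane ≃L[ℝ] Plane :=
  (LinearEquiv.ofInjectiveEndo (freq θ) (by
    intro v w h
    have h0 := congrArg (fun z : Plane => z 0) h
    have h1 := congrArg (fun z : Plane => z 1) h
    have hc : Real.pi * θ ≠ 0 := mul_ne_zero Real.pi_ne_zero hθ
    simp [freq, hθ, Real.pi_ne_zero] at h0 h1
    ext i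
    fin_cases i <;> simp [h0, h1])).toContinuousLinearEquiv

theorem freqEquiv_apply (θ : ℝ) (hθ : θ ≠ 0) (v : Plane) : freqEquiv θ hθ v = freq θ v := rfl

theorem integral_twist (θ : ℝ) (f : Plane → ℂ) (v : Plane) :
    ∫ y, f y * twist θ y v = 𝓕 f (freq θ v) := by
  rw [Real.fourier_eq']
  refine integral_congr_ae (Eventually.of_forall fun y => ?_)
  have hpi : (Real.pi : ℂ) ≠ 0 := by exact_mod_cast Real.pi_ne_zero
  simp only [twist, smul_eq_mul]
  rw [mul_comm]
  congr 2
  by_cases hθ : θ = 0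
  · simp [hθ, freq]
  have hθ' : (θ : ℂ) ≠ 0 := by exact_mod_cast hθ
  simp [freq, PiLp.inner_apply, Fin.sum_univ_two]
  field_simp
  ring

/-- The left Moyal multiplication by a Schwartz function is an integral operator
whose kernel is dominated by a Schwartz function of the difference of the variables. -/
theorem exists_kernel (θ : ℝ) (f : 𝓢(Plane, ℂ)) : ∃ (h : 𝓢(Plane, ℂ)) (k : Plane → Plane → ℂ),
    Continuous (fun p : Plane × Plane => k p.1 p.2) ∧ (∀ x v, ‖k x v‖ ≤ ‖h v‖) ∧
    ∀ (g : Plane → ℂ) (x : Plane), moyalMul θ f g x = ∫ v, k x v * g (x + v) := by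
  by_cases hθ : θ = 0
  · refine ⟨0, fun _ _ => 0, continuous_const, by simp, fun g x => by simp [moyalMul, hθ]⟩
  let h : 𝓢(Plane, ℂ) := ((1 / (Real.pi * θ) : ℂ) ^ 2) •
    SchwartzMap.compCLMOfContinuousLinearEquiv ℂ (freqEquiv θ hθ) (𝓕 f)
  have hh : ∀ v, h v = (1 / (Real.pi * θ) : ℂ) ^ 2 * 𝓕 (f : Plane → ℂ) (freq θ v) := by
    intro v
    simp [h, freqEquiv_apply, SchwartzMap.fourier_coe]
  refine ⟨h, fun x v => twist θ (-x) v * h v, ?_, ?_, ?_⟩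
  · exact ((continuous_twist θ).comp (continuous_fst.neg.prodMk continuous_snd)).mul
      (h.continuous.comp continuous_snd)
  · intro x v
    simp [norm_twist]
  · intro g x
    rw [moyalMul, ← integral_const_mul]
    refine integral_congr_ae (Eventually.of_forall fun v => ?_)
    have e : ∫ u, f (x + u) * g (x + v) * twist θ u v
        = ∫ y, f y * g (x + v) * twist θ (y - x) v := by
      rw [← integral_add_left_eq_self (μ := (volume : Measure Plane))
        (fun y => f y * g (x + v) * twist θ (y - x) v) x]
      simp
    have e2 : ∫ y, f y * g (x + v) * twist θ (y - x) v
        = (g (x + v) * twist θ (-x) v) * ∫ y, f y * twist θ y v := by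
      rw [← integral_const_mul]
      refine integral_congr_ae (Eventually.of_forall fun y => ?_)
      simp only [twist_sub θ y x v]
      ring
    simp only [e, e2, integral_twist, hh]
    ring

theorem lintegral_kernel_le (h ψ : Plane → ℝ≥0∞) (hh : Measurable h) (hψ : Measurable ψ) :
    ∫⁻ x, (∫⁻ v, h v * ψ (x + v)) ^ (2 : ℝ) ≤ (∫⁻ v, h v) ^ (2 : ℝ) * ∫⁻ x, ψ x ^ (2 : ℝ) := by
  have key : ∀ x, (∫⁻ v, h v * ψ (x + v)) ^ (2 : ℝ)
      ≤ (∫⁻ v, h v) * ∫⁻ v, h v * ψ (x + v) ^ (2 : ℝ) := by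
    intro x
    have hm : Measurable fun v => ψ (x + v) := hψ.comp (measurable_const_add x)
    have := ENNReal.lintegral_mul_le_Lp_mul_Lq (volume : Measure Plane)
      (p := 2) (q := 2) Real.HolderConjugate.two_two
      (f := fun v => h v ^ (1 / 2 : ℝ)) (g := fun v => h v ^ (1 / 2 : ℝ) * ψ (x + v))
      (hh.pow_const _).aemeasurable ((hh.pow_const _).mul hm).aemeasurable
    have hs : ∀ a : ℝ≥0∞, a ^ (1 / 2 : ℝ) * a ^ (1 / 2 : ℝ) = a := fun a => by
      rw [← ENNReal.rpow_add_of_nonneg _ _ (by norm_num) (by norm_num)]; norm_num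
    have hq : ∀ a : ℝ≥0∞, (a ^ (1 / 2 : ℝ)) ^ (2 : ℝ) = a := fun a => by
      rw [← ENNReal.rpow_mul]; norm_num
    simp only [Pi.mul_apply, ← mul_assoc, hs, hq,
      ENNReal.mul_rpow_of_nonneg _ _ (show (0 : ℝ) ≤ 2 by norm_num)] at this
    calc (∫⁻ v, h v * ψ (x + v)) ^ (2 : ℝ)
        ≤ ((∫⁻ v, h v) ^ (1 / 2 : ℝ) *
          (∫⁻ v, h v * ψ (x + v) ^ (2 : ℝ)) ^ (1 / 2 : ℝ)) ^ (2 : ℝ) :=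
          ENNReal.rpow_le_rpow this (by norm_num)
      _ = _ := by rw [ENNReal.mul_rpow_of_nonneg _ _ (by norm_num), hq, hq]
  calc ∫⁻ x, (∫⁻ v, h v * ψ (x + v)) ^ (2 : ℝ)
      ≤ ∫⁻ x, (∫⁻ v, h v) * ∫⁻ v, h v * ψ (x + v) ^ (2 : ℝ) := lintegral_mono key
    _ = (∫⁻ v, h v) * ∫⁻ x, ∫⁻ v, h v * ψ (x + v) ^ (2 : ℝ) := by
        rw [lintegral_const_mul]
        exact Measurable.lintegral_prod_right' (f := fun p : Plane × Plane =>
          h p.2 * ψ (p.1 + p.2) ^ (2 : ℝ)) (by fun_prop)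
    _ = (∫⁻ v, h v) * ∫⁻ v, ∫⁻ x, h v * ψ (x + v) ^ (2 : ℝ) := by
        rw [lintegral_lintegral_swap]
        exact Measurable.aemeasurable (by fun_prop)
    _ = (∫⁻ v, h v) * ∫⁻ v, h v * ∫⁻ x, ψ x ^ (2 : ℝ) := by
        congr 1
        refine lintegral_congr fun v => ?_
        rw [lintegral_const_mul _ (by fun_prop),
          lintegral_add_right_eq_self (fun x => ψ x ^ (2 : ℝ)) v]
    _ = _ := by
        rw [lintegral_mul_const _ hh, ← mul_assoc]
        congr 1
        rw [ENNReal.rpow_ofNat, sq]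

theorem integrable_kernel (h : 𝓢(Plane, ℂ)) (k : Plane → Plane → ℂ)
    (hk : Continuous fun p : Plane × Plane => k p.1 p.2) (hle : ∀ x v, ‖k x v‖ ≤ ‖h v‖)
    (ψ : L2) (x : Plane) : Integrable fun v => k x v * ψ (x + v) := by
  have hψ : MemLp (fun v => ψ (x + v)) 2 (volume : Measure Plane) :=
    (Lp.memLp ψ).comp_measurePreserving (measurePreserving_add_left volume x)
  have hkx : MemLp (k x) 2 (volume : Measure Plane) :=
    (h.memLp 2).of_le (by
      have : Continuous fun v => k x v := hk.comp (Continuous.prodMk_right x)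
      exact this.aestronglyMeasurable)
      (Eventually.of_forall (hle x))
  exact hkx.integrable_mul hψ

theorem eLpNorm_kernel_le (h : 𝓢(Plane, ℂ)) (k : Plane → Plane → ℂ)
    (hle : ∀ x v, ‖k x v‖ ≤ ‖h v‖) (ψ : L2) :
    eLpNorm (fun x => ∫ v, k x v * ψ (x + v)) 2 volume
      ≤ (∫⁻ v, ‖h v‖ₑ) * eLpNorm ψ 2 volume := by
  rw [eLpNorm_eq_lintegral_rpow_enorm_toReal (by norm_num) (by norm_num),
    eLpNorm_eq_lintegral_rpow_enorm_toReal (by norm_num) (by norm_num)]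
  simp only [ENNReal.toReal_ofNat]
  have hψ : Measurable fun x => ‖ψ x‖ₑ := (Lp.stronglyMeasurable ψ).measurable.enorm
  have hh : Measurable fun x => ‖h x‖ₑ := h.continuous.measurable.enorm
  calc (∫⁻ x, ‖∫ v, k x v * ψ (x + v)‖ₑ ^ (2 : ℝ)) ^ (1 / 2 : ℝ)
      ≤ (∫⁻ x, (∫⁻ v, ‖h v‖ₑ * ‖ψ (x + v)‖ₑ) ^ (2 : ℝ)) ^ (1 / 2 : ℝ) := by
        refine ENNReal.rpow_le_rpow (lintegral_mono fun x => ?_) (by norm_num)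
        refine ENNReal.rpow_le_rpow ?_ (by norm_num)
        refine (enorm_integral_le_lintegral_enorm _).trans (lintegral_mono fun v => ?_)
        rw [enorm_mul]
        gcongr
        exact enorm_le_iff_norm_le.2 (hle x v)
    _ ≤ ((∫⁻ v, ‖h v‖ₑ) ^ (2 : ℝ) * ∫⁻ x, ‖ψ x‖ₑ ^ (2 : ℝ)) ^ (1 / 2 : ℝ) :=
        ENNReal.rpow_le_rpow (lintegral_kernel_le _ _ hh hψ) (by norm_num)
    _ = _ := by
        rw [ENNReal.mul_rpow_of_nonneg _ _ (by norm_num), ← ENNReal.rpow_mul]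
        norm_num

theorem memLp_moyalMul (θ : ℝ) (f : 𝓢(Plane, ℂ)) (ψ : L2) :
    MemLp (moyalMul θ f ψ) 2 volume := by
  obtain ⟨h, k, hk, hle, hfk⟩ := exists_kernel θ f
  rw [funext (hfk ψ)]
  refine ⟨?_, (eLpNorm_kernel_le h k hle ψ).trans_lt ?_⟩
  · have hm : StronglyMeasurable fun p : Plane × Plane => k p.1 p.2 * ψ (p.1 + p.2) :=
      hk.stronglyMeasurable.mul
        ((Lp.stronglyMeasurable ψ).comp_measurable (measurable_fst.add measurable_snd))
    exact hm.integral_prod_right.aestronglyMeasurable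
  · exact ENNReal.mul_lt_top h.integrable.2 (Lp.memLp ψ).2

/-- The left regular representation `𝓛(f) ψ = f ⋆ ψ` of Schwartz functions by bounded operators
on `L²(ℝ²)`. -/
def leftMul (θ : ℝ) (f : 𝓢(Plane, ℂ)) : L2 →L[ℂ] L2 :=
  LinearMap.mkContinuousOfExistsBound
    { toFun := fun ψ => (memLp_moyalMul θ f ψ).toLp (moyalMul θ f ψ)
      map_add' := by
        intro ψ χ
        rw [← MemLp.toLp_add, MemLp.toLp_eq_toLp_iff]
        obtain ⟨h, k, hk, hle, hfk⟩ := exists_kernel θ f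
        refine Eventually.of_forall fun x => ?_
        rw [Pi.add_apply, hfk, hfk, hfk, ← integral_add (integrable_kernel h k hk hle ψ x)
          (integrable_kernel h k hk hle χ x)]
        refine integral_congr_ae ?_
        filter_upwards [(measurePreserving_add_left volume x).quasiMeasurePreserving.ae
          (Lp.coeFn_add ψ χ)] with v hv
        simp only [hv, Pi.add_apply, mul_add]
      map_smul' := by
        intro c ψ
        rw [RingHom.id_apply, ← MemLp.toLp_const_smul, MemLp.toLp_eq_toLp_iff]
        obtain ⟨h, k, hk, hle, hfk⟩ := exists_kernel θ f
        refine Eventually.of_forall fun x => ?_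
        rw [Pi.smul_apply, hfk, hfk, smul_eq_mul, ← integral_const_mul]
        refine integral_congr_ae ?_
        filter_upwards [(measurePreserving_add_left volume x).quasiMeasurePreserving.ae
          (Lp.coeFn_smul c ψ)] with v hv
        simp only [hv, Pi.smul_apply, smul_eq_mul]
        ring }
    (by
      obtain ⟨h, k, hk, hle, hfk⟩ := exists_kernel θ f
      refine ⟨(∫⁻ v, ‖h v‖ₑ).toReal, fun ψ => ?_⟩
      have h1 := eLpNorm_kernel_le h k hle ψ
      rw [← funext (hfk ψ)] at h1
      have h2 := ENNReal.toReal_mono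
        (ENNReal.mul_lt_top h.integrable.2 (Lp.memLp ψ).2).ne h1
      rw [ENNReal.toReal_mul] at h2
      rw [LinearMap.coe_mk, AddHom.coe_mk, Lp.norm_toLp, Lp.norm_def]
      exact h2)

/-- `𝓛(f) ψ` is the class of the function `f ⋆ ψ`. -/
theorem leftMul_apply (θ : ℝ) (f : 𝓢(Plane, ℂ)) (ψ : L2) :
    leftMul θ f ψ = (memLp_moyalMul θ f ψ).toLp (moyalMul θ f ψ) := rfl

/-! ### States of the Moyal algebra -/

/-- The `C*`-closure of the Moyal algebra `(𝓢(ℝ²), ⋆)`: the norm closed `*`-algebra of operators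
on `L²(ℝ²)` generated by the operators `𝓛(f)`. -/
def closureAlg (θ : ℝ) : NonUnitalStarSubalgebra ℂ (L2 →L[ℂ] L2) :=
  (NonUnitalStarAlgebra.adjoin ℂ (Set.range (leftMul θ))).topologicalClosure

theorem leftMul_mem (θ : ℝ) (f : 𝓢(Plane, ℂ)) : leftMul θ f ∈ closureAlg θ :=
  NonUnitalStarSubalgebra.le_topologicalClosure _
    (NonUnitalStarAlgebra.subset_adjoin ℂ _ ⟨f, rfl⟩)

instance (θ : ℝ) : NonUnitalCStarAlgebra (closureAlg θ) :=
  NonUnitalStarSubalgebra.nonUnitalCStarAlgebra _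
    (h_closed := NonUnitalStarSubalgebra.isClosed_topologicalClosure _)

/-- The states of a `C*`-algebra: the positive linear functionals of norm one. -/
structure CStarState (A : Type*) [NonUnitalCStarAlgebra A] where
  toCLM : A →L[ℂ] ℂ
  nonneg : ∀ a, 0 ≤ toCLM (star a * a)
  norm_eq_one : ‖toCLM‖ = 1

/-- A functional on the Moyal algebra is a state if it is the restriction to this algebra of a
state of the `C*`-closure. -/
def IsState (θ : ℝ) (φ : 𝓢(Plane, ℂ) → ℂ) : Prop :=
  ∃ Φ : CStarState (closureAlg θ), ∀ f, φ f = Φ.toCLM ⟨leftMul θ f, leftMul_mem θ f⟩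

/-- The translate `(α_κ f)(x) = f(x + κ)` of a Schwartz function. -/
def translate (κ : Plane) (f : 𝓢(Plane, ℂ)) : 𝓢(Plane, ℂ) :=
  SchwartzMap.compCLMOfAntilipschitz ℂ (g := fun x : Plane => x + κ) (K := 1)
    (by fun_prop) (AntilipschitzWith.of_le_mul_dist fun x y => by simp) f

theorem translate_apply (κ : Plane) (f : 𝓢(Plane, ℂ)) (x : Plane) :
    translate κ f x = f (x + κ) := rfl

/-- The translate `(α_κ φ)(f) = φ(α_κ f)` of a functional. -/
def translateState (κ : Plane) (φ : 𝓢(Plane, ℂ) → ℂ) : 𝓢(Plane, ℂ) → ℂ :=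
  fun f => φ (translate κ f)

/-! ### The Dirac operator and the spectral distance -/

/-- The Euclidean gamma matrices in dimension two. -/
def gammaMatrix : Fin 2 → Matrix (Fin 2) (Fin 2) ℂ :=
  ![!![0, 1; 1, 0], !![0, Complex.I; -Complex.I, 0]]

/-- The expression `-i ∑ μ, γ^μ ∂_μ ψ` in the sense of distributions. -/
def diracDistribution (ψ : Spinor) (a : Fin 2) : 𝓢'(Plane, ℂ) :=
  -Complex.I • ∑ μ, ∑ b, gammaMatrix μ a b •
    ∂_{(EuclideanSpace.single μ 1 : Plane)} ((ψ b : L2) : 𝓢'(Plane, ℂ))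

theorem diracDistribution_add (ψ χ : Spinor) (a : Fin 2) :
    diracDistribution (ψ + χ) a = diracDistribution ψ a + diracDistribution χ a := by
  simp only [diracDistribution, PiLp.add_apply, ← Lp.toTemperedDistributionCLM_apply, map_add,
    LineDeriv.lineDerivOp_add, smul_add, Finset.sum_add_distrib]

theorem diracDistribution_zero (a : Fin 2) : diracDistribution 0 a = 0 := by
  have h := diracDistribution_add 0 0 a
  rw [add_zero] at h
  exact left_eq_add.1 h

theorem diracDistribution_smul (c : ℂ) (ψ : Spinor) (a : Fin 2) :
    diracDistribution (c • ψ) a = c • diracDistribution ψ a := by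
  simp only [diracDistribution, PiLp.smul_apply, ← Lp.toTemperedDistributionCLM_apply, map_smul,
    LineDeriv.lineDerivOp_smul, Finset.smul_sum]
  simp only [smul_comm c]

/-- The graph of the Dirac operator: the pairs `(ψ, η)` of square integrable spinors such that
`-i ∑ μ, γ^μ ∂_μ ψ = η` in the sense of distributions. -/
def diracGraph : Submodule ℂ (Spinor × Spinor) where
  carrier := {p | ∀ a, diracDistribution p.1 a = ((p.2 a : L2) : 𝓢'(Plane, ℂ))}
  add_mem' := by
    intro p q hp hq a
    simp only [Set.mem_ofPred_eq, ← Lp.toTemperedDistributionCLM_apply] at hp hq ⊢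
    rw [Prod.fst_add, Prod.snd_add, diracDistribution_add, hp a, hq a, PiLp.add_apply, map_add]
  zero_mem' := by
    intro a
    rw [Prod.fst_zero, Prod.snd_zero, diracDistribution_zero,
      ← Lp.toTemperedDistributionCLM_apply, PiLp.zero_apply,
      map_zero]
  smul_mem' := by
    intro c p hp a
    simp only [Set.mem_ofPred_eq, ← Lp.toTemperedDistributionCLM_apply] at hp ⊢
    rw [Prod.smul_fst, Prod.smul_snd, diracDistribution_smul, hp a, PiLp.smul_apply, map_smul]

theorem diracGraph_single_valued (p : Spinor × Spinor) (hp : p ∈ diracGraph) (h0 : p.1 = 0) :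
    p.2 = 0 := by
  ext1 a
  have h := hp a
  have h1 : diracDistribution p.1 a = 0 := by
    rw [h0, diracDistribution_zero]
  rw [h1] at h
  have hk := Lp.ker_toTemperedDistributionCLM_eq_bot (F := ℂ) (E := Plane)
    (μ := (volume : Measure Plane)) (p := 2)
  exact (LinearMap.ker_eq_bot'.1 hk) (p.2 a) h.symm

/-- The Dirac operator `D = -i ∑ μ, γ^μ ∂_μ`, an unbounded operator on `L²(ℝ²) ⊗ ℂ²`. Its domain
consists of all the square integrable spinors `ψ` whose distributional image `D ψ` is square
integrable. -/
def dirac : Spinor →ₗ.[ℂ] Spinor := diracGraph.toLinearPMap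

theorem dirac_graph : dirac.graph = diracGraph :=
  Submodule.toLinearPMap_graph_eq _ diracGraph_single_valued

/-- The operator `T ⊗ 1` on spinors. -/
def onSpinors (T : L2 →L[ℂ] L2) (ψ : Spinor) : Spinor := WithLp.toLp 2 fun a => T (ψ a)

/-- The condition `‖[D, f]‖ ≤ 1`, where `f` acts on spinors by `𝓛(f) ⊗ 1`: the operator
`𝓛(f) ⊗ 1` preserves the domain of `D`, and there the commutator is bounded with norm at most
one. -/
def CommutatorLeOne (θ : ℝ) (f : 𝓢(Plane, ℂ)) : Prop :=
  ∀ ψ : dirac.domain, ∃ h : onSpinors (leftMul θ f) ψ ∈ dirac.domain,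
    ‖dirac ⟨onSpinors (leftMul θ f) ψ, h⟩ - onSpinors (leftMul θ f) (dirac ψ)‖ ≤ ‖(ψ : Spinor)‖

/-- Connes' spectral distance
`d_D(φ₁, φ₂) = sup {|φ₁(f) - φ₂(f)| : f ∈ 𝓢(ℝ²), ‖[D, f]‖ ≤ 1}`, with values in `[0, ∞]`. -/
def spectralDist (θ : ℝ) (φ₁ φ₂ : 𝓢(Plane, ℂ) → ℂ) : ℝ≥0∞ :=
  ⨆ (f : 𝓢(Plane, ℂ)) (_ : CommutatorLeOne θ f), ‖φ₁ f - φ₂ f‖ₑ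

/-! ### Eigenstates of the harmonic oscillator -/

/-- The normalised eigenfunction `|n⟩` of the Hamiltonian `(q² + p²)/2`, where `(q ψ)(x) = x ψ(x)`
and `p = -iθ d/dx`, written with the probabilists' Hermite polynomial `Heₙ`:
`(πθ)^{-1/4} (n!)^{-1/2} Heₙ(x √(2/θ)) exp (-x²/(2θ))`. -/
def eigenfunction (θ : ℝ) (n : ℕ) (x : ℝ) : ℂ :=
  (((Real.pi * θ) ^ (-(1 / 4) : ℝ) / Real.sqrt n.factorial *
    Polynomial.aeval (x * Real.sqrt (2 / θ)) (Polynomial.hermite n) *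
    Real.exp (-x ^ 2 / (2 * θ)) : ℝ) : ℂ)

/-- The Fourier transform `f̂(k) = (2πθ)⁻² ∫ f(x) exp (-(i/θ) x·k) dx`, normalised so that
`f(x) = ∫ f̂(k) exp ((i/θ) x·k) dk`. -/
def fourierCoeff (θ : ℝ) (f : Plane → ℂ) (k : Plane) : ℂ :=
  (1 / (2 * Real.pi * θ) : ℂ) ^ 2 *
    ∫ x, f x * Complex.exp (-(Complex.I / θ) * ((x 0 * k 0 + x 1 * k 1 : ℝ) : ℂ))

/-- The Weyl operator `exp ((i/θ)(k₁ q + k₂ p))`, that is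
`ψ ↦ exp ((i/θ)(k₁ x + k₁ k₂/2)) ψ(x + k₂)`. -/
def weyl (θ : ℝ) (k : Plane) (ψ : ℝ → ℂ) (x : ℝ) : ℂ :=
  Complex.exp ((Complex.I / θ) * ((k 0 * x + k 0 * k 1 / 2 : ℝ) : ℂ)) * ψ (x + k 1)

/-- The Schrödinger representation `π_S(f) = ∫ f̂(k) exp ((i/θ)(k₁ q + k₂ p)) dk`. -/
def schrodinger (θ : ℝ) (f : Plane → ℂ) (ψ : ℝ → ℂ) (x : ℝ) : ℂ :=
  ∫ k, fourierCoeff θ f k * weyl θ k ψ x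

/-- The eigenstate `ω_m(f) = ⟨m| π_S(f) |m⟩` of the harmonic oscillator. -/
def eigenstate (θ : ℝ) (m : ℕ) : 𝓢(Plane, ℂ) → ℂ := fun f =>
  ∫ x, (starRingEnd ℂ) (eigenfunction θ m x) * schrodinger θ f (eigenfunction θ m) x

end Moyal

end

/-!
The operators `𝓛(f)` are integrals `∫ f̂(v) V(v) dv` of twisted translations `V(v)`, which are
unitary and commute up to phases, against the symplectic Fourier transform `f̂` of `f`
(`inner_leftMul`); conjugation by `V(κ/2)` implements the translation `α_κ` (`leftMul_translate`).
Since `𝓛` satisfies the Leibniz rule, the commutator of the Dirac operator with `𝓛(f) ⊗ 1` is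
off-diagonal with entries `-i 𝓛(∂₁f ± i ∂₂f)`, so the Lipschitz condition of the spectral distance
says that `‖𝓛(∂₁f ± i ∂₂f)‖ ≤ 1` (`commutatorLeOne_iff`).

*A state and its translates.* The mean value inequality along `t ↦ α_{tκ} f`, whose derivative is
the translate of the directional derivative of `f` along `κ`, bounds the distance by `|κ|`
(`spectralDist_translateState_le`).
For the lower bound one wants to insert the function `x ↦ ⟨u, x⟩` with `u = κ/|κ|`, which is
Lipschitz but not in the algebra. It is replaced by the anti-Wick quantisation of
`x ↦ ⟨u, x⟩ exp (-c |x|²)`. Anti-Wick quantisation commutes with derivatives, and it is monotone,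
being an integral of projections onto coherent states; so an operator norm is at most one as soon as
the symbol is dominated by a Gaussian function of height one (`norm_leftMul_antiWick_le`). This
makes the regularised functions exactly Lipschitz (`exists_detector`). As `c → 0` the differences
`f - α_κ f` stay bounded and converge strictly to the scalar `-|κ|`, and a state of a
`C*`-algebra is continuous along such sequences (`CStarState.tendsto_of_strict`). Hence the distance
is `|κ|` for every state, without any assumption of normality (`le_spectralDist_translateState`).

*Eigenstates.* The Gaussian function `2 exp (-|x|²/θ)` is an idempotent of the Moyal algebra. Ladder
operators applied to it from both sides give matrix units `E m n`, and applied to it from the left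
they give an orthonormal family `ξ_n` in `L²(ℝ²)` on which the `E m n` act as matrix units. The
matrix elements of `V(v)` between the `ξ_n` and those of the Weyl operators of the
Schrödinger representation between the Hermite functions satisfy the same recursion and have the
same first entry (`pair_weylS_eq_inner_shift`), so `ω_m(f) = ⟨ξ_m, 𝓛(f) ξ_m⟩` (`eigenstate_eq`).
The derivative `∂₁ + i ∂₂` is a commutator with the annihilation operator; therefore
`⟨ξ_k, 𝓛(∂₁f + i ∂₂f) ξ_{k+1}⟩ = √(2(k+1)/θ) (ω_{k+1}(f) - ω_k(f))` (`inner_leftMul_dbar`), and the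
upper bound for the distance follows by telescoping. It is attained at the diagonal element whose
successive differences are the largest possible ones (`exists_diagonal_detector`): its derivatives
have at most one entry in every row and every column, so that their norm is the largest modulus of
an entry (`norm_sum_smul_leftMul_matrixUnit_le`).

*All values.* Finite distances are realised by translates. The distance from the ground state to the
`n`-th eigenstate grows like `√n`, so a superposition of the `ξ_n` with slowly decreasing weights
defines a state at infinite distance from the ground state (`exists_spectralDist_eq_top`).
-/

noncomputable section

namespace Moyal

open scoped ContDiff

section

/-! ### Constructing Schwartz functions -/

/-- A linear space of rapidly decreasing functions that is stable under partial derivatives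
consists of Schwartz functions. -/
theorem exists_schwartz_of_span {E ι : Type*} [NormedAddCommGroup E] [NormedSpace ℝ E] [Fintype ι]
    (l : ι → E →L[ℝ] ℝ) (S : Set (E → ℂ))
    (hdecay : ∀ F ∈ S, ∀ k : ℕ, ∃ C : ℝ, ∀ x, ‖x‖ ^ k * ‖F x‖ ≤ C)
    (hderiv : ∀ F ∈ S, ∃ G : ι → E → ℂ, (∀ i, G i ∈ Submodule.span ℂ S) ∧
      ∀ x, HasFDerivAt F (∑ i, (l i).smulRight (G i x)) x)
    {F : E → ℂ} (hF : F ∈ Submodule.span ℂ S) : ∃ f : 𝓢(E, ℂ), ∀ x, f x = F x := by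
  have h1 : ∀ F ∈ Submodule.span ℂ S, ∀ k : ℕ, ∃ C : ℝ, ∀ x, ‖x‖ ^ k * ‖F x‖ ≤ C := by
    intro F hF k
    induction hF using Submodule.span_induction with
    | mem F hF => exact hdecay F hF k
    | zero => exact ⟨0, by simp⟩
    | add F G _ _ hF hG =>
      obtain ⟨C, hC⟩ := hF
      obtain ⟨D, hD⟩ := hG
      refine ⟨C + D, fun x => ?_⟩
      calc ‖x‖ ^ k * ‖(F + G) x‖ ≤ ‖x‖ ^ k * (‖F x‖ + ‖G x‖) := by
            gcongr; exact norm_add_le _ _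
        _ ≤ C + D := by rw [mul_add]; exact add_le_add (hC x) (hD x)
    | smul c F _ hF =>
      obtain ⟨C, hC⟩ := hF
      refine ⟨‖c‖ * C, fun x => ?_⟩
      rw [Pi.smul_apply, norm_smul, mul_left_comm]
      exact mul_le_mul_of_nonneg_left (hC x) (norm_nonneg c)
  have h2 : ∀ F ∈ Submodule.span ℂ S, ∃ G : ι → E → ℂ, (∀ i, G i ∈ Submodule.span ℂ S) ∧
      ∀ x, HasFDerivAt F (∑ i, (l i).smulRight (G i x)) x := by
    intro F hF
    induction hF using Submodule.span_induction with
    | mem F hF => exact hderiv F hF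
    | zero =>
      refine ⟨fun _ => 0, fun _ => Submodule.zero_mem _, fun x => ?_⟩
      simpa using! hasFDerivAt_const (0 : ℂ) x
    | add F G _ _ hF hG =>
      obtain ⟨F', hF', hF⟩ := hF
      obtain ⟨G', hG', hG⟩ := hG
      refine ⟨fun i => F' i + G' i, fun i => Submodule.add_mem _ (hF' i) (hG' i), fun x => ?_⟩
      refine ((hF x).add (hG x)).congr_fderiv ?_
      ext y
      simp [Finset.sum_add_distrib]
    | smul c F _ hF =>
      obtain ⟨F', hF', hF⟩ := hF
      refine ⟨fun i => c • F' i, fun i => Submodule.smul_mem _ c (hF' i), fun x => ?_⟩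
      refine ((hF x).const_smul c).congr_fderiv ?_
      ext y
      simp [Finset.mul_sum, mul_left_comm]
  choose! G hGmem hGd using h2
  have hfd : ∀ F ∈ Submodule.span ℂ S, fderiv ℝ F = fun x => ∑ i, (l i).smulRight (G F i x) :=
    fun F hF => funext fun x => (hGd F hF x).fderiv
  let T : ι → ℂ →L[ℝ] (E →L[ℝ] ℂ) := fun i => ContinuousLinearMap.smulRightL ℝ E ℂ (l i)
  have hfd' : ∀ F ∈ Submodule.span ℂ S, fderiv ℝ F = fun x => ∑ i, T i (G F i x) := hfd
  have hc : ∀ (n : ℕ), ∀ F ∈ Submodule.span ℂ S, ContDiff ℝ n F := by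
    intro n
    induction n with
    | zero =>
      intro F hF
      rw [Nat.cast_zero, contDiff_zero, continuous_iff_continuousAt]
      exact fun x => (hGd F hF x).continuousAt
    | succ n ih =>
      intro F hF
      rw [Nat.cast_succ, contDiff_succ_iff_fderiv]
      refine ⟨fun x => (hGd F hF x).differentiableAt, by simp, ?_⟩
      rw [hfd' F hF]
      exact ContDiff.sum fun i _ => (T i).contDiff.comp (ih _ (hGmem F hF i))
  have hb : ∀ n : ℕ, ∀ F ∈ Submodule.span ℂ S, ∀ k : ℕ, ∃ C : ℝ,
      ∀ x, ‖x‖ ^ k * ‖iteratedFDeriv ℝ n F x‖ ≤ C := by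
    intro n
    induction n with
    | zero => intro F hF k; simpa using h1 F hF k
    | succ n ih =>
      intro F hF k
      choose C hC using fun i => ih _ (hGmem F hF i) k
      refine ⟨∑ i, ‖T i‖ * C i, fun x => ?_⟩
      have hd : ∀ i ∈ Finset.univ, ContDiffAt ℝ n (fun x => T i (G F i x)) x := fun i _ =>
        ((T i).contDiff.comp (hc n _ (hGmem F hF i))).contDiffAt
      rw [← norm_iteratedFDeriv_fderiv, hfd' F hF, iteratedFDeriv_fun_sum_apply hd]
      calc _ ≤ ‖x‖ ^ k * ∑ i, ‖T i‖ * ‖iteratedFDeriv ℝ n (G F i) x‖ := by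
            gcongr
            refine (norm_sum_le _ _).trans (Finset.sum_le_sum fun i _ => ?_)
            exact ContinuousLinearMap.norm_iteratedFDeriv_comp_left (T i)
              (hc n _ (hGmem F hF i)).contDiffAt le_rfl
        _ = ∑ i, ‖T i‖ * (‖x‖ ^ k * ‖iteratedFDeriv ℝ n (G F i) x‖) := by
            rw [Finset.mul_sum]; exact Finset.sum_congr rfl fun i _ => by ring
        _ ≤ _ := Finset.sum_le_sum fun i _ =>
            mul_le_mul_of_nonneg_left (hC i x) (T i).opNorm_nonneg
  exact ⟨⟨F, contDiff_infty.2 fun n => hc n F hF, fun k n => hb n F hF k⟩, fun x => rfl⟩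

theorem exists_pow_mul_exp_le {b : ℝ} (hb : 0 < b) (k : ℕ) :
    ∃ C : ℝ, ∀ t : ℝ, 0 ≤ t → t ^ k * Real.exp (-b * t ^ 2) ≤ C := by
  refine ⟨1 + k.factorial / b ^ k, fun t ht => ?_⟩
  have h1 : t ^ k ≤ 1 + (t ^ 2) ^ k := by
    rcases le_total t 1 with h | h
    · exact (pow_le_one₀ ht h).trans (le_add_of_nonneg_right (by positivity))
    · have : t ^ k ≤ (t ^ 2) ^ k := pow_le_pow_left₀ ht (by nlinarith) k
      linarith
  have h2 := Real.pow_div_factorial_le_exp (b * t ^ 2) (by positivity) k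
  have h3 : Real.exp (-b * t ^ 2) = (Real.exp (b * t ^ 2))⁻¹ := by rw [← Real.exp_neg]; ring_nf
  have h4 : 1 ≤ Real.exp (b * t ^ 2) := Real.one_le_exp (by positivity)
  rw [h3, ← div_eq_mul_inv, div_le_iff₀ (Real.exp_pos _)]
  rw [mul_pow, div_le_iff₀ (by positivity)] at h2
  have h5 : (t ^ 2) ^ k ≤ k.factorial / b ^ k * Real.exp (b * t ^ 2) := by
    rw [div_mul_eq_mul_div, le_div_iff₀ (by positivity)]
    linarith
  nlinarith

/-- The Gaussian `exp (-b ‖x‖²)` as a Schwartz function. -/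
theorem exists_gaussian (E : Type*) [NormedAddCommGroup E] [InnerProductSpace ℝ E] {b : ℝ}
    (hb : 0 < b) : ∃ g : 𝓢(E, ℂ), ∀ x, g x = (Real.exp (-b * ‖x‖ ^ 2) : ℂ) := by
  let g : E → ℂ := fun x => (Real.exp (-b * ‖x‖ ^ 2) : ℂ)
  let L : E →L[ℝ] E →L[ℝ] ℝ := (-(2 * b)) • innerSL ℝ
  let gr : E → ℝ := fun x => Real.exp (-b * ‖x‖ ^ 2)
  have hgr : ContDiff ℝ ∞ gr := Real.contDiff_exp.comp (contDiff_const.mul (contDiff_norm_sq ℝ))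
  have hfd : fderiv ℝ gr = fun x => gr x • L x := by
    funext x
    have h := ((hasStrictFDerivAt_norm_sq x).hasFDerivAt.const_mul (-b)).exp
    have h' : HasFDerivAt gr _ x := h
    rw [h'.fderiv]
    ext y
    simp [gr, L, innerSL_apply_apply ℝ]
    ring
  have hdec : ∀ n k : ℕ, ∃ C : ℝ, ∀ x, ‖x‖ ^ k * ‖iteratedFDeriv ℝ n gr x‖ ≤ C := by
    intro n
    induction n using Nat.strong_induction_on with
    | _ n ih =>
      intro k
      rcases n with _ | n
      · obtain ⟨C, hC⟩ := exists_pow_mul_exp_le hb k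
        refine ⟨C, fun x => ?_⟩
        simpa [gr] using hC ‖x‖ (norm_nonneg x)
      · obtain ⟨m, D, hD, hLb⟩ := L.hasTemperateGrowth.norm_iteratedFDeriv_le_uniform n
        have hi : ∀ i ∈ Finset.range (n + 1), ∃ C : ℝ, ∀ x,
            ‖x‖ ^ k * (1 + ‖x‖) ^ m * ‖iteratedFDeriv ℝ i gr x‖ ≤ C := by
          intro i hi
          obtain ⟨C1, hC1⟩ := ih i (by simpa using hi) k
          obtain ⟨C2, hC2⟩ := ih i (by simpa using hi) (k + m)
          refine ⟨2 ^ (m - 1) * (C1 + C2), fun x => ?_⟩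
          have := add_pow_le zero_le_one (norm_nonneg x) m
          calc _ ≤ ‖x‖ ^ k * (2 ^ (m - 1) * (1 ^ m + ‖x‖ ^ m)) * ‖iteratedFDeriv ℝ i gr x‖ := by
                gcongr
            _ = 2 ^ (m - 1) * (‖x‖ ^ k * ‖iteratedFDeriv ℝ i gr x‖
                + ‖x‖ ^ (k + m) * ‖iteratedFDeriv ℝ i gr x‖) := by rw [one_pow, pow_add]; ring
            _ ≤ _ := by gcongr; exacts [hC1 x, hC2 x]
        choose! C hC using hi
        refine ⟨∑ i ∈ Finset.range (n + 1), (n.choose i : ℝ) * (D * C i), fun x => ?_⟩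
        rw [← norm_iteratedFDeriv_fderiv, hfd]
        have := norm_iteratedFDeriv_smul_le (𝕜 := ℝ) (n := n) (N := ∞) hgr
          L.contDiff (x := x) (by exact_mod_cast le_top)
        refine (mul_le_mul_of_nonneg_left this (by positivity)).trans ?_
        rw [Finset.mul_sum]
        refine Finset.sum_le_sum fun i hi => ?_
        calc _ ≤ ‖x‖ ^ k * ((n.choose i : ℝ) * ‖iteratedFDeriv ℝ i gr x‖ *
              (D * (1 + ‖x‖) ^ m)) := by
              gcongr; exact hLb (n - i) (Nat.sub_le _ _) x
          _ = (n.choose i : ℝ) * (D * (‖x‖ ^ k * (1 + ‖x‖) ^ m * ‖iteratedFDeriv ℝ i gr x‖)) := by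
              ring
          _ ≤ _ := by gcongr; exact hC i hi x
  let G : 𝓢(E, ℝ) := ⟨gr, hgr, fun k n => hdec n k⟩
  exact ⟨SchwartzMap.postcompCLM (𝕜 := ℝ) Complex.ofRealCLM G, fun x => rfl⟩

end

section

/-! ### Coordinates, derivatives and the symplectic Fourier transform -/

/-- The standard basis vectors of the plane. -/
abbrev e (i : Fin 2) : Plane := EuclideanSpace.single i 1

theorem hasTemperateGrowth_coord (i : Fin 2) :
    Function.HasTemperateGrowth fun x : Plane => (x i : ℂ) :=
  (Complex.ofRealCLM.comp (EuclideanSpace.proj (𝕜 := ℝ) i)).hasTemperateGrowth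

/-- Multiplication of Schwartz functions by the coordinate `xᵢ`. -/
def coord (i : Fin 2) : 𝓢(Plane, ℂ) →L[ℂ] 𝓢(Plane, ℂ) :=
  SchwartzMap.smulLeftCLM ℂ fun x : Plane => (x i : ℂ)

@[simp]
theorem coord_apply (i : Fin 2) (f : 𝓢(Plane, ℂ)) (x : Plane) : coord i f x = x i * f x := by
  simp [coord, SchwartzMap.smulLeftCLM_apply_apply (hasTemperateGrowth_coord i)]

/-- The partial derivative `∂ᵢ` on Schwartz functions. -/
def pd (i : Fin 2) : 𝓢(Plane, ℂ) →L[ℂ] 𝓢(Plane, ℂ) :=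
  LineDeriv.lineDerivOpCLM ℂ 𝓢(Plane, ℂ) (e i)

theorem pd_apply (i : Fin 2) (f : 𝓢(Plane, ℂ)) : pd i f = ∂_{e i} f := rfl

theorem pd_eq_fderiv (i : Fin 2) (f : 𝓢(Plane, ℂ)) (x : Plane) : pd i f x = fderiv ℝ f x (e i) :=
  SchwartzMap.lineDerivOp_apply_eq_fderiv _ _ _

theorem eq_sum_e (x : Plane) : x = x 0 • e 0 + x 1 • e 1 := by
  ext i; fin_cases i <;> simp [e]

theorem fderiv_eq_sum_pd (f : 𝓢(Plane, ℂ)) (x : Plane) :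
    fderiv ℝ f x = ∑ i, (EuclideanSpace.proj (𝕜 := ℝ) i).smulRight (pd i f x) := by
  ext y
  conv_lhs => rw [eq_sum_e y]
  simp [pd_eq_fderiv]

variable (θ : ℝ)

/-- The constant `2i/θ` of the twist. -/
def tc : ℂ := 2 * Complex.I / θ

theorem twist_eq (u v : Plane) :
    twist θ u v = Complex.exp (-tc θ * (u 1 * v 0 - u 0 * v 1)) := by
  simp [twist, tc]

theorem tc_ne_zero [hθ : Fact (0 < θ)] : tc θ ≠ 0 := by
  have : (θ : ℂ) ≠ 0 := by exact_mod_cast hθ.out.ne'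
  simp [tc, this]

section
variable [hθ : Fact (0 < θ)]

/-- The symplectic Fourier transform `v ↦ (πθ)⁻² ∫ f(y) exp (-(2i/θ)(y₂v₁ - y₁v₂)) dy`, whose value
at `v` is the coefficient of the translation by `v` in the operator `𝓛(f)`. -/
def coeff : 𝓢(Plane, ℂ) →L[ℂ] 𝓢(Plane, ℂ) :=
  ((1 / (Real.pi * θ) : ℂ) ^ 2) •
    (SchwartzMap.compCLMOfContinuousLinearEquiv ℂ (freqEquiv θ hθ.out.ne')).comp
      (SchwartzMap.fourierTransformCLM ℂ)

theorem coeff_apply' (f : 𝓢(Plane, ℂ)) (v : Plane) :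
    coeff θ f v = (1 / (Real.pi * θ) : ℂ) ^ 2 * (𝓕 f) (freq θ v) := by
  simp [coeff, freqEquiv_apply, SchwartzMap.fourier_coe]

theorem coeff_apply (f : 𝓢(Plane, ℂ)) (v : Plane) :
    coeff θ f v = (1 / (Real.pi * θ) : ℂ) ^ 2 * ∫ y, f y * twist θ y v := by
  rw [coeff_apply', integral_twist, SchwartzMap.fourier_coe]

theorem coeff_surjective : Function.Surjective (coeff θ) := by
  intro h
  refine ⟨𝓕⁻ (((1 / (Real.pi * θ) : ℂ) ^ 2)⁻¹ • SchwartzMap.compCLMOfContinuousLinearEquiv ℂ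
    (freqEquiv θ hθ.out.ne').symm h), ?_⟩
  have h0 : ((1 / (Real.pi * θ) : ℂ) ^ 2) ≠ 0 := by
    have : (θ : ℂ) ≠ 0 := by exact_mod_cast hθ.out.ne'
    have : (Real.pi : ℂ) ≠ 0 := by exact_mod_cast Real.pi_ne_zero
    positivity
  ext v
  rw [coeff_apply', FourierTransform.fourier_fourierInv_eq, _root_.smul_apply, smul_eq_mul,
    mul_inv_cancel_left₀ h0, ← freqEquiv_apply θ hθ.out.ne']
  simp

theorem coeff_injective : Function.Injective (coeff θ) := by
  intro f g h
  have h0 : ((1 / (Real.pi * θ) : ℂ) ^ 2) ≠ 0 := by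
    have : (θ : ℂ) ≠ 0 := by exact_mod_cast hθ.out.ne'
    have : (Real.pi : ℂ) ≠ 0 := by exact_mod_cast Real.pi_ne_zero
    positivity
  have h2 : 𝓕 f = 𝓕 g := by
    ext w
    have := congrArg (fun F : 𝓢(Plane, ℂ) => F ((freqEquiv θ hθ.out.ne').symm w)) h
    simp only [coeff_apply', ← freqEquiv_apply θ hθ.out.ne',
      ContinuousLinearEquiv.apply_symm_apply] at this
    exact mul_left_cancel₀ h0 this
  rw [← FourierTransform.fourierInv_fourier_eq (E := 𝓢(Plane, ℂ)) (F := 𝓢(Plane, ℂ)) f, h2,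
    FourierTransform.fourierInv_fourier_eq]

theorem coeff_pd_zero (f : 𝓢(Plane, ℂ)) : coeff θ (pd 0 f) = -tc θ • coord 1 (coeff θ f) := by
  ext v
  have hg : Function.HasTemperateGrowth fun x : Plane => inner ℝ x (e 0) := by fun_prop
  have : (θ : ℂ) ≠ 0 := by exact_mod_cast hθ.out.ne'
  have : (Real.pi : ℂ) ≠ 0 := by exact_mod_cast Real.pi_ne_zero
  rw [coeff_apply', pd_apply, SchwartzMap.fourier_lineDerivOp_eq]
  rw [_root_.smul_apply, SchwartzMap.smulLeftCLM_apply_apply hg]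
  simp [coeff_apply', tc, freq, e, PiLp.inner_apply]
  field_simp

theorem coeff_pd_one (f : 𝓢(Plane, ℂ)) : coeff θ (pd 1 f) = tc θ • coord 0 (coeff θ f) := by
  ext v
  have hg : Function.HasTemperateGrowth fun x : Plane => inner ℝ x (e 1) := by fun_prop
  have : (θ : ℂ) ≠ 0 := by exact_mod_cast hθ.out.ne'
  have : (Real.pi : ℂ) ≠ 0 := by exact_mod_cast Real.pi_ne_zero
  rw [coeff_apply', pd_apply, SchwartzMap.fourier_lineDerivOp_eq]
  rw [_root_.smul_apply, SchwartzMap.smulLeftCLM_apply_apply hg]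
  simp [coeff_apply', tc, freq, e, PiLp.inner_apply]
  field_simp

theorem pd_coeff (i : Fin 2) (f : 𝓢(Plane, ℂ)) : pd i (coeff θ f) = coeff θ
    (-(2 * Real.pi * Complex.I) • SchwartzMap.smulLeftCLM ℂ (inner ℝ · (freq θ (e i))) f) := by
  rw [coeff, _root_.smul_apply, map_smul, pd_apply]
  simp only [ContinuousLinearMap.comp_apply, SchwartzMap.fourierTransformCLM_apply,
    _root_.smul_apply]
  rw [SchwartzMap.lineDerivOp_compCLMOfContinuousLinearEquiv, SchwartzMap.lineDerivOp_fourier_eq]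
  rfl

theorem pd_zero_coeff (f : 𝓢(Plane, ℂ)) : pd 0 (coeff θ f) = -tc θ • coeff θ (coord 1 f) := by
  rw [pd_coeff, ← map_smul (coeff θ)]
  congr 1
  ext x
  have hg : Function.HasTemperateGrowth fun x : Plane => inner ℝ x (freq θ (e 0)) := by fun_prop
  have : (θ : ℂ) ≠ 0 := by exact_mod_cast hθ.out.ne'
  have : (Real.pi : ℂ) ≠ 0 := by exact_mod_cast Real.pi_ne_zero
  rw [_root_.smul_apply, SchwartzMap.smulLeftCLM_apply_apply hg]
  simp [tc, freq, PiLp.inner_apply]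
  field_simp

theorem pd_one_coeff (f : 𝓢(Plane, ℂ)) : pd 1 (coeff θ f) = tc θ • coeff θ (coord 0 f) := by
  rw [pd_coeff, ← map_smul (coeff θ)]
  congr 1
  ext x
  have hg : Function.HasTemperateGrowth fun x : Plane => inner ℝ x (freq θ (e 1)) := by fun_prop
  have : (θ : ℂ) ≠ 0 := by exact_mod_cast hθ.out.ne'
  have : (Real.pi : ℂ) ≠ 0 := by exact_mod_cast Real.pi_ne_zero
  rw [_root_.smul_apply, SchwartzMap.smulLeftCLM_apply_apply hg]
  simp [tc, freq, PiLp.inner_apply]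
  field_simp

theorem moyalMul_eq (f : 𝓢(Plane, ℂ)) (g : Plane → ℂ) (x : Plane) :
    moyalMul θ f g x = ∫ v, coeff θ f v * (twist θ (-x) v * g (x + v)) := by
  rw [moyalMul, ← integral_const_mul]
  refine integral_congr_ae (Eventually.of_forall fun v => ?_)
  have e : ∫ u, f (x + u) * g (x + v) * twist θ u v
      = ∫ y, f y * g (x + v) * twist θ (y - x) v := by
    rw [← integral_add_left_eq_self (μ := (volume : Measure Plane))
      (fun y => f y * g (x + v) * twist θ (y - x) v) x]
    simp
  have e2 : ∫ y, f y * g (x + v) * twist θ (y - x) v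
      = (g (x + v) * twist θ (-x) v) * ∫ y, f y * twist θ y v := by
    rw [← integral_const_mul]
    refine integral_congr_ae (Eventually.of_forall fun y => ?_)
    simp only [twist_sub θ y x v]
    ring
  simp only [e, e2, coeff_apply]
  ring

theorem coeff_translate (κ : Plane) (f : 𝓢(Plane, ℂ)) (v : Plane) :
    coeff θ (translate κ f) v = twist θ (-κ) v * coeff θ f v := by
  simp only [coeff_apply, translate_apply]
  have h : ∫ y, f (y + κ) * twist θ y v = twist θ (-κ) v * ∫ y, f y * twist θ y v := by
    rw [← integral_sub_right_eq_self (fun y => f (y + κ) * twist θ y v) κ, ← integral_const_mul]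
    refine integral_congr_ae (Eventually.of_forall fun y => ?_)
    simp only [twist_sub θ y κ v, sub_add_cancel]
    ring
  rw [h]
  ring

end

end

section

variable (θ : ℝ)

/-! ### The twisted convolution of Schwartz functions -/

theorem exists_norm_le (f : 𝓢(Plane, ℂ)) : ∃ C, 0 ≤ C ∧ ∀ x, ‖f x‖ ≤ C :=
  ⟨_, apply_nonneg _ _, f.norm_le_seminorm ℝ⟩

theorem integrable_tconv (h φ : 𝓢(Plane, ℂ)) (x : Plane) :
    Integrable fun v => h v * (twist θ (-x) v * φ (x + v)) := by
  obtain ⟨C, -, hC⟩ := exists_norm_le φ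
  refine h.integrable.mul_bdd (c := C) ?_ (Eventually.of_forall fun v => ?_)
  · have h1 : Continuous fun v => twist θ (-x) v :=
      (continuous_twist θ).comp (Continuous.prodMk_right (-x))
    exact (h1.mul (φ.continuous.comp (continuous_const.add continuous_id))).aestronglyMeasurable
  · rw [norm_mul, norm_twist, one_mul]
    exact hC _

/-- Twisted convolutions decrease rapidly, because `|x|ᵏ` is bounded by a multiple of
`|x + v|ᵏ + |v|ᵏ`. -/
theorem tconv_decay (h φ : 𝓢(Plane, ℂ)) (k : ℕ) : ∃ C : ℝ, ∀ x : Plane,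
    ‖x‖ ^ k * ‖∫ v, h v * (twist θ (-x) v * φ (x + v))‖ ≤ C := by
  obtain ⟨C0, hC0, hφ0⟩ := exists_norm_le φ
  let Ck := SchwartzMap.seminorm ℝ k 0 φ
  have hφk : ∀ x, ‖x‖ ^ k * ‖φ x‖ ≤ Ck := φ.norm_pow_mul_le_seminorm ℝ k
  refine ⟨∫ v, 2 ^ (k - 1) * (Ck * ‖h v‖ + C0 * (‖v‖ ^ k * ‖h v‖)), fun x => ?_⟩
  have hI : Integrable fun v => 2 ^ (k - 1) * (Ck * ‖h v‖ + C0 * (‖v‖ ^ k * ‖h v‖)) :=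
    ((h.integrable.norm.const_mul _).add ((h.integrable_pow_mul volume k).const_mul _)).const_mul _
  calc _ ≤ ‖x‖ ^ k * ∫ v, ‖h v‖ * ‖φ (x + v)‖ := by
        gcongr
        refine (norm_integral_le_integral_norm _).trans_eq ?_
        simp only [norm_mul, norm_twist, one_mul]
    _ = ∫ v, ‖x‖ ^ k * (‖h v‖ * ‖φ (x + v)‖) := (integral_const_mul _ _).symm
    _ ≤ _ := by
      refine integral_mono_of_nonneg (Eventually.of_forall fun v => by positivity) hI
        (Eventually.of_forall fun v => ?_)
      have h1 : ‖x‖ ^ k ≤ 2 ^ (k - 1) * (‖x + v‖ ^ k + ‖v‖ ^ k) := by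
        refine le_trans ?_ (add_pow_le (norm_nonneg _) (norm_nonneg _) k)
        gcongr
        simpa using norm_sub_le (x + v) v
      calc _ ≤ 2 ^ (k - 1) * (‖x + v‖ ^ k + ‖v‖ ^ k) * (‖h v‖ * ‖φ (x + v)‖) :=
            mul_le_mul_of_nonneg_right h1 (by positivity)
        _ = 2 ^ (k - 1) * ((‖x + v‖ ^ k * ‖φ (x + v)‖) * ‖h v‖
            + ‖φ (x + v)‖ * (‖v‖ ^ k * ‖h v‖)) := by ring
        _ ≤ _ := mul_le_mul_of_nonneg_left (add_le_add
            (mul_le_mul_of_nonneg_right (hφk _) (norm_nonneg _))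
            (mul_le_mul_of_nonneg_right (hφ0 _) (by positivity))) (by positivity)

theorem hasFDerivAt_twist (v x : Plane) : HasFDerivAt (fun x => twist θ (-x) v)
    ((EuclideanSpace.proj (𝕜 := ℝ) (0 : Fin 2)).smulRight (-tc θ * v 1 * twist θ (-x) v)
      + (EuclideanSpace.proj (𝕜 := ℝ) (1 : Fin 2)).smulRight (tc θ * v 0 * twist θ (-x) v)) x := by
  have h1 : ∀ i : Fin 2, HasFDerivAt (fun x : Plane => (x i : ℂ))
      (Complex.ofRealCLM.comp (EuclideanSpace.proj (𝕜 := ℝ) i)) x := fun i =>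
    (Complex.ofRealCLM.comp (EuclideanSpace.proj (𝕜 := ℝ) i)).hasFDerivAt
  have h2 := ((((h1 1).fun_neg.mul_const (v 0 : ℂ)).fun_sub
    ((h1 0).fun_neg.mul_const (v 1 : ℂ))).const_mul (-tc θ)).cexp
  have h3 : (fun x : Plane => Complex.exp (-tc θ * (-(x 1 : ℂ) * v 0 - -(x 0 : ℂ) * v 1)))
      = fun x => twist θ (-x) v := by
    funext x; simp [twist_eq]
  have h4 : Complex.exp (-tc θ * (-(x 1 : ℂ) * v 0 - -(x 0 : ℂ) * v 1)) = twist θ (-x) v :=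
    congrFun h3 x
  rw [h3, h4] at h2
  refine h2.congr_fderiv ?_
  ext y
  simp
  ring

/-- The derivative of the integrand of a twisted convolution: differentiating the phase multiplies
the first factor by a coordinate. -/
theorem hasFDerivAt_tconv_integrand (h φ : 𝓢(Plane, ℂ)) (v x : Plane) :
    HasFDerivAt (fun x => h v * (twist θ (-x) v * φ (x + v)))
    ((EuclideanSpace.proj (𝕜 := ℝ) (0 : Fin 2)).smulRight
      ((-tc θ • coord 1 h) v * (twist θ (-x) v * φ (x + v))
        + h v * (twist θ (-x) v * pd 0 φ (x + v)))
      + (EuclideanSpace.proj (𝕜 := ℝ) (1 : Fin 2)).smulRight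
      ((tc θ • coord 0 h) v * (twist θ (-x) v * φ (x + v))
        + h v * (twist θ (-x) v * pd 1 φ (x + v)))) x := by
  have h1 : HasFDerivAt (fun x => φ (x + v)) (fderiv ℝ φ (x + v)) x := by
    have := (φ.hasFDerivAt (x + v)).comp x ((hasFDerivAt_id x).add_const v)
    simpa using! this
  refine (((hasFDerivAt_twist θ v x).mul h1).const_mul (h v)).congr_fderiv ?_
  rw [fderiv_eq_sum_pd]
  ext y
  simp [Fin.sum_univ_two]
  ring

/-- The partial derivatives of a twisted convolution are sums of twisted convolutions, one with the
derivative of the second factor and one with a coordinate multiple of the first. -/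
theorem hasFDerivAt_tconv (h φ : 𝓢(Plane, ℂ)) (x : Plane) :
    HasFDerivAt (fun x => ∫ v, h v * (twist θ (-x) v * φ (x + v)))
    ((EuclideanSpace.proj (𝕜 := ℝ) (0 : Fin 2)).smulRight
      ((∫ v, (-tc θ • coord 1 h) v * (twist θ (-x) v * φ (x + v)))
        + ∫ v, h v * (twist θ (-x) v * pd 0 φ (x + v)))
      + (EuclideanSpace.proj (𝕜 := ℝ) (1 : Fin 2)).smulRight
      ((∫ v, (tc θ • coord 0 h) v * (twist θ (-x) v * φ (x + v)))
        + ∫ v, h v * (twist θ (-x) v * pd 1 φ (x + v)))) x := by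
  obtain ⟨C, hC, hφ⟩ := exists_norm_le φ
  obtain ⟨C0, hC0, hφ0⟩ := exists_norm_le (pd 0 φ)
  obtain ⟨C1, hC1, hφ1⟩ := exists_norm_le (pd 1 φ)
  let l : Fin 2 → Plane →L[ℝ] ℝ := fun i => EuclideanSpace.proj (𝕜 := ℝ) i
  let T : Fin 2 → ℂ →L[ℝ] (Plane →L[ℝ] ℂ) := fun i =>
    ContinuousLinearMap.smulRightL ℝ Plane ℂ (l i)
  let F0 : Plane → Plane → ℂ := fun x v => (-tc θ • coord 1 h) v * (twist θ (-x) v * φ (x + v))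
        + h v * (twist θ (-x) v * pd 0 φ (x + v))
  let F1 : Plane → Plane → ℂ := fun x v => (tc θ • coord 0 h) v * (twist θ (-x) v * φ (x + v))
        + h v * (twist θ (-x) v * pd 1 φ (x + v))
  have hI0 : ∀ x, Integrable (F0 x) := fun x =>
    (integrable_tconv θ _ φ x).add (integrable_tconv θ h _ x)
  have hI1 : ∀ x, Integrable (F1 x) := fun x =>
    (integrable_tconv θ _ φ x).add (integrable_tconv θ h _ x)
  let bound : Plane → ℝ := fun v => ‖T 0‖ * (‖(-tc θ • coord 1 h) v‖ * C + ‖h v‖ * C0)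
    + ‖T 1‖ * (‖(tc θ • coord 0 h) v‖ * C + ‖h v‖ * C1)
  have hbound : Integrable bound :=
    ((((-tc θ • coord 1 h).integrable.norm.mul_const C).add
      (h.integrable.norm.mul_const C0)).const_mul _).add
    ((((tc θ • coord 0 h).integrable.norm.mul_const C).add
      (h.integrable.norm.mul_const C1)).const_mul _)
  have key := hasFDerivAt_integral_of_dominated_of_fderiv_le (𝕜 := ℝ)
    (F := fun x v => h v * (twist θ (-x) v * φ (x + v)))
    (F' := fun x v => T 0 (F0 x v) + T 1 (F1 x v)) (x₀ := x) (s := Set.univ) (bound := bound)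
    (μ := (volume : Measure Plane)) univ_mem
    (Eventually.of_forall fun x => (integrable_tconv θ h φ x).aestronglyMeasurable)
    (integrable_tconv θ h φ x)
    (((T 0).integrable_comp (hI0 x)).add ((T 1).integrable_comp (hI1 x))).aestronglyMeasurable
    (Eventually.of_forall fun v x _ => by
      refine (norm_add_le _ _).trans (add_le_add ?_ ?_)
      · refine ((T 0).le_opNorm _).trans (mul_le_mul_of_nonneg_left ?_ (T 0).opNorm_nonneg)
        refine (norm_add_le _ _).trans (add_le_add ?_ ?_)
        all_goals
          rw [norm_mul, norm_mul, norm_twist, one_mul]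
          gcongr
          apply_assumption
      · refine ((T 1).le_opNorm _).trans (mul_le_mul_of_nonneg_left ?_ (T 1).opNorm_nonneg)
        refine (norm_add_le _ _).trans (add_le_add ?_ ?_)
        all_goals
          rw [norm_mul, norm_mul, norm_twist, one_mul]
          gcongr
          apply_assumption)
    hbound
    (Eventually.of_forall fun v x _ => hasFDerivAt_tconv_integrand θ h φ v x)
  refine key.congr_fderiv ?_
  rw [integral_add ((T 0).integrable_comp (hI0 x)) ((T 1).integrable_comp (hI1 x)),
    (T 0).integral_comp_comm (hI0 x), (T 1).integral_comp_comm (hI1 x),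
    ← integral_add (integrable_tconv θ _ φ x) (integrable_tconv θ h _ x),
    ← integral_add (integrable_tconv θ _ φ x) (integrable_tconv θ h _ x)]
  rfl

/-- The span of the twisted convolutions is stable under partial derivatives, so it consists of
Schwartz functions. -/
theorem exists_tconv (h φ : 𝓢(Plane, ℂ)) : ∃ f : 𝓢(Plane, ℂ), ∀ x,
    f x = ∫ v, h v * (twist θ (-x) v * φ (x + v)) := by
  let K : 𝓢(Plane, ℂ) → 𝓢(Plane, ℂ) → Plane → ℂ := fun h φ x =>
    ∫ v, h v * (twist θ (-x) v * φ (x + v))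
  let S : Set (Plane → ℂ) := Set.range fun p : 𝓢(Plane, ℂ) × 𝓢(Plane, ℂ) => K p.1 p.2
  have hK : ∀ h φ, K h φ ∈ Submodule.span ℂ S := fun h φ => Submodule.subset_span ⟨(h, φ), rfl⟩
  refine exists_schwartz_of_span (fun i : Fin 2 => EuclideanSpace.proj (𝕜 := ℝ) i) S ?_ ?_ (hK h φ)
  · rintro _ ⟨⟨h, φ⟩, rfl⟩ k
    exact tconv_decay θ h φ k
  · rintro _ ⟨⟨h, φ⟩, rfl⟩
    refine ⟨![K (-tc θ • coord 1 h) φ + K h (pd 0 φ), K (tc θ • coord 0 h) φ + K h (pd 1 φ)],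
      ?_, fun x => ?_⟩
    · intro i
      fin_cases i <;> exact Submodule.add_mem _ (hK _ _) (hK _ _)
    · rw [Fin.sum_univ_two]
      exact hasFDerivAt_tconv θ h φ x

/-- The twisted convolution `x ↦ ∫ h(v) exp ((2i/θ)(x₂v₁ - x₁v₂)) φ(x + v) dv`. -/
def tconv (h φ : 𝓢(Plane, ℂ)) : 𝓢(Plane, ℂ) := (exists_tconv θ h φ).choose

theorem tconv_apply (h φ : 𝓢(Plane, ℂ)) (x : Plane) :
    tconv θ h φ x = ∫ v, h v * (twist θ (-x) v * φ (x + v)) := (exists_tconv θ h φ).choose_spec x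

theorem tconv_add_left (h₁ h₂ φ : 𝓢(Plane, ℂ)) :
    tconv θ (h₁ + h₂) φ = tconv θ h₁ φ + tconv θ h₂ φ := by
  ext x
  simp only [_root_.add_apply, tconv_apply, add_mul]
  exact integral_add (integrable_tconv θ h₁ φ x) (integrable_tconv θ h₂ φ x)

theorem tconv_add_right (h φ₁ φ₂ : 𝓢(Plane, ℂ)) :
    tconv θ h (φ₁ + φ₂) = tconv θ h φ₁ + tconv θ h φ₂ := by
  ext x
  simp only [_root_.add_apply, tconv_apply, mul_add]
  exact integral_add (integrable_tconv θ h φ₁ x) (integrable_tconv θ h φ₂ x)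

theorem tconv_smul_left (c : ℂ) (h φ : 𝓢(Plane, ℂ)) :
    tconv θ (c • h) φ = c • tconv θ h φ := by
  ext x
  simp only [_root_.smul_apply, tconv_apply, smul_eq_mul, mul_assoc]
  exact integral_const_mul _ _

theorem tconv_smul_right (c : ℂ) (h φ : 𝓢(Plane, ℂ)) :
    tconv θ h (c • φ) = c • tconv θ h φ := by
  ext x
  simp only [_root_.smul_apply, tconv_apply, smul_eq_mul]
  rw [← integral_const_mul]
  congr 1
  funext v
  ring

theorem pd_tconv_zero (h φ : 𝓢(Plane, ℂ)) :
    pd 0 (tconv θ h φ) = tconv θ h (pd 0 φ) - tc θ • tconv θ (coord 1 h) φ := by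
  ext x
  have : ⇑(tconv θ h φ) = fun x => ∫ v, h v * (twist θ (-x) v * φ (x + v)) :=
    funext (tconv_apply θ h φ)
  rw [pd_eq_fderiv, this, (hasFDerivAt_tconv θ h φ x).fderiv]
  simp only [← tconv_apply, tconv_smul_left]
  simp [e, sub_eq_neg_add]

theorem pd_tconv_one (h φ : 𝓢(Plane, ℂ)) :
    pd 1 (tconv θ h φ) = tconv θ h (pd 1 φ) + tc θ • tconv θ (coord 0 h) φ := by
  ext x
  have : ⇑(tconv θ h φ) = fun x => ∫ v, h v * (twist θ (-x) v * φ (x + v)) :=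
    funext (tconv_apply θ h φ)
  rw [pd_eq_fderiv, this, (hasFDerivAt_tconv θ h φ x).fderiv]
  simp only [← tconv_apply, tconv_smul_left]
  simp [e, add_comm]

theorem coord_tconv (i : Fin 2) (h φ : 𝓢(Plane, ℂ)) :
    coord i (tconv θ h φ) = tconv θ h (coord i φ) - tconv θ (coord i h) φ := by
  ext x
  rw [coord_apply, _root_.sub_apply, tconv_apply, tconv_apply, tconv_apply, ← integral_const_mul,
    ← integral_sub (integrable_tconv θ h (coord i φ) x) (integrable_tconv θ (coord i h) φ x)]
  congr 1
  funext v
  simp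
  ring

end

section

/-! ### Modulated translates of Schwartz functions -/

section
variable {E : Type*} [NormedAddCommGroup E] [InnerProductSpace ℝ E]

theorem hasFDerivAt_cexp_mul_I (l : E →L[ℝ] ℝ) (x : E) :
    HasFDerivAt (fun x => Complex.exp (l x * Complex.I))
      (l.smulRight (Complex.I * Complex.exp (l x * Complex.I))) x := by
  have h1 : HasFDerivAt (fun x => (l x : ℂ)) (Complex.ofRealCLM.comp l) x :=
    (Complex.ofRealCLM.comp l).hasFDerivAt
  refine ((h1.mul_const Complex.I).cexp).congr_fderiv ?_
  ext y
  simp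
  ring

theorem hasFDerivAt_wave (l : E →L[ℝ] ℝ) (τ : E) (φ : 𝓢(E, ℂ)) (x : E) :
    HasFDerivAt (fun x => Complex.exp (l x * Complex.I) * φ (x + τ))
      (l.smulRight (Complex.I * (Complex.exp (l x * Complex.I) * φ (x + τ)))
        + Complex.exp (l x * Complex.I) • fderiv ℝ φ (x + τ)) x := by
  have h1 : HasFDerivAt (fun x => φ (x + τ)) (fderiv ℝ φ (x + τ)) x := by
    have := (φ.hasFDerivAt (x + τ)).comp x ((hasFDerivAt_id x).add_const τ)
    simpa using! this
  refine ((hasFDerivAt_cexp_mul_I l x).mul h1).congr_fderiv ?_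
  ext y
  simp
  ring

variable [FiniteDimensional ℝ E]

/-- Modulated translates decrease rapidly, and their span is stable under partial derivatives. -/
theorem exists_wave (l : E →L[ℝ] ℝ) (τ : E) (φ : 𝓢(E, ℂ)) : ∃ f : 𝓢(E, ℂ), ∀ x,
    f x = Complex.exp (l x * Complex.I) * φ (x + τ) := by
  let b := stdOrthonormalBasis ℝ E
  let W : 𝓢(E, ℂ) → E → ℂ := fun φ x => Complex.exp (l x * Complex.I) * φ (x + τ)
  have hW : ∀ φ, W φ ∈ Submodule.span ℂ (Set.range W) := fun φ =>
    Submodule.subset_span ⟨φ, rfl⟩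
  refine exists_schwartz_of_span (fun i => innerSL ℝ (b i)) (Set.range W) ?_ ?_ (hW φ)
  · rintro _ ⟨φ, rfl⟩ k
    refine ⟨2 ^ (k - 1) * (SchwartzMap.seminorm ℝ k 0 φ
      + ‖τ‖ ^ k * SchwartzMap.seminorm ℝ 0 0 φ), fun x => ?_⟩
    have h1 : ‖x‖ ^ k ≤ 2 ^ (k - 1) * (‖x + τ‖ ^ k + ‖τ‖ ^ k) := by
      refine le_trans ?_ (add_pow_le (norm_nonneg _) (norm_nonneg _) k)
      gcongr
      simpa using norm_sub_le (x + τ) τ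
    simp only [W]
    rw [norm_mul, Complex.norm_exp_ofReal_mul_I, one_mul]
    calc _ ≤ 2 ^ (k - 1) * (‖x + τ‖ ^ k + ‖τ‖ ^ k) * ‖φ (x + τ)‖ := by gcongr
      _ = 2 ^ (k - 1) * (‖x + τ‖ ^ k * ‖φ (x + τ)‖ + ‖τ‖ ^ k * ‖φ (x + τ)‖) := by ring
      _ ≤ _ := by
        gcongr
        · exact φ.norm_pow_mul_le_seminorm ℝ k _
        · exact φ.norm_le_seminorm ℝ _
  · rintro _ ⟨φ, rfl⟩
    refine ⟨fun i => (Complex.I * l (b i)) • W φ + W (∂_{b i} φ), fun i =>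
      Submodule.add_mem _ (Submodule.smul_mem _ _ (hW _)) (hW _), fun x => ?_⟩
    refine (hasFDerivAt_wave l τ φ x).congr_fderiv ?_
    ext y
    conv_lhs => rw [← b.sum_repr' y]
    simp only [map_sum, map_smul, _root_.sum_apply,
      ContinuousLinearMap.smulRight_apply]
    refine Finset.sum_congr rfl fun i _ => ?_
    simp only [W, SchwartzMap.lineDerivOp_apply_eq_fderiv, innerSL_apply_apply ℝ, _root_.add_apply,
      _root_.smul_apply, ContinuousLinearMap.smulRight_apply, Pi.add_apply, Pi.smul_apply,
      smul_eq_mul, Complex.real_smul]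
    ring

/-- The Schwartz function `x ↦ exp (i l(x)) φ(x + τ)`. -/
def wave (l : E →L[ℝ] ℝ) (τ : E) (φ : 𝓢(E, ℂ)) : 𝓢(E, ℂ) := (exists_wave l τ φ).choose

theorem wave_apply (l : E →L[ℝ] ℝ) (τ : E) (φ : 𝓢(E, ℂ)) (x : E) :
    wave l τ φ x = Complex.exp (l x * Complex.I) * φ (x + τ) := (exists_wave l τ φ).choose_spec x

theorem lineDerivOp_wave (l : E →L[ℝ] ℝ) (τ : E) (φ : 𝓢(E, ℂ)) (m : E) :
    ∂_{m} (wave l τ φ) = (Complex.I * l m) • wave l τ φ + wave l τ (∂_{m} φ) := by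
  ext x
  have : ⇑(wave l τ φ) = fun x => Complex.exp (l x * Complex.I) * φ (x + τ) :=
    funext (wave_apply l τ φ)
  rw [SchwartzMap.lineDerivOp_apply_eq_fderiv, this, (hasFDerivAt_wave l τ φ x).fderiv]
  simp [wave_apply, SchwartzMap.lineDerivOp_apply_eq_fderiv]
  ring

end

/-! ### The Moyal product of Schwartz functions -/

variable (θ : ℝ)

/-- The linear form `x ↦ (2/θ)(x₂v₁ - x₁v₂)`, the phase of `twist θ (-x) v`. -/
def phase (v : Plane) : Plane →L[ℝ] ℝ :=
  (2 / θ * v 0) • EuclideanSpace.proj (𝕜 := ℝ) (1 : Fin 2)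
    - (2 / θ * v 1) • EuclideanSpace.proj (𝕜 := ℝ) (0 : Fin 2)

theorem phase_apply (v x : Plane) : phase θ v x = 2 / θ * (x 1 * v 0 - x 0 * v 1) := by
  simp [phase]
  ring

theorem twist_neg_eq (x v : Plane) : twist θ (-x) v = Complex.exp (phase θ v x * Complex.I) := by
  rw [twist_eq, phase_apply]
  simp [tc]
  ring_nf

theorem twist_neg_left_eq (x v : Plane) :
    twist θ (-x) v = Complex.exp (phase θ (-x) v * Complex.I) := by
  rw [twist_eq, phase_apply]
  simp [tc]
  ring_nf

/-- The action of the translation by `v`, twisted by a phase, on Schwartz functions. -/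
def shiftS (v : Plane) (φ : 𝓢(Plane, ℂ)) : 𝓢(Plane, ℂ) := wave (phase θ v) v φ

theorem shiftS_apply (v : Plane) (φ : 𝓢(Plane, ℂ)) (x : Plane) :
    shiftS θ v φ x = twist θ (-x) v * φ (x + v) := by
  rw [shiftS, wave_apply, twist_neg_eq]

theorem integral_pd_mul (h φ : 𝓢(Plane, ℂ)) (i : Fin 2) :
    ∫ v, pd i h v * φ v = -∫ v, h v * pd i φ v := by
  rw [pd_apply, pd_apply, SchwartzMap.integral_mul_lineDerivOp_right_eq_neg_left, neg_neg]

/-- Integration by parts in a twisted convolution. -/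
theorem tconv_pd (i : Fin 2) (h φ : 𝓢(Plane, ℂ)) (x : Plane) : tconv θ (pd i h) φ x
    = -(Complex.I * phase θ (-x) (e i)) * tconv θ h φ x - tconv θ h (pd i φ) x := by
  let W : 𝓢(Plane, ℂ) → 𝓢(Plane, ℂ) := wave (phase θ (-x)) x
  have hW : ∀ φ v, W φ v = twist θ (-x) v * φ (x + v) := fun φ v => by
    rw [wave_apply, twist_neg_left_eq, add_comm x v]
  have hI : ∀ φ, Integrable fun v => h v * W φ v := fun φ => by
    simpa only [hW] using integrable_tconv θ h φ x
  simp only [tconv_apply, ← hW]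
  rw [integral_pd_mul, pd_apply, lineDerivOp_wave]
  simp only [_root_.add_apply, _root_.smul_apply, mul_add, smul_eq_mul]
  rw [integral_add _ (hI _)]
  · simp only [mul_left_comm (h _)]
    rw [integral_const_mul]
    simp only [W, pd_apply]
    ring
  · simp only [mul_left_comm (h _)]
    exact (hI φ).const_mul _

theorem tconv_pd_zero (h φ : 𝓢(Plane, ℂ)) : tconv θ (pd 0 h) φ
    = -tc θ • coord 1 (tconv θ h φ) - tconv θ h (pd 0 φ) := by
  ext x
  rw [tconv_pd]
  simp [phase_apply, e, tc]
  ring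

theorem tconv_pd_one (h φ : 𝓢(Plane, ℂ)) : tconv θ (pd 1 h) φ
    = tc θ • coord 0 (tconv θ h φ) - tconv θ h (pd 1 φ) := by
  ext x
  rw [tconv_pd]
  simp [phase_apply, e, tc]
  ring

variable [hθ : Fact (0 < θ)]

/-- The Moyal product of two Schwartz functions. -/
def mstar (f g : 𝓢(Plane, ℂ)) : 𝓢(Plane, ℂ) := tconv θ (coeff θ f) g

theorem mstar_apply (f g : 𝓢(Plane, ℂ)) (x : Plane) : mstar θ f g x = moyalMul θ f g x := by
  rw [mstar, tconv_apply, moyalMul_eq]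

theorem leftMul_toLp (f g : 𝓢(Plane, ℂ)) :
    leftMul θ f (g.toLp 2 volume) = (mstar θ f g).toLp 2 volume := by
  rw [leftMul_apply]
  refine (MemLp.toLp_eq_toLp_iff _ _).2 ?_
  refine Eventually.of_forall fun x => ?_
  simp only [mstar_apply, moyalMul_eq]
  refine integral_congr_ae ?_
  filter_upwards [(measurePreserving_add_left volume x).quasiMeasurePreserving.ae
    (g.coeFn_toLp 2 volume)] with v hv
  rw [hv]

theorem mstar_add_left (f₁ f₂ g : 𝓢(Plane, ℂ)) :
    mstar θ (f₁ + f₂) g = mstar θ f₁ g + mstar θ f₂ g := by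
  rw [mstar, map_add, tconv_add_left]; rfl

theorem mstar_smul_left (c : ℂ) (f g : 𝓢(Plane, ℂ)) : mstar θ (c • f) g = c • mstar θ f g := by
  rw [mstar, map_smul, tconv_smul_left]; rfl

theorem mstar_add_right (f g₁ g₂ : 𝓢(Plane, ℂ)) :
    mstar θ f (g₁ + g₂) = mstar θ f g₁ + mstar θ f g₂ := tconv_add_right _ _ _ _

theorem mstar_smul_right (c : ℂ) (f g : 𝓢(Plane, ℂ)) : mstar θ f (c • g) = c • mstar θ f g :=
  tconv_smul_right _ _ _ _

theorem mstar_sub_left (f₁ f₂ g : 𝓢(Plane, ℂ)) :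
    mstar θ (f₁ - f₂) g = mstar θ f₁ g - mstar θ f₂ g := by
  rw [sub_eq_add_neg, mstar_add_left, ← neg_one_smul ℂ f₂, mstar_smul_left, neg_one_smul,
    ← sub_eq_add_neg]

theorem mstar_sub_right (f g₁ g₂ : 𝓢(Plane, ℂ)) :
    mstar θ f (g₁ - g₂) = mstar θ f g₁ - mstar θ f g₂ := by
  rw [sub_eq_add_neg, mstar_add_right, ← neg_one_smul ℂ g₂, mstar_smul_right, neg_one_smul,
    ← sub_eq_add_neg]

theorem mstar_zero_left (g : 𝓢(Plane, ℂ)) : mstar θ 0 g = 0 := by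
  simpa using mstar_smul_left θ 0 0 g

theorem mstar_zero_right (f : 𝓢(Plane, ℂ)) : mstar θ f 0 = 0 := by
  simpa using mstar_smul_right θ 0 f 0

/-- Leibniz rule. -/
theorem pd_mstar (i : Fin 2) (f g : 𝓢(Plane, ℂ)) :
    pd i (mstar θ f g) = mstar θ (pd i f) g + mstar θ f (pd i g) := by
  fin_cases i
  · simp only [mstar, Fin.zero_eta, coeff_pd_zero, pd_tconv_zero, tconv_smul_left]
    module
  · simp only [mstar, Fin.mk_one, coeff_pd_one, pd_tconv_one, tconv_smul_left]
    module

theorem mstar_coord_zero_right (f g : 𝓢(Plane, ℂ)) : mstar θ f (coord 0 g)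
    = coord 0 (mstar θ f g) + (tc θ)⁻¹ • mstar θ (pd 1 f) g := by
  simp only [mstar, coeff_pd_one, tconv_smul_left, coord_tconv, smul_smul,
    inv_mul_cancel₀ (tc_ne_zero θ), one_smul]
  module

theorem mstar_coord_one_right (f g : 𝓢(Plane, ℂ)) : mstar θ f (coord 1 g)
    = coord 1 (mstar θ f g) - (tc θ)⁻¹ • mstar θ (pd 0 f) g := by
  have h : tconv θ (coord 1 (coeff θ f)) g = -(tc θ)⁻¹ • tconv θ (coeff θ (pd 0 f)) g := by
    rw [coeff_pd_zero, tconv_smul_left, smul_smul, neg_mul_neg, inv_mul_cancel₀ (tc_ne_zero θ),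
      one_smul]
  simp only [mstar, coord_tconv, h]
  module

theorem mstar_coord_zero_left (f g : 𝓢(Plane, ℂ)) : mstar θ (coord 0 f) g
    = coord 0 (mstar θ f g) - (tc θ)⁻¹ • mstar θ f (pd 1 g) := by
  have h : coeff θ (coord 0 f) = (tc θ)⁻¹ • pd 1 (coeff θ f) := by
    rw [pd_one_coeff, smul_smul, inv_mul_cancel₀ (tc_ne_zero θ), one_smul]
  simp only [mstar, h, tconv_smul_left, tconv_pd_one, smul_sub, smul_smul,
    inv_mul_cancel₀ (tc_ne_zero θ), one_smul]

theorem mstar_coord_one_left (f g : 𝓢(Plane, ℂ)) : mstar θ (coord 1 f) g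
    = coord 1 (mstar θ f g) + (tc θ)⁻¹ • mstar θ f (pd 0 g) := by
  have h : coeff θ (coord 1 f) = -(tc θ)⁻¹ • pd 0 (coeff θ f) := by
    rw [pd_zero_coeff, smul_smul, neg_mul_neg, inv_mul_cancel₀ (tc_ne_zero θ), one_smul]
  simp only [mstar, h, tconv_smul_left, tconv_pd_zero, smul_sub, smul_smul, neg_mul_neg,
    inv_mul_cancel₀ (tc_ne_zero θ), one_smul]
  module

end

section

variable (θ : ℝ)

/-! ### Twisted translations and the integrated form of the left regular representation -/

theorem continuous_twist_neg_left (v : Plane) : Continuous fun x => twist θ (-x) v :=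
  (continuous_twist θ).comp (continuous_neg.prodMk continuous_const)

theorem memLp_shift (v : Plane) (ψ : L2) :
    MemLp (fun x => twist θ (-x) v * ψ (x + v)) 2 (volume : Measure Plane) := by
  have hψ : MemLp (fun x => ψ (x + v)) 2 (volume : Measure Plane) :=
    (Lp.memLp ψ).comp_measurePreserving (measurePreserving_add_right volume v)
  refine hψ.of_le ((continuous_twist_neg_left θ v).aestronglyMeasurable.mul
    hψ.aestronglyMeasurable) (Eventually.of_forall fun x => ?_)
  rw [norm_mul, norm_twist, one_mul]

/-- The twisted translation `(V(v) ψ)(x) = exp ((2i/θ)(x₂v₁ - x₁v₂)) ψ(x + v)`, an isometry of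
`L²(ℝ²)`. It is left Moyal multiplication by a plane wave. -/
def shift (v : Plane) : L2 →ₗᵢ[ℂ] L2 where
  toFun ψ := (memLp_shift θ v ψ).toLp _
  map_add' ψ χ := by
    rw [← MemLp.toLp_add, MemLp.toLp_eq_toLp_iff]
    filter_upwards [(measurePreserving_add_right volume v).quasiMeasurePreserving.ae
      (Lp.coeFn_add ψ χ)] with x hx
    simp only [hx, Pi.add_apply, mul_add]
  map_smul' c ψ := by
    rw [RingHom.id_apply, ← MemLp.toLp_const_smul, MemLp.toLp_eq_toLp_iff]
    filter_upwards [(measurePreserving_add_right volume v).quasiMeasurePreserving.ae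
      (Lp.coeFn_smul c ψ)] with x hx
    simp only [hx, Pi.smul_apply, smul_eq_mul, mul_left_comm]
  norm_map' ψ := by
    rw [LinearMap.coe_mk, AddHom.coe_mk, Lp.norm_toLp, Lp.norm_def]
    congr 1
    have h1 : eLpNorm (fun x => twist θ (-x) v * ψ (x + v)) 2 (volume : Measure Plane)
        = eLpNorm (fun x => ψ (x + v)) 2 volume :=
      eLpNorm_congr_norm_ae (Eventually.of_forall fun x => by
        rw [norm_mul, norm_twist, one_mul])
    rw [h1]
    exact eLpNorm_comp_measurePreserving (Lp.aestronglyMeasurable ψ)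
      (measurePreserving_add_right volume v)

theorem coeFn_shift (v : Plane) (ψ : L2) :
    shift θ v ψ =ᵐ[volume] fun x => twist θ (-x) v * ψ (x + v) :=
  (memLp_shift θ v ψ).coeFn_toLp

theorem shift_toLp (v : Plane) (φ : 𝓢(Plane, ℂ)) :
    shift θ v (φ.toLp 2 volume) = (shiftS θ v φ).toLp 2 volume := by
  refine Lp.ext ?_
  filter_upwards [coeFn_shift θ v (φ.toLp 2 volume), (shiftS θ v φ).coeFn_toLp 2 volume,
    (measurePreserving_add_right volume v).quasiMeasurePreserving.ae (φ.coeFn_toLp 2 volume)]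
    with x h1 h2 h3
  rw [h1, h2, h3, shiftS_apply]

theorem shift_zero (ψ : L2) : shift θ 0 ψ = ψ := by
  refine Lp.ext ?_
  filter_upwards [coeFn_shift θ 0 ψ] with x h1
  rw [h1]
  simp [twist]

theorem shift_shift (v w : Plane) (ψ : L2) :
    shift θ v (shift θ w ψ) = twist θ (-v) w • shift θ (v + w) ψ := by
  refine Lp.ext ?_
  filter_upwards [coeFn_shift θ v (shift θ w ψ), coeFn_shift θ (v + w) ψ,
    Lp.coeFn_smul (twist θ (-v) w) (shift θ (v + w) ψ),
    (measurePreserving_add_right volume v).quasiMeasurePreserving.ae (coeFn_shift θ w ψ)]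
    with x h1 h2 h3 h4
  rw [h1, h3, Pi.smul_apply, h2, h4, smul_eq_mul, ← add_assoc, ← mul_assoc, ← mul_assoc]
  congr 1
  simp only [twist_eq, ← Complex.exp_add]
  congr 1
  simp
  ring

theorem shift_neg_shift (v : Plane) (ψ : L2) : shift θ (-v) (shift θ v ψ) = ψ := by
  rw [shift_shift, neg_add_cancel, shift_zero]
  simp [twist, mul_comm]

theorem shift_shift_neg (v : Plane) (ψ : L2) : shift θ v (shift θ (-v) ψ) = ψ := by
  simpa using shift_neg_shift θ (-v) ψ

theorem inner_shift_right (v : Plane) (χ ψ : L2) :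
    inner ℂ χ (shift θ v ψ) = inner ℂ (shift θ (-v) χ) ψ := by
  rw [← LinearIsometry.inner_map_map (shift θ v) (shift θ (-v) χ) ψ, shift_shift_neg]

theorem inner_shift_left (v : Plane) (χ ψ : L2) :
    inner ℂ (shift θ v χ) ψ = inner ℂ χ (shift θ (-v) ψ) := by
  rw [inner_shift_right, neg_neg]

/-- Conjugation by a twisted translation multiplies twisted translations by a phase. -/
theorem shift_conj (w v : Plane) (ψ : L2) :
    shift θ w (shift θ v (shift θ (-w) ψ)) = twist θ (-(2 : ℝ) • w) v • shift θ v ψ := by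
  rw [shift_shift θ v, map_smul, shift_shift, smul_smul]
  congr 2
  · simp only [twist_eq, ← Complex.exp_add]
    congr 1
    simp
    ring
  · congr 1; abel

theorem denseRange_toL2 : DenseRange fun φ : 𝓢(Plane, ℂ) => φ.toLp 2 (volume : Measure Plane) :=
  SchwartzMap.denseRange_toLpCLM (F := ℂ) (E := Plane) (μ := volume) (p := 2) (by simp)

theorem inner_eq_integral (χ ψ : L2) : inner ℂ χ ψ = ∫ x, (starRingEnd ℂ) (χ x) * ψ x := by
  rw [L2.inner_def]
  simp only [RCLike.inner_apply']

theorem inner_toL2 (f g : 𝓢(Plane, ℂ)) :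
    inner ℂ (f.toLp 2 volume : L2) (g.toLp 2 volume) = ∫ x, (starRingEnd ℂ) (f x) * g x := by
  rw [inner_eq_integral]
  refine integral_congr_ae ?_
  filter_upwards [f.coeFn_toLp 2 volume, g.coeFn_toLp 2 volume] with x h1 h2
  rw [h1, h2]

/-- The twisted translations are strongly continuous: on Schwartz functions, `‖V(v) u - u‖²` is
controlled by the continuous function `v ↦ ⟨u, V(v) u⟩`. -/
theorem tendsto_shift_zero (ψ : L2) :
    Tendsto (fun v => shift θ v ψ) (nhds 0) (nhds ψ) := by
  have hS : ∀ φ : 𝓢(Plane, ℂ), Tendsto (fun v => shift θ v (φ.toLp 2 volume)) (nhds 0)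
      (nhds (φ.toLp 2 volume)) := by
    intro φ
    let u : L2 := φ.toLp 2 volume
    have hc : Continuous fun v => inner ℂ u (shift θ v u) := by
      simp only [u, shift_toLp, inner_toL2, shiftS_apply]
      obtain ⟨C, hC, hφ⟩ := exists_norm_le φ
      refine continuous_of_dominated (bound := fun x => ‖φ x‖ * C) (fun v => ?_)
        (fun v => Eventually.of_forall fun x => ?_) (φ.integrable.norm.mul_const C)
        (Eventually.of_forall fun x => ?_)
      · have h1 : Continuous fun x => φ (x + v) := φ.continuous.comp (by fun_prop)
        exact ((Complex.continuous_conj.comp φ.continuous).mul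
          ((continuous_twist_neg_left θ v).mul h1)).aestronglyMeasurable
      · rw [norm_mul, norm_mul, norm_twist, one_mul, RCLike.norm_conj]
        gcongr
        exact hφ _
      · have h1 : Continuous fun v => φ (x + v) := φ.continuous.comp (by fun_prop)
        have h2 : Continuous fun v => twist θ (-x) v :=
          (continuous_twist θ).comp (Continuous.prodMk_right (-x))
        exact continuous_const.mul (h2.mul h1)
    have h2 : ∀ v, ‖shift θ v u - u‖ ^ 2 = 2 * ‖u‖ ^ 2 - 2 * (inner ℂ u (shift θ v u)).re := by
      intro v
      have := norm_sub_sq (𝕜 := ℂ) u (shift θ v u)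
      rw [norm_sub_rev, this, LinearIsometry.norm_map, RCLike.re_to_complex]
      ring
    have h3 : Tendsto (fun v => ‖shift θ v u - u‖ ^ 2) (nhds 0) (nhds 0) := by
      simp only [h2]
      have h4 := (Complex.continuous_re.comp hc).tendsto 0
      have h5 := (h4.const_mul 2).const_sub (2 * ‖u‖ ^ 2)
      have h6 : (inner ℂ u (shift θ 0 u)).re = ‖u‖ ^ 2 := by
        rw [shift_zero, inner_self_eq_norm_sq_to_K]
        norm_cast
      rw [Function.comp_apply, h6, sub_self] at h5
      exact h5
    rw [tendsto_iff_norm_sub_tendsto_zero]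
    have h6 := h3.sqrt
    simpa [Real.sqrt_sq] using h6
  rw [Metric.tendsto_nhds]
  intro ε hε
  obtain ⟨φ, hφ⟩ := denseRange_toL2.exists_dist_lt ψ (show 0 < ε / 3 by positivity)
  filter_upwards [(Metric.tendsto_nhds.1 (hS φ)) (ε / 3) (by positivity)] with v hv
  calc dist (shift θ v ψ) ψ ≤ dist (shift θ v ψ) (shift θ v (φ.toLp 2 volume))
        + dist (shift θ v (φ.toLp 2 volume)) (φ.toLp 2 volume)
        + dist (φ.toLp 2 volume : L2) ψ := dist_triangle4 _ _ _ _
    _ < ε / 3 + ε / 3 + ε / 3 := by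
      rw [(shift θ v).isometry.dist_eq, dist_comm _ ψ]
      gcongr
    _ = ε := by ring

theorem twist_mul_neg (u v : Plane) : twist θ (-u) v * twist θ u v = 1 := by
  rw [twist_eq, twist_eq, ← Complex.exp_add, ← Complex.exp_zero]
  congr 1
  simp
  ring

theorem continuous_shift (ψ : L2) : Continuous fun v => shift θ v ψ := by
  rw [continuous_iff_continuousAt]
  intro w
  have h1 : ∀ v, shift θ v ψ = twist θ w (v - w) • shift θ w (shift θ (v - w) ψ) := by
    intro v
    rw [shift_shift, smul_smul, mul_comm, twist_mul_neg, one_smul, add_sub_cancel]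
  have h2 : Tendsto (fun v => v - w) (nhds w) (nhds 0) := by
    have : Continuous fun v : Plane => v - w := by fun_prop
    simpa using this.tendsto w
  have h3 : Tendsto (fun v => twist θ w (v - w)) (nhds w) (nhds 1) := by
    have : Continuous fun v : Plane => twist θ w v :=
      (continuous_twist θ).comp (Continuous.prodMk_right w)
    have h := (this.tendsto 0).comp h2
    have h0 : twist θ w 0 = 1 := by simp [twist]
    rw [h0] at h
    exact h
  have h4 := h3.smul (((shift θ w).continuous.tendsto ψ).comp
    ((tendsto_shift_zero θ ψ).comp h2))
  rw [one_smul] at h4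
  refine h4.congr fun v => ?_
  rw [h1 v]
  rfl

theorem norm_inner_shift_le (χ ψ : L2) (v : Plane) : ‖inner ℂ χ (shift θ v ψ)‖ ≤ ‖χ‖ * ‖ψ‖ := by
  simpa using norm_inner_le_norm χ (shift θ v ψ)

theorem continuous_inner_shift (χ ψ : L2) : Continuous fun v => inner ℂ χ (shift θ v ψ) :=
  continuous_const.inner (continuous_shift θ ψ)

theorem integrable_mul_inner_shift (h : 𝓢(Plane, ℂ)) (χ ψ : L2) :
    Integrable fun v => h v * inner ℂ χ (shift θ v ψ) :=
  h.integrable.mul_bdd (continuous_inner_shift θ χ ψ).aestronglyMeasurable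
    (Eventually.of_forall (norm_inner_shift_le θ χ ψ))

/-- The integrability behind Fubini's theorem in the integrated form of `𝓛(f)`; the product of the
two square integrable functions is bounded by the sum of their squares. -/
theorem integrable_prod_shift (h : 𝓢(Plane, ℂ)) (χ ψ : L2) :
    Integrable (Function.uncurry fun x v : Plane =>
      (starRingEnd ℂ) (χ x) * (h v * (twist θ (-x) v * ψ (x + v))))
      ((volume : Measure Plane).prod volume) := by
  have hχ : Integrable fun x => ‖χ x‖ ^ 2 := (Lp.memLp χ).integrable_norm_pow (by norm_num)
  have hψ : Integrable fun x => ‖ψ x‖ ^ 2 := (Lp.memLp ψ).integrable_norm_pow (by norm_num)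
  have hm : AEStronglyMeasurable (Function.uncurry fun x v : Plane =>
      (starRingEnd ℂ) (χ x) * (h v * (twist θ (-x) v * ψ (x + v))))
      ((volume : Measure Plane).prod volume) := by
    have h1 : StronglyMeasurable fun p : Plane × Plane => χ p.1 :=
      (Lp.stronglyMeasurable χ).comp_measurable measurable_fst
    have h2 : StronglyMeasurable fun p : Plane × Plane => ψ (p.1 + p.2) :=
      (Lp.stronglyMeasurable ψ).comp_measurable (measurable_fst.add measurable_snd)
    have h3 : Continuous fun p : Plane × Plane => twist θ (-p.1) p.2 :=
      (continuous_twist θ).comp (continuous_fst.neg.prodMk continuous_snd)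
    have h4 : Continuous fun p : Plane × Plane => h p.2 := h.continuous.comp continuous_snd
    exact ((Complex.continuous_conj.comp_stronglyMeasurable h1).mul
      (h4.stronglyMeasurable.mul (h3.stronglyMeasurable.mul h2))).aestronglyMeasurable
  have hb : ∀ v x, ‖(starRingEnd ℂ) (χ x) * (h v * (twist θ (-x) v * ψ (x + v)))‖
      ≤ ‖h v‖ * (‖χ x‖ ^ 2 + ‖ψ (x + v)‖ ^ 2) := by
    intro v x
    rw [norm_mul, norm_mul, norm_mul, norm_twist, one_mul, RCLike.norm_conj, mul_left_comm]
    gcongr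
    nlinarith [sq_nonneg (‖χ x‖ - ‖ψ (x + v)‖), sq_nonneg ‖χ x‖, sq_nonneg ‖ψ (x + v)‖]
  have hi : ∀ v, Integrable fun x => ‖h v‖ * (‖χ x‖ ^ 2 + ‖ψ (x + v)‖ ^ 2) := fun v =>
    (hχ.add (hψ.comp_add_right v)).const_mul _
  rw [integrable_prod_iff' hm]
  refine ⟨?_, ?_⟩
  · have hm' := hm.prodMk_right
    filter_upwards [hm'] with v hv
    exact (hi v).mono' hv (Eventually.of_forall (hb v))
  · refine (h.integrable.norm.mul_const ((∫ x, ‖χ x‖ ^ 2) + ∫ x, ‖ψ x‖ ^ 2)).mono'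
      hm.norm.prod_swap.integral_prod_right' (Eventually.of_forall fun v => ?_)
    rw [Real.norm_of_nonneg (integral_nonneg fun x => norm_nonneg _)]
    refine (integral_mono_of_nonneg (Eventually.of_forall fun x => norm_nonneg _) (hi v)
      (Eventually.of_forall (hb v))).trans_eq ?_
    rw [integral_const_mul, integral_add hχ (hψ.comp_add_right v),
      integral_add_right_eq_self (fun x => ‖ψ x‖ ^ 2)]

/-- The operator `𝓛(f)` is the integral of the twisted translations against the symplectic Fourier
transform of `f`. -/
theorem inner_leftMul [Fact (0 < θ)] (f : 𝓢(Plane, ℂ)) (χ ψ : L2) :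
    inner ℂ χ (leftMul θ f ψ) = ∫ v, coeff θ f v * inner ℂ χ (shift θ v ψ) := by
  have h1 : inner ℂ χ (leftMul θ f ψ)
      = ∫ x, ∫ v, (starRingEnd ℂ) (χ x) * (coeff θ f v * (twist θ (-x) v * ψ (x + v))) := by
    rw [inner_eq_integral]
    refine integral_congr_ae ?_
    filter_upwards [(memLp_moyalMul θ f ψ).coeFn_toLp] with x hx
    rw [leftMul_apply, hx, moyalMul_eq, integral_const_mul]
  rw [h1, integral_integral_swap (integrable_prod_shift θ (coeff θ f) χ ψ)]
  congr 1
  funext v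
  rw [inner_eq_integral, ← integral_const_mul]
  refine integral_congr_ae ?_
  filter_upwards [coeFn_shift θ v ψ] with x hx
  rw [hx]
  ring

end

section

/-! ### Adjoints, linearity and translations -/

theorem opNorm_le_of_inner {T : L2 →L[ℂ] L2} {M : ℝ} (hM : 0 ≤ M)
    (h : ∀ χ ψ : L2, ‖inner ℂ χ (T ψ)‖ ≤ M * (‖χ‖ * ‖ψ‖)) : ‖T‖ ≤ M := by
  refine T.opNorm_le_bound hM fun ψ => ?_
  have h1 := h (T ψ) ψ
  rw [inner_self_eq_norm_sq_to_K] at h1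
  have h2 : ‖T ψ‖ ^ 2 ≤ M * (‖T ψ‖ * ‖ψ‖) := by simpa using h1
  rcases (norm_nonneg (T ψ)).eq_or_lt with h0 | h0
  · rw [← h0]; positivity
  · nlinarith

/-- The complex conjugate of a Schwartz function. -/
def conjS (f : 𝓢(Plane, ℂ)) : 𝓢(Plane, ℂ) :=
  SchwartzMap.postcompCLM (𝕜 := ℝ) (Complex.conjCLE : ℂ →L[ℝ] ℂ) f

@[simp]
theorem conjS_apply (f : 𝓢(Plane, ℂ)) (x : Plane) : conjS f x = (starRingEnd ℂ) (f x) := rfl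

theorem conjS_conjS (f : 𝓢(Plane, ℂ)) : conjS (conjS f) = f := by
  ext x; simp

theorem conjS_add (f g : 𝓢(Plane, ℂ)) : conjS (f + g) = conjS f + conjS g := by
  ext x; simp

theorem pd_conjS (i : Fin 2) (f : 𝓢(Plane, ℂ)) : pd i (conjS f) = conjS (pd i f) := by
  ext x
  have h : HasFDerivAt (conjS f) ((Complex.conjCLE : ℂ →L[ℝ] ℂ).comp (fderiv ℝ f x)) x :=
    (Complex.conjCLE : ℂ →L[ℝ] ℂ).hasFDerivAt.comp x (f.hasFDerivAt x)
  rw [conjS_apply, pd_eq_fderiv, pd_eq_fderiv, h.fderiv]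
  simp

variable (θ : ℝ)

theorem conj_twist (u v : Plane) : (starRingEnd ℂ) (twist θ u v) = twist θ (-u) v := by
  rw [twist_eq, twist_eq, ← Complex.exp_conj]
  congr 1
  have h2 : (starRingEnd ℂ) 2 = 2 := Complex.conj_ofNat 2
  simp [tc, h2]
  ring

theorem twist_neg_right (u v : Plane) : twist θ u (-v) = twist θ (-u) v := by
  rw [twist_eq, twist_eq]
  congr 1
  simp

variable [hθ : Fact (0 < θ)]

theorem coeff_conjS (f : 𝓢(Plane, ℂ)) (v : Plane) :
    coeff θ (conjS f) v = (starRingEnd ℂ) (coeff θ f (-v)) := by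
  rw [coeff_apply, coeff_apply, map_mul, ← integral_conj]
  simp [conj_twist, twist_neg_right]

/-- The operator `𝓛(f̄)` is the adjoint of `𝓛(f)`. -/
theorem star_leftMul (f : 𝓢(Plane, ℂ)) : star (leftMul θ f) = leftMul θ (conjS f) := by
  rw [ContinuousLinearMap.star_eq_adjoint]
  refine (ContinuousLinearMap.eq_adjoint_iff _ _ |>.2 fun χ ψ => ?_).symm
  rw [← inner_conj_symm, inner_leftMul, inner_leftMul, ← integral_conj,
    ← integral_neg_eq_self (fun v => coeff θ f v * inner ℂ χ (shift θ v ψ))]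
  congr 1
  funext v
  rw [map_mul, coeff_conjS, RCLike.conj_conj, inner_conj_symm, inner_shift_left]

theorem inner_leftMul_left (f : 𝓢(Plane, ℂ)) (χ ψ : L2) :
    inner ℂ (leftMul θ f χ) ψ = inner ℂ χ (leftMul θ (conjS f) ψ) := by
  rw [← star_leftMul, ContinuousLinearMap.star_eq_adjoint, ContinuousLinearMap.adjoint_inner_right]

/-- The left regular representation as a linear map. -/
def leftMulₗ : 𝓢(Plane, ℂ) →ₗ[ℂ] L2 →L[ℂ] L2 where
  toFun := leftMul θ
  map_add' f g := by
    ext1 ψ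
    refine ext_inner_left ℂ fun χ => ?_
    rw [_root_.add_apply, inner_add_right, inner_leftMul, inner_leftMul, inner_leftMul,
      ← integral_add (integrable_mul_inner_shift θ _ χ ψ) (integrable_mul_inner_shift θ _ χ ψ)]
    simp [add_mul]
  map_smul' c f := by
    ext1 ψ
    refine ext_inner_left ℂ fun χ => ?_
    rw [_root_.smul_apply, inner_smul_right, inner_leftMul, inner_leftMul, ← integral_const_mul]
    simp [mul_assoc]

theorem leftMul_add (f g : 𝓢(Plane, ℂ)) : leftMul θ (f + g) = leftMul θ f + leftMul θ g :=
  map_add (leftMulₗ θ) f g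

theorem leftMul_sub (f g : 𝓢(Plane, ℂ)) : leftMul θ (f - g) = leftMul θ f - leftMul θ g :=
  map_sub (leftMulₗ θ) f g

theorem leftMul_smul (c : ℂ) (f : 𝓢(Plane, ℂ)) : leftMul θ (c • f) = c • leftMul θ f :=
  map_smul (leftMulₗ θ) c f

theorem leftMul_sum {ι : Type*} (s : Finset ι) (f : ι → 𝓢(Plane, ℂ)) :
    leftMul θ (∑ i ∈ s, f i) = ∑ i ∈ s, leftMul θ (f i) :=
  map_sum (leftMulₗ θ) f s

/-- Translations of the Moyal algebra are implemented by twisted translations. -/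
theorem leftMul_translate (κ : Plane) (f : 𝓢(Plane, ℂ)) (ψ : L2) :
    leftMul θ (translate κ f) ψ = shift θ ((1 / 2 : ℝ) • κ) (leftMul θ f
      (shift θ (-((1 / 2 : ℝ) • κ)) ψ)) := by
  refine ext_inner_left ℂ fun χ => ?_
  rw [inner_shift_right, inner_leftMul, inner_leftMul]
  congr 1
  funext v
  have h : -(2 : ℝ) • (1 / 2 : ℝ) • κ = -κ := by rw [smul_smul]; norm_num
  rw [inner_shift_left, neg_neg, shift_conj, inner_smul_right, coeff_translate, h]
  ring

theorem norm_leftMul_translate_le (κ : Plane) (f : 𝓢(Plane, ℂ)) :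
    ‖leftMul θ (translate κ f)‖ ≤ ‖leftMul θ f‖ := by
  refine ContinuousLinearMap.opNorm_le_bound _ (norm_nonneg _) fun ψ => ?_
  rw [leftMul_translate, LinearIsometry.norm_map]
  refine ((leftMul θ f).le_opNorm _).trans_eq ?_
  rw [LinearIsometry.norm_map]

/-- The derivative of a Schwartz function in the direction `κ`. -/
def dirDeriv (κ : Plane) (f : 𝓢(Plane, ℂ)) : 𝓢(Plane, ℂ) :=
  (κ 0 : ℂ) • pd 0 f + (κ 1 : ℂ) • pd 1 f

theorem coeff_dirDeriv (κ : Plane) (f : 𝓢(Plane, ℂ)) (v : Plane) :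
    coeff θ (dirDeriv κ f) v = tc θ * (κ 1 * v 0 - κ 0 * v 1) * coeff θ f v := by
  rw [dirDeriv, map_add, map_smul, map_smul, coeff_pd_zero, coeff_pd_one]
  simp
  ring

theorem hasDerivAt_inner_leftMul_translate (κ : Plane) (f : 𝓢(Plane, ℂ)) (χ ψ : L2) (t : ℝ) :
    HasDerivAt (fun t : ℝ => inner ℂ χ (leftMul θ (translate (t • κ) f) ψ))
      (inner ℂ χ (leftMul θ (translate (t • κ) (dirDeriv κ f)) ψ)) t := by
  simp only [inner_leftMul]
  have hb : Integrable fun v => ‖coeff θ (dirDeriv κ f) v‖ * (‖χ‖ * ‖ψ‖) :=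
    (coeff θ (dirDeriv κ f)).integrable.norm.mul_const _
  have hF : ∀ t : ℝ, Integrable fun v =>
      coeff θ (translate (t • κ) f) v * inner ℂ χ (shift θ v ψ) :=
    fun t => integrable_mul_inner_shift θ (coeff θ (translate (t • κ) f)) χ ψ
  have hF' : Integrable fun v =>
      coeff θ (translate (t • κ) (dirDeriv κ f)) v * inner ℂ χ (shift θ v ψ) :=
    integrable_mul_inner_shift θ (coeff θ (translate (t • κ) (dirDeriv κ f))) χ ψ
  refine (hasDerivAt_integral_of_dominated_loc_of_deriv_le (μ := volume) (x₀ := t) (s := Set.univ)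
    (F := fun t v => coeff θ (translate (t • κ) f) v * inner ℂ χ (shift θ v ψ))
    (F' := fun t v => coeff θ (translate (t • κ) (dirDeriv κ f)) v * inner ℂ χ (shift θ v ψ))
    (bound := fun v => ‖coeff θ (dirDeriv κ f) v‖ * (‖χ‖ * ‖ψ‖))
    univ_mem (Eventually.of_forall fun t => (hF t).aestronglyMeasurable) (hF t)
    hF'.aestronglyMeasurable (Eventually.of_forall fun v t _ => ?_) hb
    (Eventually.of_forall fun v t _ => ?_)).2
  · rw [coeff_translate, norm_mul, norm_mul, norm_twist, one_mul]
    gcongr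
    exact norm_inner_shift_le θ χ ψ v
  · simp only [coeff_translate, coeff_dirDeriv]
    refine HasDerivAt.mul_const ?_ _
    have h1 : ∀ t : ℝ, twist θ (-(t • κ)) v
        = Complex.exp (t * (tc θ * (κ 1 * v 0 - κ 0 * v 1))) := by
      intro t
      rw [twist_eq]
      congr 1
      simp
      ring
    simp only [h1]
    have h2 := ((Complex.ofRealCLM.hasDerivAt (x := t)).mul_const
      (tc θ * (κ 1 * v 0 - κ 0 * v 1))).cexp.mul_const (coeff θ f v)
    refine h2.congr_deriv ?_
    simp
    ring

/-- A translation moves `𝓛(f)` at most by the norm of the directional derivative. -/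
theorem norm_leftMul_translate_sub_le (κ : Plane) (f : 𝓢(Plane, ℂ)) :
    ‖leftMul θ (translate κ f) - leftMul θ f‖ ≤ ‖leftMul θ (dirDeriv κ f)‖ := by
  refine opNorm_le_of_inner (norm_nonneg _) fun χ ψ => ?_
  have h := norm_image_sub_le_of_norm_deriv_le_segment'
    (f := fun t : ℝ => inner ℂ χ (leftMul θ (translate (t • κ) f) ψ))
    (a := 0) (b := 1) (C := ‖leftMul θ (dirDeriv κ f)‖ * (‖χ‖ * ‖ψ‖))
    (fun t _ => (hasDerivAt_inner_leftMul_translate θ κ f χ ψ t).hasDerivWithinAt)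
    (fun t _ => by
      refine (norm_inner_le_norm _ _).trans ?_
      rw [mul_left_comm]
      gcongr
      exact ((leftMul θ _).le_opNorm ψ).trans (mul_le_mul_of_nonneg_right
        (norm_leftMul_translate_le θ _ _) (norm_nonneg _))) 1 (by simp)
  have h0 : translate ((0 : ℝ) • κ) f = f := by ext x; simp [translate_apply]
  simpa only [one_smul, h0, sub_zero, mul_one, ← inner_sub_right, ← _root_.sub_apply] using h

end

section

/-! ### The commutator with the Dirac operator -/

variable (θ : ℝ)

/-- The derivative `∂₁ + i ∂₂`. -/
def dbar (f : 𝓢(Plane, ℂ)) : 𝓢(Plane, ℂ) := pd 0 f + Complex.I • pd 1 f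

/-- The derivative `∂₁ - i ∂₂`. -/
def del (f : 𝓢(Plane, ℂ)) : 𝓢(Plane, ℂ) := pd 0 f - Complex.I • pd 1 f

/-- The commutator of the Dirac operator with `𝓛(f) ⊗ 1`. -/
def commutator (f : 𝓢(Plane, ℂ)) (ψ : Spinor) : Spinor :=
  WithLp.toLp 2 ![-Complex.I • leftMul θ (dbar f) (ψ 1), -Complex.I • leftMul θ (del f) (ψ 0)]

theorem norm_commutator_sq (f : 𝓢(Plane, ℂ)) (ψ : Spinor) : ‖commutator θ f ψ‖ ^ 2
    = ‖leftMul θ (dbar f) (ψ 1)‖ ^ 2 + ‖leftMul θ (del f) (ψ 0)‖ ^ 2 := by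
  rw [PiLp.norm_sq_eq_of_L2, Fin.sum_univ_two]
  simp [commutator, norm_smul]

variable [hθ : Fact (0 < θ)]

/-- The transpose of left Moyal multiplication for the bilinear pairing, on Schwartz functions. -/
def transposeMul (f φ : 𝓢(Plane, ℂ)) : 𝓢(Plane, ℂ) := conjS (mstar θ (conjS f) (conjS φ))

theorem toTemperedDistribution_leftMul (f : 𝓢(Plane, ℂ)) (u : L2) (φ : 𝓢(Plane, ℂ)) :
    ((leftMul θ f u : L2) : 𝓢'(Plane, ℂ)) φ = (u : 𝓢'(Plane, ℂ)) (transposeMul θ f φ) := by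
  have key : ∀ (w : L2) (χ : 𝓢(Plane, ℂ)),
      (w : 𝓢'(Plane, ℂ)) χ = inner ℂ ((conjS χ).toLp 2 volume : L2) w := by
    intro w χ
    rw [Lp.toTemperedDistribution_apply, inner_eq_integral]
    refine integral_congr_ae ?_
    filter_upwards [(conjS χ).coeFn_toLp 2 volume] with x hx
    simp [hx]
  rw [key, key, transposeMul, conjS_conjS, ← leftMul_toLp, inner_leftMul_left, conjS_conjS]

theorem pd_transposeMul (i : Fin 2) (f φ : 𝓢(Plane, ℂ)) : pd i (transposeMul θ f φ)
    = transposeMul θ (pd i f) φ + transposeMul θ f (pd i φ) := by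
  simp only [transposeMul, pd_conjS, pd_mstar, conjS_add]

theorem lineDerivOp_leftMul (i : Fin 2) (f : 𝓢(Plane, ℂ)) (u : L2) (φ : 𝓢(Plane, ℂ)) :
    (∂_{(EuclideanSpace.single i 1 : Plane)} ((leftMul θ f u : L2) : 𝓢'(Plane, ℂ))) φ
      = (∂_{(EuclideanSpace.single i 1 : Plane)} (u : 𝓢'(Plane, ℂ))) (transposeMul θ f φ)
        + ((leftMul θ (pd i f) u : L2) : 𝓢'(Plane, ℂ)) φ := by
  have h := pd_transposeMul θ i f φ
  rw [TemperedDistribution.lineDerivOp_apply_apply, TemperedDistribution.lineDerivOp_apply_apply,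
    map_neg, map_neg, toTemperedDistribution_leftMul, toTemperedDistribution_leftMul,
    ← pd_apply, ← pd_apply, h, map_add]
  ring

theorem diracDistribution_zero_apply (ψ : Spinor) (φ : 𝓢(Plane, ℂ)) :
    diracDistribution ψ 0 φ = -Complex.I *
      ((∂_{(EuclideanSpace.single 0 1 : Plane)} ((ψ 1 : L2) : 𝓢'(Plane, ℂ))) φ
        + Complex.I * (∂_{(EuclideanSpace.single 1 1 : Plane)} ((ψ 1 : L2) : 𝓢'(Plane, ℂ))) φ) := by
  simp [diracDistribution, gammaMatrix, Fin.sum_univ_two]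
  ring

theorem diracDistribution_one_apply (ψ : Spinor) (φ : 𝓢(Plane, ℂ)) :
    diracDistribution ψ 1 φ = -Complex.I *
      ((∂_{(EuclideanSpace.single 0 1 : Plane)} ((ψ 0 : L2) : 𝓢'(Plane, ℂ))) φ
        - Complex.I * (∂_{(EuclideanSpace.single 1 1 : Plane)} ((ψ 0 : L2) : 𝓢'(Plane, ℂ))) φ) := by
  simp [diracDistribution, gammaMatrix, Fin.sum_univ_two]
  ring

theorem toTemperedDistribution_add_apply (u w : L2) (φ : 𝓢(Plane, ℂ)) :
    ((u + w : L2) : 𝓢'(Plane, ℂ)) φ = (u : 𝓢'(Plane, ℂ)) φ + (w : 𝓢'(Plane, ℂ)) φ := by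
  simp only [← Lp.toTemperedDistributionCLM_apply, map_add]
  rfl

theorem toTemperedDistribution_smul_apply (c : ℂ) (u : L2) (φ : 𝓢(Plane, ℂ)) :
    ((c • u : L2) : 𝓢'(Plane, ℂ)) φ = c * (u : 𝓢'(Plane, ℂ)) φ := by
  simp only [← Lp.toTemperedDistributionCLM_apply, map_smul]
  rfl

/-- The Leibniz rule in the sense of distributions: `𝓛(f) ⊗ 1` preserves the graph of the Dirac
operator up to the bounded commutator. -/
theorem leftMul_mem_diracGraph (f : 𝓢(Plane, ℂ)) {ψ η : Spinor} (h : (ψ, η) ∈ diracGraph) :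
    (onSpinors (leftMul θ f) ψ, onSpinors (leftMul θ f) η + commutator θ f ψ) ∈ diracGraph := by
  have h' : ∀ a φ, diracDistribution ψ a φ = ((η a : L2) : 𝓢'(Plane, ℂ)) φ := fun a φ => by
    rw [h a]
  intro a
  ext φ
  rw [PiLp.add_apply, toTemperedDistribution_add_apply]
  fin_cases a
  · have h0 := h' 0 (transposeMul θ f φ)
    rw [diracDistribution_zero_apply] at h0
    simp only [Fin.zero_eta, diracDistribution_zero_apply, onSpinors, lineDerivOp_leftMul,
      toTemperedDistribution_leftMul θ f (η 0), ← h0, commutator, Matrix.cons_val_zero,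
      toTemperedDistribution_smul_apply, dbar, leftMul_add, leftMul_smul, _root_.add_apply,
      _root_.smul_apply, toTemperedDistribution_add_apply]
    ring
  · have h0 := h' 1 (transposeMul θ f φ)
    rw [diracDistribution_one_apply] at h0
    simp only [Fin.mk_one, diracDistribution_one_apply, onSpinors, lineDerivOp_leftMul,
      toTemperedDistribution_leftMul θ f (η 1), ← h0, commutator, Matrix.cons_val_one,
      Matrix.cons_val_fin_one,
      toTemperedDistribution_smul_apply, del, sub_eq_add_neg, ← neg_smul, leftMul_add,
      leftMul_smul, _root_.add_apply, _root_.smul_apply, toTemperedDistribution_add_apply]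
    ring

/-- Spinors whose components are Schwartz functions lie in the domain of the Dirac operator. -/
theorem schwartz_mem_domain (g : Fin 2 → 𝓢(Plane, ℂ)) :
    (WithLp.toLp 2 fun a => (g a).toLp 2 volume : Spinor) ∈ dirac.domain := by
  rw [LinearPMap.mem_domain_iff, dirac_graph]
  refine ⟨WithLp.toLp 2 ![(-Complex.I • dbar (g 1)).toLp 2 volume,
    (-Complex.I • del (g 0)).toLp 2 volume], fun a => ?_⟩
  ext φ
  fin_cases a
  · simp only [Fin.zero_eta, diracDistribution_zero_apply, Lp.toTemperedDistribution_toLp_eq,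
      TemperedDistribution.lineDerivOp_toTemperedDistributionCLM_eq, ← pd_apply,
      Matrix.cons_val_zero, dbar, smul_add, map_add, map_smul]
    simp [mul_add]
  · simp only [Fin.mk_one, diracDistribution_one_apply, Lp.toTemperedDistribution_toLp_eq,
      TemperedDistribution.lineDerivOp_toTemperedDistributionCLM_eq, ← pd_apply,
      Matrix.cons_val_one, del, smul_sub]
    simp [mul_sub]

/-- On its domain the Dirac operator satisfies `[D, 𝓛(f) ⊗ 1] = commutator θ f`. -/
theorem dirac_leftMul (f : 𝓢(Plane, ℂ)) (ψ : dirac.domain) :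
    ∃ h : onSpinors (leftMul θ f) ψ ∈ dirac.domain,
      dirac ⟨onSpinors (leftMul θ f) ψ, h⟩ - onSpinors (leftMul θ f) (dirac ψ)
        = commutator θ f ψ := by
  have h1 : ((ψ : Spinor), dirac ψ) ∈ diracGraph := dirac_graph ▸ dirac.mem_graph ψ
  have h2 := leftMul_mem_diracGraph θ f h1
  rw [← dirac_graph] at h2
  refine ⟨LinearPMap.mem_domain_of_mem_graph h2, ?_⟩
  rw [sub_eq_iff_eq_add']
  exact dirac.mem_graph_snd_inj (dirac.mem_graph ⟨_, LinearPMap.mem_domain_of_mem_graph h2⟩) h2 rfl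

theorem norm_le_of_dense {T : L2 →L[ℂ] L2} {M : ℝ} (hM : 0 ≤ M)
    (h : ∀ g : 𝓢(Plane, ℂ), ‖T (g.toLp 2 volume)‖ ≤ M * ‖(g.toLp 2 volume : L2)‖) : ‖T‖ ≤ M := by
  refine T.opNorm_le_bound hM fun ψ => ?_
  have hc : IsClosed {ψ : L2 | ‖T ψ‖ ≤ M * ‖ψ‖} :=
    isClosed_le T.continuous.norm (continuous_const.mul continuous_norm)
  exact denseRange_toL2.induction_on (p := fun ψ => ‖T ψ‖ ≤ M * ‖ψ‖) ψ hc h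

/-- The Lipschitz condition of the spectral distance in terms of the derivatives `∂₁ ± i ∂₂`. -/
theorem commutatorLeOne_iff (f : 𝓢(Plane, ℂ)) :
    CommutatorLeOne θ f ↔ ‖leftMul θ (dbar f)‖ ≤ 1 ∧ ‖leftMul θ (del f)‖ ≤ 1 := by
  constructor
  · intro h
    have key : ∀ g : Fin 2 → 𝓢(Plane, ℂ),
        ‖leftMul θ (dbar f) ((g 1).toLp 2 volume)‖ ^ 2
          + ‖leftMul θ (del f) ((g 0).toLp 2 volume)‖ ^ 2
        ≤ ‖((g 0).toLp 2 volume : L2)‖ ^ 2 + ‖((g 1).toLp 2 volume : L2)‖ ^ 2 := by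
      intro g
      obtain ⟨h1, h2⟩ := h ⟨_, schwartz_mem_domain g⟩
      obtain ⟨h3, h4⟩ := dirac_leftMul θ f ⟨_, schwartz_mem_domain g⟩
      rw [h4] at h2
      have h5 := pow_le_pow_left₀ (norm_nonneg _) h2 2
      rwa [norm_commutator_sq, PiLp.norm_sq_eq_of_L2, Fin.sum_univ_two] at h5
    have hz : ((0 : 𝓢(Plane, ℂ)).toLp 2 volume : L2) = 0 :=
      map_zero (SchwartzMap.toLpCLM ℂ ℂ 2 (volume : Measure Plane))
    constructor
    · refine norm_le_of_dense zero_le_one fun g => ?_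
      have := key ![0, g]
      simp only [Matrix.cons_val_zero, Matrix.cons_val_one, hz, map_zero, norm_zero, ne_eq,
        OfNat.ofNat_ne_zero, not_false_eq_true, zero_pow, add_zero, zero_add] at this
      rw [one_mul]
      exact (pow_le_pow_iff_left₀ (norm_nonneg _) (norm_nonneg _) two_ne_zero).1 this
    · refine norm_le_of_dense zero_le_one fun g => ?_
      have := key ![g, 0]
      simp only [Matrix.cons_val_zero, Matrix.cons_val_one, hz, map_zero, norm_zero, ne_eq,
        OfNat.ofNat_ne_zero, not_false_eq_true, zero_pow, add_zero, zero_add] at this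
      rw [one_mul]
      exact (pow_le_pow_iff_left₀ (norm_nonneg _) (norm_nonneg _) two_ne_zero).1 this
  · rintro ⟨h1, h2⟩ ψ
    obtain ⟨h3, h4⟩ := dirac_leftMul θ f ψ
    refine ⟨h3, ?_⟩
    rw [h4, ← pow_le_pow_iff_left₀ (norm_nonneg _) (norm_nonneg _) two_ne_zero,
      norm_commutator_sq, PiLp.norm_sq_eq_of_L2, Fin.sum_univ_two, add_comm]
    have h5 : ∀ (T : L2 →L[ℂ] L2) (u : L2), ‖T‖ ≤ 1 → ‖T u‖ ≤ ‖u‖ := fun T u hT => by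
      simpa using T.le_of_opNorm_le hT u
    gcongr
    · exact h5 _ _ h2
    · exact h5 _ _ h1

end

section

/-! ### States of a `C*`-algebra and strictly convergent nets -/

section

variable {A : Type*} [NonUnitalCStarAlgebra A]

/-- The Cauchy–Schwarz inequality for states. -/
theorem CStarState.norm_apply_star_mul_sq_le (Φ : CStarState A) (a b : A) :
    ‖Φ.toCLM (star a * b)‖ ^ 2 ≤ (Φ.toCLM (star a * a)).re * (Φ.toCLM (star b * b)).re := by
  let _ : PartialOrder A := CStarAlgebra.spectralOrder A
  have : StarOrderedRing A := CStarAlgebra.spectralOrderedRing A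
  let f : A →ₚ[ℂ] ℂ := PositiveLinearMap.mk₀ Φ.toCLM.toLinearMap fun a ha => by
    obtain ⟨b, rfl⟩ := CStarAlgebra.nonneg_iff_eq_star_mul_self.1 ha
    exact Φ.nonneg b
  have h := norm_inner_le_norm (𝕜 := ℂ) (f.toPreGNS a) (f.toPreGNS b)
  rw [f.preGNS_inner_def] at h
  have h2 : ∀ a, ‖f.toPreGNS a‖ ^ 2 = (Φ.toCLM (star a * a)).re := by
    intro a
    have := congrArg Complex.re (f.preGNS_norm_sq (f.toPreGNS a))
    rw [← Complex.ofReal_pow, Complex.ofReal_re] at this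
    exact this
  have h3 := pow_le_pow_left₀ (norm_nonneg _) h 2
  rw [mul_pow, h2, h2] at h3
  exact h3

theorem CStarState.norm_apply_le (Φ : CStarState A) (a : A) : ‖Φ.toCLM a‖ ≤ ‖a‖ := by
  simpa [Φ.norm_eq_one] using Φ.toCLM.le_opNorm a

theorem CStarState.re_apply_star_mul_le (Φ : CStarState A) (a : A) :
    (Φ.toCLM (star a * a)).re ≤ ‖a‖ ^ 2 := by
  refine (Complex.re_le_norm _).trans ((Φ.norm_apply_le _).trans_eq ?_)
  rw [CStarRing.norm_star_mul_self, sq]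

/-- A state takes values close to one on squares of self-adjoint contractions. -/
theorem CStarState.exists_almost_one (Φ : CStarState A) {δ : ℝ} (hδ : 0 < δ) :
    ∃ e : A, star e = e ∧ ‖e‖ ≤ 1 ∧ 1 - δ ≤ (Φ.toCLM (e * e)).re := by
  let _ : PartialOrder A := CStarAlgebra.spectralOrder A
  have : StarOrderedRing A := CStarAlgebra.spectralOrderedRing A
  have hl := CStarAlgebra.increasingApproximateUnit A
  obtain ⟨b, hb1, hb2⟩ : ∃ b : A, ‖b‖ ≤ 1 ∧ 1 - δ / 2 < ‖Φ.toCLM b‖ := by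
    obtain ⟨b, hb1, hb2⟩ := Φ.toCLM.exists_lt_apply_of_lt_opNorm
      (r := 1 - δ / 2) (by rw [Φ.norm_eq_one]; linarith)
    exact ⟨b, hb1.le, hb2⟩
  have ht : Tendsto (fun u => ‖Φ.toCLM (u * b)‖) (CStarAlgebra.approximateUnit A)
      (nhds ‖Φ.toCLM b‖) :=
    ((Φ.toCLM.continuous.tendsto b).comp (hl.tendsto_mul_right b)).norm
  have := hl.neBot
  obtain ⟨e, he1, he2, he3⟩ := ((ht.eventually (lt_mem_nhds hb2)).and
    (hl.eventually_star_eq.and hl.eventually_norm)).exists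
  refine ⟨e, he2, he3, ?_⟩
  have h1 := Φ.norm_apply_star_mul_sq_le e b
  rw [he2] at h1
  have h2 : (Φ.toCLM (star b * b)).re ≤ 1 :=
    (Φ.re_apply_star_mul_le b).trans (pow_le_one₀ (norm_nonneg _) hb1)
  have h3 : 0 ≤ (Φ.toCLM (e * e)).re := by
    have := (Φ.nonneg e)
    rw [he2] at this
    exact (Complex.le_def.1 this).1
  nlinarith [norm_nonneg (Φ.toCLM (e * b)), sq_nonneg δ]

/-- Right multiplication by `e²` changes the values of a state little if the state is close to one
at `e²`. The algebra has no unit, so the Cauchy–Schwarz inequality is applied to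
`x (1 - e²) u` with `u` in an approximate unit. -/
theorem CStarState.norm_sub_mul_sq_le (Φ : CStarState A) {e : A} (he : star e = e)
    (he1 : ‖e‖ ≤ 1) (x : A) :
    ‖Φ.toCLM (x - x * (e * e))‖ ^ 2 ≤ ‖x‖ ^ 2 * (2 - 2 * (Φ.toCLM (e * e)).re) := by
  let _ : PartialOrder A := CStarAlgebra.spectralOrder A
  have : StarOrderedRing A := CStarAlgebra.spectralOrderedRing A
  have hl := CStarAlgebra.increasingApproximateUnit A
  have := hl.neBot
  have hmul : ∀ a, Tendsto (fun u => a * u) (CStarAlgebra.approximateUnit A) (nhds a) :=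
    hl.tendsto_mul_left
  have hconj : ∀ a, Tendsto (fun u => u * (a * u)) (CStarAlgebra.approximateUnit A) (nhds a) := by
    intro a
    have h1 : Tendsto (fun u => u * (a * u - a)) (CStarAlgebra.approximateUnit A) (nhds 0) := by
      refine squeeze_zero_norm' (a := fun u => ‖a * u - a‖) ?_ ?_
      · filter_upwards [hl.eventually_norm] with u hu
        exact (norm_mul_le _ _).trans (mul_le_of_le_one_left (norm_nonneg _) hu)
      · simpa using ((hmul a).sub_const a).norm
    have h2 := h1.add (hl.tendsto_mul_right a)
    simpa [mul_sub] using h2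
  have hL : Tendsto (fun u => ‖Φ.toCLM ((x - x * (e * e)) * u)‖ ^ 2)
      (CStarAlgebra.approximateUnit A) (nhds (‖Φ.toCLM (x - x * (e * e))‖ ^ 2)) :=
    (((Φ.toCLM.continuous.tendsto _).comp (hmul _)).norm).pow 2
  have hre : ∀ a, Tendsto (fun u => (Φ.toCLM (u * (a * u))).re) (CStarAlgebra.approximateUnit A)
      (nhds (Φ.toCLM a).re) := fun a =>
    (Complex.continuous_re.tendsto _).comp ((Φ.toCLM.continuous.tendsto _).comp (hconj a))
  have hR := (((tendsto_const_nhds (x := (1 : ℝ))).sub ((hre (e * e)).const_mul 2)).add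
    (hre (e * e * (e * e)))).const_mul (‖x‖ ^ 2)
  have h4 : (Φ.toCLM (e * e * (e * e))).re ≤ 1 := by
    have h := Φ.re_apply_star_mul_le (e * e)
    rw [star_mul, he] at h
    refine h.trans (pow_le_one₀ (norm_nonneg _) ?_)
    exact (norm_mul_le _ _).trans (mul_le_one₀ he1 (norm_nonneg _) he1)
  refine (le_of_tendsto_of_tendsto hL hR ?_).trans ?_
  · filter_upwards [hl.eventually_norm, hl.eventually_star_eq] with u hu1 hu2
    have h := Φ.norm_apply_star_mul_sq_le (star x) (u - e * e * u)
    rw [star_star, mul_sub, ← mul_assoc x (e * e) u, ← sub_mul] at h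
    refine h.trans ?_
    have hx : (Φ.toCLM (x * star x)).re ≤ ‖x‖ ^ 2 := by
      simpa using Φ.re_apply_star_mul_le (star x)
    have hu : (Φ.toCLM (u * u)).re ≤ 1 := by
      have := Φ.re_apply_star_mul_le u
      rw [hu2] at this
      exact this.trans (pow_le_one₀ (norm_nonneg _) hu1)
    have hexp : star (u - e * e * u) * (u - e * e * u) = u * u - u * (e * e * u)
        - u * (e * e * u) + u * (e * e * (e * e) * u) := by
      simp only [star_sub, star_mul, he, hu2]
      noncomm_ring
    have hn : 0 ≤ (Φ.toCLM (star (u - e * e * u) * (u - e * e * u))).re :=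
      (Complex.le_def.1 (Φ.nonneg _)).1
    refine (mul_le_mul_of_nonneg_right hx hn).trans ?_
    refine mul_le_mul_of_nonneg_left ?_ (sq_nonneg _)
    rw [hexp]
    simp only [map_add, map_sub, Complex.add_re, Complex.sub_re]
    linarith
  · refine mul_le_mul_of_nonneg_left ?_ (sq_nonneg _)
    linarith

/-- A state is continuous along bounded nets that converge strictly to a scalar. -/
theorem CStarState.tendsto_of_strict (Φ : CStarState A) {ι : Type*} {l : Filter ι} {x : ι → A}
    {M : ℝ} (hM : ∀ i, ‖x i‖ ≤ M) {c : ℂ} (h : ∀ a, Tendsto (fun i => x i * a) l (nhds (c • a))) :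
    Tendsto (fun i => Φ.toCLM (x i)) l (nhds c) := by
  rw [Metric.tendsto_nhds]
  intro ε hε
  rcases l.eq_or_neBot with rfl | hl
  · simp
  have hM0 : 0 ≤ M := by
    obtain ⟨i⟩ := hl.nonempty
    exact (norm_nonneg _).trans (hM i)
  obtain ⟨δ, hδ0, hδ1, hδ2⟩ : ∃ δ : ℝ, 0 < δ ∧ M ^ 2 * (2 * δ) < (ε / 3) ^ 2 ∧
      ‖c‖ ^ 2 * (2 * δ) < (ε / 3) ^ 2 := by
    refine ⟨(ε / 3) ^ 2 / (2 * (M ^ 2 + ‖c‖ ^ 2 + 1)), by positivity, ?_, ?_⟩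
    all_goals
      rw [show ∀ a b c : ℝ, a * (2 * (b / (2 * c))) = a * b / c from fun a b c => by ring,
        div_lt_iff₀ (by positivity)]
      have : 0 < (ε / 3) ^ 2 := by positivity
      nlinarith [sq_nonneg M, sq_nonneg ‖c‖]
  obtain ⟨e, he, he1, he2⟩ := Φ.exists_almost_one hδ0
  have hxe := (Φ.toCLM.continuous.tendsto _).comp (h (e * e))
  have he3 : ‖(1 : ℂ) - Φ.toCLM (e * e)‖ ^ 2 ≤ 2 * δ := by
    have hn : ‖Φ.toCLM (e * e)‖ ≤ 1 := (Φ.norm_apply_le _).trans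
      ((norm_mul_le _ _).trans (mul_le_one₀ he1 (norm_nonneg _) he1))
    have hn2 : (Φ.toCLM (e * e)).re ^ 2 + (Φ.toCLM (e * e)).im ^ 2 ≤ 1 := by
      have := pow_le_one₀ (n := 2) (norm_nonneg _) hn
      rw [← Complex.normSq_eq_norm_sq, Complex.normSq_apply] at this
      linarith
    rw [← Complex.normSq_eq_norm_sq, Complex.normSq_apply]
    simp
    nlinarith
  filter_upwards [Metric.tendsto_nhds.1 hxe (ε / 3) (by positivity)] with i hi
  rw [dist_eq_norm] at hi ⊢
  have h1 : ‖Φ.toCLM (x i - x i * (e * e))‖ < ε / 3 := by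
    refine lt_of_pow_lt_pow_left₀ 2 (by positivity) (lt_of_le_of_lt ?_ hδ1)
    refine (Φ.norm_sub_mul_sq_le he he1 (x i)).trans ?_
    have := pow_le_pow_left₀ (norm_nonneg _) (hM i) 2
    exact mul_le_mul this (by linarith) (by
      have := (Complex.re_le_norm _).trans ((Φ.norm_apply_le (e * e)).trans
        ((norm_mul_le _ _).trans (mul_le_one₀ he1 (norm_nonneg _) he1)))
      linarith) (sq_nonneg _)
  have h2 : ‖c * (1 - Φ.toCLM (e * e))‖ < ε / 3 := by
    refine lt_of_pow_lt_pow_left₀ 2 (by positivity) (lt_of_le_of_lt ?_ hδ2)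
    rw [norm_mul, mul_pow]
    exact mul_le_mul_of_nonneg_left he3 (sq_nonneg _)
  have h3 : Φ.toCLM (x i) - c = Φ.toCLM (x i - x i * (e * e))
      + (Φ.toCLM (x i * (e * e)) - Φ.toCLM (c • (e * e))) - c * (1 - Φ.toCLM (e * e)) := by
    rw [map_sub, map_smul, smul_eq_mul]
    ring
  rw [h3]
  calc _ ≤ ‖Φ.toCLM (x i - x i * (e * e))‖
      + ‖Φ.toCLM (x i * (e * e)) - Φ.toCLM (c • (e * e))‖ + ‖c * (1 - Φ.toCLM (e * e))‖ :=
        (norm_sub_le _ _).trans (by gcongr; exact norm_add_le _ _)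
    _ < ε := by
        have hi' : ‖Φ.toCLM (x i * (e * e)) - Φ.toCLM (c • (e * e))‖ < ε / 3 := hi
        linarith

/-- The composition of a state with an automorphism `α` that has the inverse `β`. -/
theorem CStarState.exists_comp (Φ : CStarState A) (α β : A → A)
    (hadd : ∀ a b, α (a + b) = α a + α b) (hsmul : ∀ (c : ℂ) a, α (c • a) = c • α a)
    (hstar : ∀ a, α (star a * a) = star (α a) * α a) (hα : ∀ a, ‖α a‖ ≤ ‖a‖)
    (hβ : ∀ a, ‖β a‖ ≤ ‖a‖) (hαβ : ∀ a, α (β a) = a) :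
    ∃ Ψ : CStarState A, ∀ a, Ψ.toCLM a = Φ.toCLM (α a) := by
  let Ψ : A →ₗ[ℂ] ℂ :=
    { toFun a := Φ.toCLM (α a)
      map_add' a b := by rw [hadd, map_add]
      map_smul' c a := by rw [hsmul, map_smul, RingHom.id_apply] }
  have hΨ : ∀ a, ‖Ψ a‖ ≤ 1 * ‖a‖ := fun a => by
    rw [one_mul]
    exact (Φ.norm_apply_le _).trans (hα a)
  refine ⟨⟨Ψ.mkContinuous 1 hΨ, fun a => ?_, le_antisymm ?_ ?_⟩, fun a => rfl⟩
  · have := Φ.nonneg (α a)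
    rwa [← hstar] at this
  · exact Ψ.mkContinuous_norm_le zero_le_one hΨ
  · conv_lhs => rw [← Φ.norm_eq_one]
    refine ContinuousLinearMap.opNorm_le_bound _ (norm_nonneg _) fun a => ?_
    have := (Ψ.mkContinuous 1 hΨ).le_opNorm (β a)
    rw [show Ψ.mkContinuous 1 hΨ (β a) = Φ.toCLM (α (β a)) from rfl, hαβ] at this
    exact this.trans (mul_le_mul_of_nonneg_left (hβ a) (norm_nonneg _))

end

end

section

/-! ### Twisted translations and the `C*`-closure -/

variable (θ : ℝ)

/-- The generator of the twisted translations in the direction `v`. -/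
def gen (v : Plane) (φ : 𝓢(Plane, ℂ)) : 𝓢(Plane, ℂ) :=
  (v 0 : ℂ) • (pd 0 φ + tc θ • coord 1 φ) + (v 1 : ℂ) • (pd 1 φ - tc θ • coord 0 φ)

theorem gen_apply (v : Plane) (φ : 𝓢(Plane, ℂ)) (x : Plane) :
    gen θ v φ x = tc θ * (x 1 * v 0 - x 0 * v 1) * φ x + fderiv ℝ φ x v := by
  rw [fderiv_eq_sum_pd]
  simp [gen, Fin.sum_univ_two, coord_apply]
  ring

theorem hasDerivAt_shiftS (v : Plane) (φ : 𝓢(Plane, ℂ)) (x : Plane) (t : ℝ) :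
    HasDerivAt (fun t : ℝ => shiftS θ (t • v) φ x) (shiftS θ (t • v) (gen θ v φ) x) t := by
  simp only [shiftS_apply]
  have h1 : ∀ t : ℝ, twist θ (-x) (t • v) = Complex.exp (t * (tc θ * (x 1 * v 0 - x 0 * v 1))) := by
    intro t
    rw [twist_eq]
    congr 1
    simp
    ring
  simp only [h1]
  have h2 := ((Complex.ofRealCLM.hasDerivAt (x := t)).mul_const
    (tc θ * (x 1 * v 0 - x 0 * v 1))).cexp
  have h3 : HasDerivAt (fun t : ℝ => φ (x + t • v)) (fderiv ℝ φ (x + t • v) v) t := by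
    have h4 : HasDerivAt (fun t : ℝ => x + t • v) v t := by
      simpa using ((hasDerivAt_id t).smul_const v).const_add x
    exact (φ.differentiableAt (x := x + t • v)).hasFDerivAt.comp_hasDerivAt t h4
  refine (h2.mul h3).congr_deriv ?_
  rw [gen_apply]
  simp
  ring

theorem hasDerivAt_inner_shift (v : Plane) (χ φ : 𝓢(Plane, ℂ)) (t : ℝ) :
    HasDerivAt (fun t : ℝ => inner ℂ (χ.toLp 2 volume : L2) (shift θ (t • v) (φ.toLp 2 volume)))
      (inner ℂ (χ.toLp 2 volume : L2) (shift θ (t • v) ((gen θ v φ).toLp 2 volume))) t := by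
  simp only [shift_toLp, inner_toL2]
  obtain ⟨C, hC, hφ⟩ := exists_norm_le (gen θ v φ)
  have hi : ∀ g : 𝓢(Plane, ℂ), Integrable fun x => (starRingEnd ℂ) (χ x) * g x := by
    intro g
    obtain ⟨D, -, hg⟩ := exists_norm_le g
    exact (conjS χ).integrable.mul_bdd (c := D) g.continuous.aestronglyMeasurable
      (Eventually.of_forall hg)
  have hF : ∀ t : ℝ, Integrable fun x => (starRingEnd ℂ) (χ x) * shiftS θ (t • v) φ x :=
    fun t => hi (shiftS θ (t • v) φ)
  have hF' : Integrable fun x => (starRingEnd ℂ) (χ x) * shiftS θ (t • v) (gen θ v φ) x :=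
    hi (shiftS θ (t • v) (gen θ v φ))
  refine (hasDerivAt_integral_of_dominated_loc_of_deriv_le (μ := volume) (x₀ := t) (s := Set.univ)
    (F := fun t x => (starRingEnd ℂ) (χ x) * shiftS θ (t • v) φ x)
    (F' := fun t x => (starRingEnd ℂ) (χ x) * shiftS θ (t • v) (gen θ v φ) x)
    (bound := fun x => ‖χ x‖ * C) univ_mem (Eventually.of_forall fun t =>
    (hF t).aestronglyMeasurable) (hF t) hF'.aestronglyMeasurable
    (Eventually.of_forall fun x t _ => ?_) (χ.integrable.norm.mul_const C)
    (Eventually.of_forall fun x t _ => ?_)).2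
  · rw [norm_mul, RCLike.norm_conj, shiftS_apply, norm_mul, norm_twist, one_mul]
    gcongr
    exact hφ _
  · exact (hasDerivAt_shiftS θ v φ x t).const_mul _

/-- The twisted translations as unitary operators. -/
def shiftU (v : Plane) : unitary (L2 →L[ℂ] L2) :=
  ⟨(shift θ v).toContinuousLinearMap, by
    have h : star (shift θ v).toContinuousLinearMap = (shift θ (-v)).toContinuousLinearMap := by
      rw [ContinuousLinearMap.star_eq_adjoint, eq_comm, ContinuousLinearMap.eq_adjoint_iff]
      intro χ ψ
      simp [inner_shift_left]
    rw [Unitary.mem_iff, h]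
    constructor
    · ext1 ψ
      exact shift_neg_shift θ v ψ
    · ext1 ψ
      exact shift_shift_neg θ v ψ⟩

theorem star_shiftU (v : Plane) : star (shiftU θ v) = shiftU θ (-v) := by
  refine Subtype.ext ?_
  rw [Unitary.coe_star, ContinuousLinearMap.star_eq_adjoint, eq_comm,
    ContinuousLinearMap.eq_adjoint_iff]
  intro χ ψ
  change inner ℂ (shift θ (-v) χ) ψ = inner ℂ χ (shift θ v ψ)
  rw [inner_shift_left, neg_neg]

theorem norm_conj_shiftU (v : Plane) (a : L2 →L[ℂ] L2) :
    ‖Unitary.conjStarAlgAut ℂ (L2 →L[ℂ] L2) (shiftU θ v) a‖ = ‖a‖ := by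
  rw [Unitary.conjStarAlgAut_apply, ← Unitary.coe_star, CStarRing.norm_mul_coe_unitary,
    CStarRing.norm_coe_unitary_mul]

/-- A unit vector that is approximately reproduced by contractions of the Moyal algebra defines
a state. -/
theorem isState_inner {ξ : L2} (hξ : ‖ξ‖ = 1) (h : ∀ r : ℝ, r < 1 → ∃ f : 𝓢(Plane, ℂ),
    ‖leftMul θ f‖ ≤ 1 ∧ r ≤ ‖inner ℂ ξ (leftMul θ f ξ)‖) :
    IsState θ fun f => inner ℂ ξ (leftMul θ f ξ) := by
  let Ψ : closureAlg θ →ₗ[ℂ] ℂ :=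
    { toFun a := inner ℂ ξ ((a : L2 →L[ℂ] L2) ξ)
      map_add' a b := inner_add_right (𝕜 := ℂ) ξ ((a : L2 →L[ℂ] L2) ξ) ((b : L2 →L[ℂ] L2) ξ)
      map_smul' c a := inner_smul_right ξ ((a : L2 →L[ℂ] L2) ξ) c }
  have hΨ : ∀ a, ‖Ψ a‖ ≤ 1 * ‖a‖ := by
    intro a
    rw [one_mul]
    refine (norm_inner_le_norm (𝕜 := ℂ) ξ ((a : L2 →L[ℂ] L2) ξ)).trans ?_
    rw [hξ, one_mul]
    have := (a : L2 →L[ℂ] L2).le_opNorm ξ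
    rw [hξ, mul_one] at this
    exact this
  refine ⟨⟨Ψ.mkContinuous 1 hΨ, fun a => ?_, le_antisymm ?_ ?_⟩, fun f => rfl⟩
  · have h1 : Ψ.mkContinuous 1 hΨ (star a * a)
        = inner ℂ ((a : L2 →L[ℂ] L2) ξ) ((a : L2 →L[ℂ] L2) ξ) :=
      ContinuousLinearMap.adjoint_inner_right (a : L2 →L[ℂ] L2) ξ _
    rw [h1, inner_self_eq_norm_sq_to_K]
    have := sq_nonneg ‖(a : L2 →L[ℂ] L2) ξ‖
    rw [← RCLike.ofReal_pow]
    exact Complex.zero_le_real.2 this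
  · exact Ψ.mkContinuous_norm_le zero_le_one hΨ
  · refine le_of_forall_lt fun r hr => ?_
    obtain ⟨s, hs1, hs2⟩ := exists_between hr
    obtain ⟨f, hf1, hf2⟩ := h s hs2
    refine hs1.trans_le (hf2.trans ?_)
    have := (Ψ.mkContinuous 1 hΨ).le_opNorm ⟨leftMul θ f, leftMul_mem θ f⟩
    exact this.trans (mul_le_of_le_one_right (norm_nonneg _) hf1)

variable [hθ : Fact (0 < θ)]

/-- The generators of the twisted translations act on the left factor of a Moyal product. -/
theorem gen_mstar (v : Plane) (f g : 𝓢(Plane, ℂ)) :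
    gen θ v (mstar θ f g) = mstar θ (gen θ v f) g := by
  simp only [gen, mstar_add_left, mstar_sub_left, mstar_smul_left, pd_mstar,
    mstar_coord_zero_left, mstar_coord_one_left, smul_sub, smul_add, smul_smul,
    mul_inv_cancel₀ (tc_ne_zero θ), mul_assoc]
  simp only [mul_one]
  module

/-- On the Moyal algebra the twisted translations are Lipschitz for the operator norm. -/
theorem exists_norm_shiftU_mul_leftMul_sub_le (f : 𝓢(Plane, ℂ)) : ∃ C, 0 ≤ C ∧ ∀ v : Plane,
    ‖(shiftU θ v : L2 →L[ℂ] L2) * leftMul θ f - leftMul θ f‖ ≤ C * ‖v‖ := by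
  refine ⟨‖leftMul θ (pd 0 f + tc θ • coord 1 f)‖ + ‖leftMul θ (pd 1 f - tc θ • coord 0 f)‖,
    by positivity, fun v => ?_⟩
  have hg : ‖leftMul θ (gen θ v f)‖ ≤ (‖leftMul θ (pd 0 f + tc θ • coord 1 f)‖
      + ‖leftMul θ (pd 1 f - tc θ • coord 0 f)‖) * ‖v‖ := by
    rw [gen, leftMul_add, leftMul_smul, leftMul_smul, add_mul]
    refine (norm_add_le _ _).trans ?_
    rw [norm_smul, norm_smul, Complex.norm_real, Complex.norm_real, mul_comm, mul_comm ‖v 1‖]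
    gcongr
    · exact PiLp.norm_apply_le v 0
    · exact PiLp.norm_apply_le v 1
  refine le_trans ?_ hg
  refine norm_le_of_dense (norm_nonneg _) fun g => ?_
  set η : L2 := ((shiftU θ v : L2 →L[ℂ] L2) * leftMul θ f - leftMul θ f) (g.toLp 2 volume) with hη
  have key : ∀ χ : 𝓢(Plane, ℂ), ‖inner ℂ (χ.toLp 2 volume : L2) η‖
      ≤ ‖(χ.toLp 2 volume : L2)‖ * (‖leftMul θ (gen θ v f)‖ * ‖(g.toLp 2 volume : L2)‖) := by
    intro χ
    have h := norm_image_sub_le_of_norm_deriv_le_segment'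
      (f := fun t : ℝ => inner ℂ (χ.toLp 2 volume : L2)
        (shift θ (t • v) ((mstar θ f g).toLp 2 volume)))
      (a := 0) (b := 1) (C := ‖(χ.toLp 2 volume : L2)‖
        * (‖leftMul θ (gen θ v f)‖ * ‖(g.toLp 2 volume : L2)‖))
      (fun t _ => (hasDerivAt_inner_shift θ v χ _ t).hasDerivWithinAt)
      (fun t _ => by
        refine (norm_inner_le_norm _ _).trans ?_
        rw [LinearIsometry.norm_map, gen_mstar, ← leftMul_toLp]
        gcongr
        exact (leftMul θ _).le_opNorm _) 1 (by simp)
    simp only [one_smul, zero_smul, shift_zero, sub_zero, mul_one, ← inner_sub_right] at h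
    rw [← leftMul_toLp] at h
    exact h
  have h2 : ∀ u : L2, ‖inner ℂ u η‖
      ≤ ‖u‖ * (‖leftMul θ (gen θ v f)‖ * ‖(g.toLp 2 volume : L2)‖) := by
    intro u
    have hc : IsClosed {u : L2 | ‖inner ℂ u η‖
        ≤ ‖u‖ * (‖leftMul θ (gen θ v f)‖ * ‖(g.toLp 2 volume : L2)‖)} :=
      isClosed_le (by fun_prop) (by fun_prop)
    exact denseRange_toL2.induction_on (p := fun u => ‖inner ℂ u η‖
        ≤ ‖u‖ * (‖leftMul θ (gen θ v f)‖ * ‖(g.toLp 2 volume : L2)‖)) u hc key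
  have h3 := h2 η
  rw [inner_self_eq_norm_sq_to_K, norm_pow, sq] at h3
  rcases (norm_nonneg η).eq_or_lt with h0 | h0
  · rw [← h0]; positivity
  · refine le_of_mul_le_mul_left ?_ h0
    simpa using h3

/-- The deviation of `𝓛(g) 𝓛(f)` from the multiple of `𝓛(f)` by the scalar `∫ ĝ`: it is small if
the symplectic Fourier transform `ĝ` is concentrated near the origin, since the twisted translations
act on `𝓛(f)` in a Lipschitz way. -/
theorem norm_leftMul_mul_sub_le (f : 𝓢(Plane, ℂ)) {C : ℝ} (hC : 0 ≤ C)
    (hf : ∀ v : Plane, ‖(shiftU θ v : L2 →L[ℂ] L2) * leftMul θ f - leftMul θ f‖ ≤ C * ‖v‖)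
    (g : 𝓢(Plane, ℂ)) :
    ‖leftMul θ g * leftMul θ f - (∫ v, coeff θ g v) • leftMul θ f‖
      ≤ ∫ v, ‖coeff θ g v‖ * (C * ‖v‖) := by
  refine opNorm_le_of_inner (by positivity) fun χ ψ => ?_
  have h1 : inner ℂ χ ((leftMul θ g * leftMul θ f - (∫ v, coeff θ g v) • leftMul θ f) ψ)
      = ∫ v, coeff θ g v * inner ℂ χ (((shiftU θ v : L2 →L[ℂ] L2) * leftMul θ f
        - leftMul θ f) ψ) := by
    have h2 : ∀ v, coeff θ g v * inner ℂ χ (((shiftU θ v : L2 →L[ℂ] L2) * leftMul θ f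
        - leftMul θ f) ψ) = coeff θ g v * inner ℂ χ (shift θ v (leftMul θ f ψ))
          - coeff θ g v * inner ℂ χ (leftMul θ f ψ) := fun v => by
      rw [← mul_sub, ← inner_sub_right]
      rfl
    simp only [h2]
    rw [_root_.sub_apply, _root_.smul_apply, inner_sub_right, inner_smul_right,
      show (leftMul θ g * leftMul θ f) ψ = leftMul θ g (leftMul θ f ψ) from rfl,
      integral_sub (integrable_mul_inner_shift θ _ _ _) ((coeff θ g).integrable.mul_const _),
      integral_mul_const, inner_leftMul]
  rw [h1, ← integral_mul_const]
  have hint : Integrable fun v => ‖coeff θ g v‖ * (C * ‖v‖) := by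
    have := ((coeff θ g).integrable_pow_mul volume 1).const_mul C
    refine this.congr (Eventually.of_forall fun v => ?_)
    simp only [pow_one]
    ring
  refine norm_integral_le_of_norm_le (hint.mul_const _) (Eventually.of_forall fun v => ?_)
  rw [norm_mul, mul_assoc]
  gcongr
  refine (norm_inner_le_norm _ _).trans ?_
  rw [mul_left_comm]
  gcongr
  exact ContinuousLinearMap.le_of_opNorm_le _ (hf v) ψ

/-- For a bounded net of operators, strict convergence to a scalar on the `C*`-closure can be
tested on the Moyal algebra. -/
theorem tendsto_mul_of_mem_closureAlg {ι : Type*} {l : Filter ι} {x : ι → L2 →L[ℂ] L2} {M : ℝ}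
    (hM : ∀ i, ‖x i‖ ≤ M) {c : ℂ}
    (h : ∀ f, Tendsto (fun i => x i * leftMul θ f) l (nhds (c • leftMul θ f)))
    {a : L2 →L[ℂ] L2} (ha : a ∈ closureAlg θ) :
    Tendsto (fun i => x i * a) l (nhds (c • a)) := by
  rcases l.eq_or_neBot with rfl | hl
  · exact tendsto_bot
  obtain ⟨i₀⟩ := hl.nonempty
  have hM0 : 0 ≤ M := (norm_nonneg _).trans (hM i₀)
  have hcl : IsClosed {a : L2 →L[ℂ] L2 | Tendsto (fun i => x i * a) l (nhds (c • a))} := by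
    refine isClosed_of_closure_subset fun a ha => ?_
    refine Metric.tendsto_nhds.2 fun ε hε => ?_
    obtain ⟨b, hb, hab⟩ := Metric.mem_closure_iff.1 ha (ε / (2 * (M + ‖c‖ + 1))) (by positivity)
    filter_upwards [Metric.tendsto_nhds.1 hb (ε / 2) (by positivity)] with i hi
    have h1 : x i * a - c • a = (x i * b - c • b) + x i * (a - b) - c • (a - b) := by
      rw [mul_sub, smul_sub]; abel
    rw [dist_eq_norm] at hi hab ⊢
    rw [h1]
    have h2 : ‖x i * (a - b)‖ ≤ M * ‖a - b‖ :=
      (norm_mul_le _ _).trans (mul_le_mul_of_nonneg_right (hM i) (norm_nonneg _))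
    have h3 : (M + ‖c‖) * ‖a - b‖ ≤ ε / 2 := by
      rw [lt_div_iff₀ (by positivity)] at hab
      nlinarith [norm_nonneg (a - b)]
    calc _ ≤ ‖x i * b - c • b‖ + ‖x i * (a - b)‖ + ‖c • (a - b)‖ :=
          (norm_sub_le _ _).trans (by gcongr; exact norm_add_le _ _)
      _ < ε := by rw [norm_smul]; linarith
  refine closure_minimal (s := (NonUnitalStarAlgebra.adjoin ℂ (Set.range (leftMul θ)) : Set _))
    (t := {a : L2 →L[ℂ] L2 | Tendsto (fun i => x i * a) l (nhds (c • a))}) (fun a ha => ?_) hcl ha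
  have hp : Tendsto (fun i => x i * a) l (nhds (c • a))
      ∧ Tendsto (fun i => x i * star a) l (nhds (c • star a)) := by
    induction ha using NonUnitalStarAlgebra.adjoin_induction with
    | mem a ha =>
      obtain ⟨f, rfl⟩ := ha
      rw [star_leftMul]
      exact ⟨h f, h _⟩
    | add a b _ _ ha hb =>
      simp only [star_add, mul_add, smul_add]
      exact ⟨ha.1.add hb.1, ha.2.add hb.2⟩
    | zero => simp
    | mul a b _ _ ha hb =>
      simp only [star_mul, ← mul_assoc, ← smul_mul_assoc]
      exact ⟨ha.1.mul_const b, hb.2.mul_const (star a)⟩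
    | smul r a _ ha =>
      simp only [star_smul, mul_smul_comm, smul_comm c]
      exact ⟨ha.1.const_smul r, ha.2.const_smul (star r)⟩
    | star a _ ha =>
      rw [star_star]
      exact ha.symm
  exact hp.1

/-! ### Translates of states and vector states -/

theorem conj_shiftU_leftMul (κ : Plane) (f : 𝓢(Plane, ℂ)) :
    Unitary.conjStarAlgAut ℂ (L2 →L[ℂ] L2) (shiftU θ ((1 / 2 : ℝ) • κ)) (leftMul θ f)
      = leftMul θ (translate κ f) := by
  ext1 ψ
  rw [leftMul_translate, Unitary.conjStarAlgAut_apply, ← Unitary.coe_star, star_shiftU]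
  rfl

theorem conj_shiftU_mem (κ : Plane) {a : L2 →L[ℂ] L2} (ha : a ∈ closureAlg θ) :
    Unitary.conjStarAlgAut ℂ (L2 →L[ℂ] L2) (shiftU θ ((1 / 2 : ℝ) • κ)) a ∈ closureAlg θ := by
  have h : closureAlg θ ≤ NonUnitalStarSubalgebra.comap
      (Unitary.conjStarAlgAut ℂ (L2 →L[ℂ] L2) (shiftU θ ((1 / 2 : ℝ) • κ))) (closureAlg θ) := by
    refine NonUnitalStarSubalgebra.topologicalClosure_minimal _
      (NonUnitalStarAlgebra.adjoin_le ?_) ?_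
    · rintro _ ⟨f, rfl⟩
      rw [NonUnitalStarSubalgebra.coe_comap, Set.mem_preimage, conj_shiftU_leftMul]
      exact leftMul_mem θ _
    · rw [NonUnitalStarSubalgebra.coe_comap]
      refine (NonUnitalStarSubalgebra.isClosed_topologicalClosure _).preimage ?_
      exact (continuous_const.mul continuous_id).mul continuous_const
  exact h ha

/-- The translate of a state is a state. -/
theorem IsState.translateState {φ : 𝓢(Plane, ℂ) → ℂ} (hφ : IsState θ φ) (κ : Plane) :
    IsState θ (translateState κ φ) := by
  obtain ⟨Φ, hΦ⟩ := hφ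
  let α : Plane → closureAlg θ → closureAlg θ := fun κ a =>
    ⟨Unitary.conjStarAlgAut ℂ (L2 →L[ℂ] L2) (shiftU θ ((1 / 2 : ℝ) • κ)) a,
      conj_shiftU_mem θ κ a.2⟩
  obtain ⟨Ψ, hΨ⟩ := Φ.exists_comp (α κ) (α (-κ))
    (fun a b => Subtype.ext (map_add _ (a : L2 →L[ℂ] L2) b))
    (fun c a => Subtype.ext (map_smul _ c (a : L2 →L[ℂ] L2)))
    (fun a => Subtype.ext ((map_mul _ (star (a : L2 →L[ℂ] L2)) a).trans
      (congrArg (· * _) (map_star _ (a : L2 →L[ℂ] L2)))))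
    (fun a => (norm_conj_shiftU θ _ (a : L2 →L[ℂ] L2)).le)
    (fun a => (norm_conj_shiftU θ _ (a : L2 →L[ℂ] L2)).le)
    (fun a => Subtype.ext (by
      simp only [α, smul_neg]
      rw [← star_shiftU, ← Unitary.conjStarAlgAut_mul_apply, Unitary.mul_star_self, map_one]
      rfl))
  refine ⟨Ψ, fun f => ?_⟩
  rw [hΨ, Moyal.translateState, hΦ]
  congr 1
  exact Subtype.ext (conj_shiftU_leftMul θ κ f).symm

end

section

/-! ### Gaussian functions and the vacuum projection -/

/-- The Gaussian function `x ↦ exp (-b |x|²)` as a Schwartz function on the plane. -/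
def gauss {b : ℝ} (hb : 0 < b) : 𝓢(Plane, ℂ) := (exists_gaussian Plane hb).choose

theorem gauss_apply {b : ℝ} (hb : 0 < b) (x : Plane) :
    gauss hb x = (Real.exp (-b * ‖x‖ ^ 2) : ℂ) := (exists_gaussian Plane hb).choose_spec x

theorem gauss_zero {b : ℝ} (hb : 0 < b) : gauss hb 0 = 1 := by simp [gauss_apply]

theorem pd_gauss {b : ℝ} (hb : 0 < b) (i : Fin 2) :
    pd i (gauss hb) = (-(2 * b) : ℂ) • coord i (gauss hb) := by
  ext x
  have h1 : HasFDerivAt (fun x : Plane => Real.exp (-b * ‖x‖ ^ 2))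
      (Real.exp (-b * ‖x‖ ^ 2) • (-b) • ((2 : ℕ) • innerSL ℝ x)) x :=
    ((HasStrictFDerivAt.hasFDerivAt (hasStrictFDerivAt_norm_sq x)).const_mul (-b)).exp
  have h2 : HasFDerivAt (gauss hb) (Complex.ofRealCLM.comp
      (Real.exp (-b * ‖x‖ ^ 2) • (-b) • ((2 : ℕ) • innerSL ℝ x))) x :=
    (Complex.ofRealCLM.hasFDerivAt.comp x h1).congr_of_eventuallyEq
      (Eventually.of_forall fun y => gauss_apply hb y)
  rw [pd_eq_fderiv, h2.fderiv, _root_.smul_apply, coord_apply, gauss_apply]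
  simp [e, innerSL_apply_apply ℝ, EuclideanSpace.inner_single_right]
  ring

theorem integral_exp_neg_mul_norm_sq {b : ℝ} (hb : 0 < b) :
    ∫ x : Plane, Real.exp (-b * ‖x‖ ^ 2) = Real.pi / b := by
  rw [GaussianFourier.integral_rexp_neg_mul_sq_norm hb]
  simp

theorem norm_freq_sq (θ : ℝ) (v : Plane) :
    ‖freq θ v‖ ^ 2 = (1 / (Real.pi * θ)) ^ 2 * ‖v‖ ^ 2 := by
  simp only [EuclideanSpace.norm_sq_eq, Fin.sum_univ_two, Real.norm_eq_abs, sq_abs, freq,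
    LinearMap.coe_mk, AddHom.coe_mk]
  simp
  ring

theorem twist_zero_left (θ : ℝ) (v : Plane) : twist θ 0 v = 1 := by simp [twist]

/-- The reflection `v ↦ -v` on Schwartz functions. -/
def refl (h : 𝓢(Plane, ℂ)) : 𝓢(Plane, ℂ) :=
  SchwartzMap.compCLMOfContinuousLinearEquiv ℂ (ContinuousLinearEquiv.neg ℝ) h

theorem refl_apply (h : 𝓢(Plane, ℂ)) (v : Plane) : refl h v = h (-v) := rfl

/-- Twisted convolutions compose to the twisted convolution with a twisted convolution. -/
theorem tconv_tconv (θ : ℝ) (h k φ : 𝓢(Plane, ℂ)) :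
    tconv θ h (tconv θ k φ) = tconv θ (tconv θ (refl h) k) φ := by
  ext x
  have h1 : tconv θ h (tconv θ k φ) x = ∫ v, ∫ u, h v * k (u - v) * twist θ (-v) u
      * (twist θ (-x) u * φ (x + u)) := by
    rw [tconv_apply]
    congr 1
    funext v
    rw [tconv_apply, ← integral_sub_right_eq_self _ v, ← integral_const_mul, ← integral_const_mul]
    congr 1
    funext u
    have ht : twist θ (-x) v * twist θ (-(x + v)) (u - v) = twist θ (-v) u * twist θ (-x) u := by
      simp only [twist_eq, ← Complex.exp_add]
      congr 1
      simp
      ring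
    rw [show x + v + (u - v) = x + u by abel]
    linear_combination (h v * k (u - v) * φ (x + u)) * ht
  have h2 : ∀ u, tconv θ (refl h) k u = ∫ v, h v * k (u - v) * twist θ (-v) u := by
    intro u
    rw [tconv_apply, ← integral_neg_eq_self]
    congr 1
    funext v
    have ht : twist θ (-u) (-v) = twist θ (-v) u := by
      rw [twist_eq, twist_eq]
      congr 1
      simp only [PiLp.neg_apply, Complex.ofReal_neg]
      ring
    rw [refl_apply, neg_neg, ht, ← sub_eq_add_neg]
    ring
  rw [h1, tconv_apply, integral_integral_swap]
  · congr 1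
    funext u
    rw [h2, integral_mul_const]
  · obtain ⟨C, hC, hk⟩ := exists_norm_le k
    have hφ : Integrable fun u => φ (x + u) := φ.integrable.comp_add_left x
    have hi := (h.integrable (μ := volume)).mul_prod hφ
    have hi2 := hi.mul_bdd (c := C) (g := fun p : Plane × Plane =>
      k (p.2 - p.1) * twist θ (-p.1) p.2 * twist θ (-x) p.2) ?_ (Eventually.of_forall fun p => ?_)
    · refine hi2.congr (Eventually.of_forall fun p => ?_)
      simp only [Function.uncurry]
      ring
    · have c1 : Continuous fun p : Plane × Plane => k (p.2 - p.1) :=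
        k.continuous.comp (continuous_snd.sub continuous_fst)
      have c2 : Continuous fun p : Plane × Plane => twist θ (-p.1) p.2 :=
        (continuous_twist θ).comp (continuous_fst.neg.prodMk continuous_snd)
      have c3 : Continuous fun p : Plane × Plane => twist θ (-x) p.2 :=
        (continuous_twist θ).comp (continuous_const.prodMk continuous_snd)
      exact ((c1.mul c2).mul c3).aestronglyMeasurable
    · rw [norm_mul, norm_mul, norm_twist, norm_twist, mul_one, mul_one]
      exact hk _

variable (θ : ℝ) [hθ : Fact (0 < θ)]

theorem coeff_gauss {b : ℝ} (hb : 0 < b) (v : Plane) : coeff θ (gauss hb) v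
    = ((1 / (Real.pi * θ ^ 2 * b) * Real.exp (-(1 / (θ ^ 2 * b)) * ‖v‖ ^ 2) : ℝ) : ℂ) := by
  have h0 : θ ≠ 0 := hθ.out.ne'
  have h1 : (gauss hb : Plane → ℂ) = fun v => Complex.exp (-(b : ℂ) * (‖v‖ : ℂ) ^ 2) := by
    funext v
    rw [gauss_apply]
    push_cast
    rfl
  rw [coeff_apply', SchwartzMap.fourier_coe, h1,
    fourier_gaussian_innerProductSpace (by simpa using hb)]
  have h2 : (-(Real.pi : ℂ) ^ 2 * (‖freq θ v‖ : ℂ) ^ 2 / (b : ℂ))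
      = ((-(1 / (θ ^ 2 * b)) * ‖v‖ ^ 2 : ℝ) : ℂ) := by
    rw [← Complex.ofReal_pow ‖freq θ v‖, norm_freq_sq]
    have hpi : (Real.pi : ℂ) ≠ 0 := by exact_mod_cast Real.pi_ne_zero
    have h0' : (θ : ℂ) ≠ 0 := by exact_mod_cast h0
    have hb' : (b : ℂ) ≠ 0 := by exact_mod_cast hb.ne'
    push_cast
    field_simp
  rw [h2, finrank_euclideanSpace]
  have h3 : ((Fintype.card (Fin 2) : ℕ) : ℂ) / 2 = 1 := by simp
  rw [h3, Complex.cpow_one, ← Complex.ofReal_exp]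
  have hpi : (Real.pi : ℂ) ≠ 0 := by exact_mod_cast Real.pi_ne_zero
  have h0' : (θ : ℂ) ≠ 0 := by exact_mod_cast h0
  have hb' : (b : ℂ) ≠ 0 := by exact_mod_cast hb.ne'
  push_cast
  field_simp

/-- The integral of the symplectic Fourier transform is the value at the origin. -/
theorem integral_coeff (f : 𝓢(Plane, ℂ)) : ∫ v, coeff θ f v = f 0 := by
  have hdet : LinearMap.det (freq θ) ≠ 0 := by
    have := (freqEquiv θ hθ.out.ne').toLinearEquiv.isUnit_det'
    exact this.ne_zero
  have h1 : ∀ f : 𝓢(Plane, ℂ), ∫ v, coeff θ f v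
      = ((1 / (Real.pi * θ) : ℂ) ^ 2 * (|(LinearMap.det (freq θ))⁻¹| : ℝ)) * f 0 := by
    intro f
    have h2 : ∫ v, (𝓕 f) (freq θ v) = (|(LinearMap.det (freq θ))⁻¹| : ℝ) • ∫ w, (𝓕 f) w := by
      have h3 := integral_map (μ := (volume : Measure Plane)) (φ := freq θ)
        (f := fun w => (𝓕 f) w)
        (freqEquiv θ hθ.out.ne').continuous.aemeasurable (𝓕 f).continuous.aestronglyMeasurable
      rw [← h3, Measure.map_linearMap_addHaar_eq_smul_addHaar _ hdet, integral_smul_measure,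
        ENNReal.toReal_ofReal (abs_nonneg _)]
    have h4 : ∫ w, (𝓕 f) w = f 0 := by
      have h5 := congrArg (fun g : 𝓢(Plane, ℂ) => g 0)
        (FourierTransform.fourierInv_fourier_eq (E := 𝓢(Plane, ℂ))
        (F := 𝓢(Plane, ℂ)) f)
      simp only [SchwartzMap.fourierInv_coe, Real.fourierInv_eq'] at h5
      simpa using h5
    simp only [coeff_apply']
    rw [integral_const_mul, h2, h4, Complex.real_smul]
    ring
  -- the Jacobian is determined by testing with a Gaussian function
  have h6 := h1 (gauss one_pos)
  simp only [coeff_gauss] at h6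
  have h0 : θ ≠ 0 := hθ.out.ne'
  have hpos : 0 < 1 / (θ ^ 2 * 1) := by positivity
  have h7 : Real.pi / (1 / (θ ^ 2 * 1)) = Real.pi * θ ^ 2 := by field_simp
  rw [integral_complex_ofReal, integral_const_mul, integral_exp_neg_mul_norm_sq hpos, h7,
    gauss_zero] at h6
  simp only [mul_one] at h6
  rw [h1, ← h6]
  have hpi : (Real.pi : ℂ) ≠ 0 := by exact_mod_cast Real.pi_ne_zero
  have h0' : (θ : ℂ) ≠ 0 := by exact_mod_cast h0
  push_cast
  field_simp

theorem inv_theta_pos : 0 < 1 / θ := one_div_pos.2 hθ.out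

/-- The vacuum `2 exp (-|x|²/θ)`, which is the idempotent of the Moyal algebra belonging to the
ground state of the harmonic oscillator. -/
def vacuum : 𝓢(Plane, ℂ) := (2 : ℂ) • gauss (inv_theta_pos θ)

theorem vacuum_apply (x : Plane) :
    vacuum θ x = ((2 * Real.exp (-(1 / θ) * ‖x‖ ^ 2) : ℝ) : ℂ) := by
  rw [vacuum, _root_.smul_apply, gauss_apply]
  simp

theorem pd_vacuum (i : Fin 2) : pd i (vacuum θ) = (-(2 / θ) : ℂ) • coord i (vacuum θ) := by
  rw [vacuum, map_smul, map_smul, pd_gauss, smul_comm]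
  congr 2
  push_cast
  ring

theorem coeff_vacuum : coeff θ (vacuum θ) = (1 / (Real.pi * θ) : ℂ) • vacuum θ := by
  ext v
  have h0 : θ ≠ 0 := hθ.out.ne'
  have hpi : Real.pi ≠ 0 := Real.pi_ne_zero
  rw [vacuum, map_smul, _root_.smul_apply, _root_.smul_apply, _root_.smul_apply, coeff_gauss,
    gauss_apply]
  have h1 : 1 / (θ ^ 2 * (1 / θ)) = 1 / θ := by field_simp
  have h2 : 1 / (Real.pi * θ ^ 2 * (1 / θ)) = 1 / (Real.pi * θ) := by field_simp
  rw [h1, h2]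
  simp
  ring

theorem conjS_vacuum : conjS (vacuum θ) = vacuum θ := by
  ext x
  rw [conjS_apply, vacuum_apply, Complex.conj_ofReal]

/-- A Schwartz function that satisfies the differential equations of the vacuum is a multiple of
the vacuum. -/
theorem eq_smul_vacuum {F : 𝓢(Plane, ℂ)}
    (hF : ∀ i, pd i F = (-(2 / θ) : ℂ) • coord i F) : F = (F 0 / 2) • vacuum θ := by
  let g : Plane → ℂ := fun x => (Real.exp ((1 / θ) * ‖x‖ ^ 2) : ℂ)
  have hg : ∀ x, HasFDerivAt g (Complex.ofRealCLM.comp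
      (Real.exp ((1 / θ) * ‖x‖ ^ 2) • (1 / θ) • ((2 : ℕ) • innerSL ℝ x))) x := fun x =>
    Complex.ofRealCLM.hasFDerivAt.comp (f := fun x : Plane => Real.exp ((1 / θ) * ‖x‖ ^ 2)) x
      ((HasStrictFDerivAt.hasFDerivAt (hasStrictFDerivAt_norm_sq x)).const_mul (1 / θ)).exp
  have hd : ∀ x, HasFDerivAt (fun x => F x * g x) (0 : Plane →L[ℝ] ℂ) x := by
    intro x
    refine (F.differentiableAt.hasFDerivAt.mul (hg x)).congr_fderiv ?_
    ext y
    rw [fderiv_eq_sum_pd]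
    simp [Fin.sum_univ_two, hF, coord_apply, g, innerSL_apply_apply ℝ, PiLp.inner_apply]
    ring
  have hc : ∀ x, F x * g x = F 0 := by
    intro x
    have := is_const_of_fderiv_eq_zero (𝕜 := ℝ) (f := fun x => F x * g x)
      (fun x => (hd x).differentiableAt) (fun x => (hd x).fderiv) x 0
    simpa [g] using this
  ext x
  rw [_root_.smul_apply, vacuum_apply, ← hc x]
  simp only [g, smul_eq_mul]
  rw [← Complex.ofReal_ofNat, ← mul_one (F x)]
  have : Real.exp (1 / θ * ‖x‖ ^ 2) * Real.exp (-(1 / θ) * ‖x‖ ^ 2) = 1 := by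
    rw [← Real.exp_add]; simp
  have h2 : (Real.exp (1 / θ * ‖x‖ ^ 2) : ℂ) * (Real.exp (-(1 / θ) * ‖x‖ ^ 2) : ℂ) = 1 := by
    exact_mod_cast this
  push_cast at h2 ⊢
  linear_combination (-F x) * h2

theorem tc_inv_mul_tc_inv : (tc θ)⁻¹ * (tc θ)⁻¹ = -(θ ^ 2 / 4 : ℂ) := by
  have h0' : (θ : ℂ) ≠ 0 := by exact_mod_cast hθ.out.ne'
  have hI : Complex.I ≠ 0 := Complex.I_ne_zero
  rw [tc]
  field_simp
  rw [Complex.I_sq]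
  norm_num

/-- The vacuum is idempotent: the ladder operators determine its square up to a factor, which is
a Gaussian integral. -/
theorem mstar_vacuum_vacuum : mstar θ (vacuum θ) (vacuum θ) = vacuum θ := by
  have h0' : (θ : ℂ) ≠ 0 := by exact_mod_cast hθ.out.ne'
  set G := vacuum θ with hG
  have hq := tc_inv_mul_tc_inv θ
  have hF : ∀ i, pd i (mstar θ G G) = (-(2 / θ) : ℂ) • coord i (mstar θ G G) := by
    have e0 : pd 0 (mstar θ G G) = (-(2 / θ) : ℂ) • (mstar θ (coord 0 G) G
        + mstar θ G (coord 0 G)) := by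
      rw [pd_mstar, pd_vacuum, mstar_smul_left, mstar_smul_right, smul_add]
    have e1 : pd 1 (mstar θ G G) = (-(2 / θ) : ℂ) • (mstar θ (coord 1 G) G
        + mstar θ G (coord 1 G)) := by
      rw [pd_mstar, pd_vacuum, mstar_smul_left, mstar_smul_right, smul_add]
    have f0 : mstar θ (coord 0 G) G + mstar θ G (coord 0 G) = (2 : ℂ) • coord 0 (mstar θ G G)
        + (tc θ)⁻¹ • (mstar θ (pd 1 G) G - mstar θ G (pd 1 G)) := by
      rw [mstar_coord_zero_left, mstar_coord_zero_right]
      module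
    have f1 : mstar θ (coord 1 G) G + mstar θ G (coord 1 G) = (2 : ℂ) • coord 1 (mstar θ G G)
        - (tc θ)⁻¹ • (mstar θ (pd 0 G) G - mstar θ G (pd 0 G)) := by
      rw [mstar_coord_one_left, mstar_coord_one_right]
      module
    have g1 : mstar θ (pd 1 G) G - mstar θ G (pd 1 G)
        = (-(2 / θ) : ℂ) • (tc θ)⁻¹ • pd 0 (mstar θ G G) := by
      rw [pd_vacuum, mstar_smul_left, mstar_smul_right, ← smul_sub, mstar_coord_one_left,
        mstar_coord_one_right, pd_mstar]
      module
    have g0 : mstar θ (pd 0 G) G - mstar θ G (pd 0 G)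
        = (2 / θ : ℂ) • (tc θ)⁻¹ • pd 1 (mstar θ G G) := by
      rw [pd_vacuum, mstar_smul_left, mstar_smul_right, ← smul_sub, mstar_coord_zero_left,
        mstar_coord_zero_right, pd_mstar]
      module
    intro i
    fin_cases i
    · simp only [Fin.zero_eta]
      rw [f0, g1, smul_smul, smul_smul] at e0
      ext x
      have e2 := congrArg (fun F : 𝓢(Plane, ℂ) => F x) e0
      simp only [_root_.smul_apply, _root_.add_apply, smul_eq_mul] at e2 ⊢
      rw [show (tc θ)⁻¹ * -(2 / (θ : ℂ)) * (tc θ)⁻¹ = (tc θ)⁻¹ * (tc θ)⁻¹ * -(2 / (θ : ℂ)) by ring,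
        hq] at e2
      field_simp at e2 ⊢
      linear_combination (1 / 8 : ℂ) * e2
    · simp only [Fin.mk_one]
      rw [f1, g0, smul_smul, smul_smul] at e1
      ext x
      have e2 := congrArg (fun F : 𝓢(Plane, ℂ) => F x) e1
      simp only [_root_.smul_apply, _root_.sub_apply, smul_eq_mul] at e2 ⊢
      rw [show (tc θ)⁻¹ * (2 / (θ : ℂ)) * (tc θ)⁻¹ = (tc θ)⁻¹ * (tc θ)⁻¹ * (2 / (θ : ℂ)) by ring,
        hq] at e2
      field_simp at e2 ⊢
      linear_combination (1 / 8 : ℂ) * e2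
  have h1 : mstar θ G G 0 = 2 := by
    rw [mstar, hG, coeff_vacuum, tconv_apply]
    have h2 : ∀ v, ((1 / (Real.pi * θ) : ℂ) • vacuum θ) v
        * (twist θ (-0) v * vacuum θ (0 + v))
        = ((4 / (Real.pi * θ) * Real.exp (-(2 / θ) * ‖v‖ ^ 2) : ℝ) : ℂ) := by
      intro v
      rw [neg_zero, twist_zero_left, zero_add, _root_.smul_apply, vacuum_apply,
        show -(2 / θ) * ‖v‖ ^ 2 = -(1 / θ) * ‖v‖ ^ 2 + -(1 / θ) * ‖v‖ ^ 2 by ring, Real.exp_add]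
      push_cast
      simp only [smul_eq_mul]
      ring
    simp only [h2]
    have h3 : 0 < 2 / θ := div_pos two_pos hθ.out
    rw [integral_complex_ofReal, integral_const_mul, integral_exp_neg_mul_norm_sq h3]
    have h4 : 4 / (Real.pi * θ) * (Real.pi / (2 / θ)) = 2 := by
      have := hθ.out.ne'
      have := Real.pi_ne_zero
      field_simp
      norm_num
    rw [h4]
    norm_num
  rw [eq_smul_vacuum θ hF, h1, div_self two_ne_zero, one_smul]

theorem refl_vacuum : refl (vacuum θ) = vacuum θ := by
  ext x
  rw [refl_apply, vacuum_apply, vacuum_apply, norm_neg]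

theorem refl_smul (c : ℂ) (h : 𝓢(Plane, ℂ)) : refl (c • h) = c • refl h := rfl

theorem mstar_vacuum_mstar_vacuum (φ : 𝓢(Plane, ℂ)) :
    mstar θ (vacuum θ) (mstar θ (vacuum θ) φ) = mstar θ (vacuum θ) φ := by
  have h : tconv θ (refl (coeff θ (vacuum θ))) (coeff θ (vacuum θ)) = coeff θ (vacuum θ) := by
    have h1 := mstar_vacuum_vacuum θ
    rw [mstar, coeff_vacuum] at h1
    rw [coeff_vacuum, refl_smul, refl_vacuum, tconv_smul_right, h1]
  rw [mstar, mstar, tconv_tconv, h]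

/-- Left multiplication by the vacuum is a projection. -/
theorem leftMul_vacuum_leftMul_vacuum (ψ : L2) :
    leftMul θ (vacuum θ) (leftMul θ (vacuum θ) ψ) = leftMul θ (vacuum θ) ψ :=
  denseRange_toL2.induction_on
    (p := fun ψ => leftMul θ (vacuum θ) (leftMul θ (vacuum θ) ψ) = leftMul θ (vacuum θ) ψ) ψ
    (isClosed_eq (by fun_prop) (by fun_prop)) fun φ => by
      rw [leftMul_toLp, leftMul_toLp, mstar_vacuum_mstar_vacuum]

end

section

/-! ### Anti-Wick quantisation -/

variable (θ : ℝ) [hθ : Fact (0 < θ)]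

theorem norm_leftMul_le_integral (f : 𝓢(Plane, ℂ)) : ‖leftMul θ f‖ ≤ ∫ v, ‖coeff θ f v‖ := by
  refine opNorm_le_of_inner (by positivity) fun χ ψ => ?_
  rw [inner_leftMul, ← integral_mul_const]
  refine norm_integral_le_of_norm_le ((coeff θ f).integrable.norm.mul_const _)
    (Eventually.of_forall fun v => ?_)
  rw [norm_mul]
  exact mul_le_mul_of_nonneg_left (norm_inner_shift_le θ χ ψ v) (norm_nonneg _)

/-- The coherent state projection centred at `y`. -/
def coherent (y : Plane) : L2 →L[ℂ] L2 := leftMul θ (translate (-y) (vacuum θ))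

theorem coherent_coherent (y : Plane) (ψ : L2) :
    coherent θ y (coherent θ y ψ) = coherent θ y ψ := by
  simp only [coherent, leftMul_translate, shift_neg_shift, leftMul_vacuum_leftMul_vacuum]

theorem inner_coherent_left (y : Plane) (χ ψ : L2) :
    inner ℂ (coherent θ y χ) ψ = inner ℂ χ (coherent θ y ψ) := by
  have h : conjS (translate (-y) (vacuum θ)) = translate (-y) (vacuum θ) := by
    ext x
    have := congrArg (fun f : 𝓢(Plane, ℂ) => f (x + -y)) (conjS_vacuum θ)
    exact this
  rw [coherent, inner_leftMul_left, h]

theorem re_inner_coherent (y : Plane) (χ : L2) :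
    (inner ℂ χ (coherent θ y χ)).re = ‖coherent θ y χ‖ ^ 2 := by
  rw [← coherent_coherent, ← inner_coherent_left, inner_self_eq_norm_sq_to_K, coherent_coherent]
  norm_cast

/-- The Cauchy–Schwarz inequality for a projection, together with `2ab ≤ a² + b²`. -/
theorem norm_inner_coherent_le (y : Plane) (χ ψ : L2) : ‖inner ℂ χ (coherent θ y ψ)‖
    ≤ ((inner ℂ χ (coherent θ y χ)).re + (inner ℂ ψ (coherent θ y ψ)).re) / 2 := by
  rw [re_inner_coherent, re_inner_coherent, ← coherent_coherent θ y ψ, ← inner_coherent_left,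
    coherent_coherent]
  refine (norm_inner_le_norm _ _).trans ?_
  nlinarith [sq_nonneg (‖coherent θ y χ‖ - ‖coherent θ y ψ‖)]

theorem exists_antiWick (τ : 𝓢(Plane, ℂ)) : ∃ f : 𝓢(Plane, ℂ), ∀ v,
    coeff θ f v = ((Real.exp (-(1 / θ) * ‖v‖ ^ 2) : ℝ) : ℂ) * coeff θ τ v := by
  obtain ⟨f, hf⟩ := coeff_surjective θ
    (SchwartzMap.smulLeftCLM ℂ (gauss (inv_theta_pos θ)) (coeff θ τ))
  refine ⟨f, fun v => ?_⟩
  rw [hf, SchwartzMap.smulLeftCLM_apply_apply (SchwartzMap.hasTemperateGrowth _), gauss_apply,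
    smul_eq_mul]

/-- The anti-Wick quantisation of the symbol `τ`: the convolution of `τ` with a Gaussian function,
described by its symplectic Fourier transform. -/
def antiWick (τ : 𝓢(Plane, ℂ)) : 𝓢(Plane, ℂ) := (exists_antiWick θ τ).choose

theorem coeff_antiWick (τ : 𝓢(Plane, ℂ)) (v : Plane) : coeff θ (antiWick θ τ) v
    = ((Real.exp (-(1 / θ) * ‖v‖ ^ 2) : ℝ) : ℂ) * coeff θ τ v :=
  (exists_antiWick θ τ).choose_spec v

theorem antiWick_kernel_integrable (τ : 𝓢(Plane, ℂ)) (χ ψ : L2) :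
    Integrable (fun p : Plane × Plane => vacuum θ p.1 * τ p.2 *
      (twist θ p.2 p.1 * inner ℂ χ (shift θ p.1 ψ))) (volume.prod volume) := by
  have hi := ((vacuum θ).integrable (μ := volume)).mul_prod (τ.integrable (μ := volume))
  refine hi.mul_bdd (c := ‖χ‖ * ‖ψ‖) ?_ (Eventually.of_forall fun p => ?_)
  · have c1 : Continuous fun p : Plane × Plane => twist θ p.2 p.1 :=
      (continuous_twist θ).comp (continuous_snd.prodMk continuous_fst)
    have c2 : Continuous fun p : Plane × Plane => inner ℂ χ (shift θ p.1 ψ) :=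
      (continuous_inner_shift θ χ ψ).comp continuous_fst
    exact (c1.mul c2).aestronglyMeasurable
  · rw [norm_mul, norm_twist, one_mul]
    exact norm_inner_shift_le θ χ ψ _

theorem mul_inner_coherent (τ : 𝓢(Plane, ℂ)) (χ ψ : L2) (y : Plane) :
    τ y * inner ℂ χ (coherent θ y ψ) = (1 / (Real.pi * θ) : ℂ) * ∫ v, vacuum θ v * τ y *
      (twist θ y v * inner ℂ χ (shift θ v ψ)) := by
  rw [coherent, inner_leftMul, ← integral_const_mul, ← integral_const_mul]
  congr 1
  funext v
  rw [coeff_translate, neg_neg, coeff_vacuum, _root_.smul_apply, smul_eq_mul]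
  ring

theorem integrable_mul_inner_coherent (τ : 𝓢(Plane, ℂ)) (χ ψ : L2) :
    Integrable fun y => τ y * inner ℂ χ (coherent θ y ψ) := by
  simp only [mul_inner_coherent]
  exact (antiWick_kernel_integrable θ τ χ ψ).integral_prod_right.const_mul _

/-- The anti-Wick quantisation is the superposition of the coherent state projections weighted by
the symbol. -/
theorem inner_leftMul_antiWick (τ : 𝓢(Plane, ℂ)) (χ ψ : L2) :
    inner ℂ χ (leftMul θ (antiWick θ τ) ψ)
      = (1 / (2 * Real.pi * θ) : ℂ) * ∫ y, τ y * inner ℂ χ (coherent θ y ψ) := by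
  have h0' : (θ : ℂ) ≠ 0 := by exact_mod_cast hθ.out.ne'
  have hpi : (Real.pi : ℂ) ≠ 0 := by exact_mod_cast Real.pi_ne_zero
  simp only [mul_inner_coherent]
  rw [integral_const_mul, ← integral_integral_swap (antiWick_kernel_integrable θ τ χ ψ),
    inner_leftMul, ← integral_const_mul, ← integral_const_mul]
  congr 1
  funext v
  have h1 : ∫ y, vacuum θ v * τ y * (twist θ y v * inner ℂ χ (shift θ v ψ))
      = vacuum θ v * inner ℂ χ (shift θ v ψ) * ∫ y, τ y * twist θ y v := by
    rw [← integral_const_mul]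
    congr 1
    funext y
    ring
  rw [h1, coeff_antiWick, coeff_apply, vacuum_apply]
  push_cast
  field_simp

/-- The symplectic Fourier transform of a Gaussian function is positive, and its integral is the
value at the origin, which is one. -/
theorem norm_leftMul_antiWick_gauss_le {δ : ℝ} (hδ : 0 < δ) :
    ‖leftMul θ (antiWick θ (gauss hδ))‖ ≤ 1 := by
  have h1 : ∫ v, ‖coeff θ (gauss hδ) v‖ = 1 := by
    have h2 : ∀ v, ((‖coeff θ (gauss hδ) v‖ : ℝ) : ℂ) = coeff θ (gauss hδ) v := by
      intro v
      rw [coeff_gauss, Complex.norm_real, Real.norm_of_nonneg]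
      have := hθ.out
      have := Real.pi_pos
      positivity
    have h3 := integral_coeff θ (gauss hδ)
    rw [gauss_zero, ← integral_congr_ae (Eventually.of_forall h2), integral_complex_ofReal] at h3
    exact_mod_cast h3
  refine (norm_leftMul_le_integral θ _).trans (le_of_le_of_eq ?_ h1)
  refine integral_mono (coeff θ _).integrable.norm (coeff θ _).integrable.norm fun v => ?_
  rw [coeff_antiWick, norm_mul, Complex.norm_real, Real.norm_of_nonneg (Real.exp_nonneg _)]
  refine mul_le_of_le_one_left (norm_nonneg _) (Real.exp_le_one_iff.2 ?_)
  have := inv_theta_pos θ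
  nlinarith [sq_nonneg ‖v‖]

/-- The anti-Wick quantisation of a symbol bounded by a Gaussian function of height one is a
contraction: the quantisation is monotone, and that of the Gaussian function is a contraction
because its symplectic Fourier transform is positive. -/
theorem norm_leftMul_antiWick_le {τ : 𝓢(Plane, ℂ)} {δ : ℝ} (hδ : 0 < δ)
    (hτ : ∀ y, ‖τ y‖ ≤ Real.exp (-δ * ‖y‖ ^ 2)) : ‖leftMul θ (antiWick θ τ)‖ ≤ 1 := by
  have hc : 0 < 1 / (2 * Real.pi * θ) := by
    have := hθ.out
    have := Real.pi_pos
    positivity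
  have hre : ∀ χ : L2, 1 / (2 * Real.pi * θ) * ∫ y, Real.exp (-δ * ‖y‖ ^ 2)
      * (inner ℂ χ (coherent θ y χ)).re ≤ ‖χ‖ ^ 2 := by
    intro χ
    have h1 := congrArg Complex.re (inner_leftMul_antiWick θ (gauss hδ) χ χ)
    have h2 : (1 / (2 * Real.pi * θ) : ℂ) = ((1 / (2 * Real.pi * θ) : ℝ) : ℂ) := by push_cast; rfl
    rw [h2, Complex.re_ofReal_mul, ← RCLike.re_to_complex, ← RCLike.re_to_complex,
      ← integral_re (integrable_mul_inner_coherent θ _ χ χ)] at h1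
    simp only [gauss_apply, RCLike.re_to_complex, Complex.re_ofReal_mul] at h1
    rw [← h1]
    refine (Complex.re_le_norm _).trans ((norm_inner_le_norm _ _).trans ?_)
    rw [sq]
    refine mul_le_mul_of_nonneg_left ?_ (norm_nonneg _)
    exact (ContinuousLinearMap.le_of_opNorm_le _ (norm_leftMul_antiWick_gauss_le θ hδ) χ).trans_eq
      (one_mul _)
  have hint : ∀ χ : L2, Integrable fun y => Real.exp (-δ * ‖y‖ ^ 2)
      * (inner ℂ χ (coherent θ y χ)).re := by
    intro χ
    have := (integrable_mul_inner_coherent θ (gauss hδ) χ χ).re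
    simpa only [gauss_apply, RCLike.re_to_complex, Complex.re_ofReal_mul] using this
  have key : ∀ χ ψ : L2, ‖inner ℂ χ (leftMul θ (antiWick θ τ) ψ)‖
      ≤ (‖χ‖ ^ 2 + ‖ψ‖ ^ 2) / 2 := by
    intro χ ψ
    have h2 : ‖(1 / (2 * Real.pi * θ) : ℂ)‖ = 1 / (2 * Real.pi * θ) := by
      rw [show (1 / (2 * Real.pi * θ) : ℂ) = ((1 / (2 * Real.pi * θ) : ℝ) : ℂ) by push_cast; rfl,
        Complex.norm_real, Real.norm_of_nonneg hc.le]
    rw [inner_leftMul_antiWick, norm_mul, h2]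
    have h3 : ‖∫ y, τ y * inner ℂ χ (coherent θ y ψ)‖ ≤ ∫ y,
        (Real.exp (-δ * ‖y‖ ^ 2) * (inner ℂ χ (coherent θ y χ)).re
          + Real.exp (-δ * ‖y‖ ^ 2) * (inner ℂ ψ (coherent θ y ψ)).re) / 2 := by
      refine norm_integral_le_of_norm_le (((hint χ).add (hint ψ)).div_const 2)
        (Eventually.of_forall fun y => ?_)
      rw [norm_mul, ← mul_add, mul_div_assoc]
      exact mul_le_mul (hτ y) (norm_inner_coherent_le θ y χ ψ) (norm_nonneg _) (Real.exp_nonneg _)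
    rw [integral_div, integral_add (hint χ) (hint ψ)] at h3
    have h4 := mul_le_mul_of_nonneg_left h3 hc.le
    have h5 := hre χ
    have h6 := hre ψ
    rw [← mul_div_assoc, mul_add] at h4
    linarith
  refine opNorm_le_of_inner zero_le_one fun χ ψ => ?_
  rw [one_mul]
  rcases eq_or_ne χ 0 with rfl | hχ
  · simp
  rcases eq_or_ne ψ 0 with rfl | hψ
  · simp
  have hχ' := norm_pos_iff.2 hχ
  have hψ' := norm_pos_iff.2 hψ
  have h := key (((‖χ‖ : ℂ)⁻¹) • χ) (((‖ψ‖ : ℂ)⁻¹) • ψ)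
  rw [inner_smul_left, map_smul, inner_smul_right, norm_mul, norm_mul] at h
  simp only [norm_smul, RCLike.norm_conj, norm_inv, Complex.norm_real, norm_norm,
    inv_mul_cancel₀ hχ'.ne', inv_mul_cancel₀ hψ'.ne'] at h
  rw [← mul_assoc, ← mul_inv, inv_mul_le_iff₀ (by positivity)] at h
  linarith

end

section

/-! ### Lipschitz elements that detect translations -/

theorem norm_euclidean_eq (y : Plane) : ‖y‖ ^ 2 = ‖(⟨y 0, y 1⟩ : ℂ)‖ ^ 2 := by
  rw [← Complex.normSq_eq_norm_sq, Complex.normSq_apply, EuclideanSpace.norm_sq_eq,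
    Fin.sum_univ_two]
  simp [sq]

/-- The left-hand side is `1 - a² (2 - t)` with `t = a² + b²`; the bound follows from the cubic
Taylor polynomial of the exponential function. -/
theorem one_sub_sq_le_exp {a b : ℝ} :
    (1 - a ^ 2) ^ 2 + (a * b) ^ 2 ≤ Real.exp (3 / 4 * (a ^ 2 + b ^ 2)) := by
  set t := a ^ 2 + b ^ 2 with ht
  have ht0 : 0 ≤ t := by positivity
  have h1 : (1 - a ^ 2) ^ 2 + (a * b) ^ 2 = 1 - a ^ 2 * (2 - t) := by rw [ht]; ring
  rw [h1]
  have h2 : 1 + 3 / 4 * t + (3 / 4 * t) ^ 2 / 2 + (3 / 4 * t) ^ 3 / 6 ≤ Real.exp (3 / 4 * t) := by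
    have := Real.sum_le_exp_of_nonneg (x := 3 / 4 * t) (by positivity) 4
    simpa [Finset.sum_range_succ, Nat.factorial] using this
  refine le_trans ?_ h2
  have ha : a ^ 2 ≤ t := by rw [ht]; nlinarith [sq_nonneg b]
  rcases le_total t 2 with h | h
  · nlinarith [mul_nonneg (sq_nonneg a) (sub_nonneg.2 h), pow_nonneg ht0 2, pow_nonneg ht0 3]
  · have h3 : a ^ 2 * (t - 2) ≤ t * (t - 2) := mul_le_mul_of_nonneg_right ha (by linarith)
    have h4 : 0 ≤ t * (11 / 4 - 23 / 32 * t + 9 / 128 * t ^ 2) :=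
      mul_nonneg ht0 (by nlinarith [sq_nonneg (t - 46 / 9)])
    nlinarith

/-- The derivatives `∂₁ ± i ∂₂` of the symbol `x ↦ ⟨u, x⟩ exp (-c |x|²)` are dominated by a
Gaussian function of height one. -/
theorem norm_symbol_le {c : ℝ} (hc : 0 < c) {w z : ℂ} (hw : ‖w‖ = 1) {N : ℝ}
    (hN : N ^ 2 = ‖z‖ ^ 2) :
    ‖(w - 2 * c * ((w.re * z.re + w.im * z.im : ℝ) : ℂ) * z)‖ * Real.exp (-c * N ^ 2)
      ≤ Real.exp (-(c / 4) * N ^ 2) := by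
  have hw2 : w.re ^ 2 + w.im ^ 2 = 1 := by
    have := congrArg (· ^ 2) hw
    simp only [← Complex.normSq_eq_norm_sq, Complex.normSq_apply] at this
    linarith
  have hz2 : ‖z‖ ^ 2 = z.re ^ 2 + z.im ^ 2 := by
    rw [← Complex.normSq_eq_norm_sq, Complex.normSq_apply]; ring
  set s := Real.sqrt (2 * c) with hs
  have hs2 : s ^ 2 = 2 * c := Real.sq_sqrt (by positivity)
  set a := s * (w.re * z.re + w.im * z.im) with ha
  set b := s * (w.re * z.im - w.im * z.re) with hb
  have hab : a ^ 2 + b ^ 2 = 2 * c * N ^ 2 := by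
    have : a ^ 2 + b ^ 2 = s ^ 2 * (w.re ^ 2 + w.im ^ 2) * (z.re ^ 2 + z.im ^ 2) := by
      rw [ha, hb]; ring
    rw [this, hs2, hw2, hN, hz2]
    ring
  have h1 : ‖(w - 2 * c * ((w.re * z.re + w.im * z.im : ℝ) : ℂ) * z)‖ ^ 2
      = (1 - a ^ 2) ^ 2 + (a * b) ^ 2 := by
    rw [← Complex.normSq_eq_norm_sq, Complex.normSq_apply]
    have e1 : (w - 2 * c * ((w.re * z.re + w.im * z.im : ℝ) : ℂ) * z).re
        = w.re - s ^ 2 * (w.re * z.re + w.im * z.im) * z.re := by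
      rw [hs2]; simp [-Complex.ofReal_add, -Complex.ofReal_mul]
    have e2 : (w - 2 * c * ((w.re * z.re + w.im * z.im : ℝ) : ℂ) * z).im
        = w.im - s ^ 2 * (w.re * z.re + w.im * z.im) * z.im := by
      rw [hs2]; simp [-Complex.ofReal_add, -Complex.ofReal_mul]
    rw [e1, e2]
    have e3 : (1 - a ^ 2) ^ 2 + (a * b) ^ 2
        = 1 - 2 * a ^ 2 + a ^ 2 * (a ^ 2 + b ^ 2) := by ring
    have e4 : a ^ 2 + b ^ 2 = s ^ 2 * (z.re ^ 2 + z.im ^ 2) := by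
      rw [hab, hs2, hN, hz2]
    rw [e3, e4, ha]
    linear_combination hw2
  have h2 : ‖(w - 2 * c * ((w.re * z.re + w.im * z.im : ℝ) : ℂ) * z)‖
      ≤ Real.exp (3 / 8 * (a ^ 2 + b ^ 2)) := by
    refine le_of_sq_le_sq ?_ (Real.exp_nonneg _)
    rw [h1, ← Real.exp_nat_mul]
    refine one_sub_sq_le_exp.trans_eq ?_
    congr 1
    push_cast
    ring
  refine (mul_le_mul_of_nonneg_right h2 (Real.exp_nonneg _)).trans_eq ?_
  rw [← Real.exp_add, hab]
  congr 1
  ring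

theorem pd_coord (i j : Fin 2) (f : 𝓢(Plane, ℂ)) :
    pd j (coord i f) = (if i = j then f else 0) + coord i (pd j f) := by
  ext x
  have h1 : HasFDerivAt (fun x : Plane => ((x i : ℝ) : ℂ))
      (Complex.ofRealCLM.comp (EuclideanSpace.proj (𝕜 := ℝ) i)) x :=
    (Complex.ofRealCLM.comp (EuclideanSpace.proj (𝕜 := ℝ) i)).hasFDerivAt
  have h2 : HasFDerivAt (coord i f) (((x i : ℝ) : ℂ) • fderiv ℝ f x
      + f x • (Complex.ofRealCLM.comp (EuclideanSpace.proj (𝕜 := ℝ) i))) x :=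
    (h1.mul f.differentiableAt.hasFDerivAt).congr_of_eventuallyEq
      (Eventually.of_forall fun y => coord_apply i f y)
  rw [pd_eq_fderiv, h2.fderiv, _root_.add_apply, _root_.add_apply, coord_apply, pd_eq_fderiv]
  by_cases h : i = j
  · subst h
    simp [e]
    ring
  · simp [h, e]

/-- The symbol `x ↦ ⟨u, x⟩ exp (-c |x|²)`. -/
def symbol {c : ℝ} (hc : 0 < c) (u : Plane) : 𝓢(Plane, ℂ) :=
  (u 0 : ℂ) • coord 0 (gauss hc) + (u 1 : ℂ) • coord 1 (gauss hc)

theorem dirDeriv_gauss {c : ℝ} (hc : 0 < c) (u : Plane) :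
    dirDeriv u (gauss hc) = (-(2 * c) : ℂ) • symbol hc u := by
  rw [dirDeriv, symbol, pd_gauss, pd_gauss]
  module

theorem pd_symbol_apply {c : ℝ} (hc : 0 < c) (u : Plane) (j : Fin 2) (y : Plane) :
    pd j (symbol hc u) y
      = (u j - 2 * c * ((u 0 * y 0 + u 1 * y 1 : ℝ) : ℂ) * y j) * gauss hc y := by
  fin_cases j
  all_goals
    simp [symbol, pd_coord, pd_gauss, coord_apply]
    ring

variable {θ : ℝ}

/-- A state of the Moyal algebra is evaluated at differences through its extension to the
`C*`-closure. -/
theorem IsState.exists_apply_sub [Fact (0 < θ)] {φ : 𝓢(Plane, ℂ) → ℂ} (hφ : IsState θ φ) :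
    ∃ Φ : CStarState (closureAlg θ), (∀ f, φ f = Φ.toCLM ⟨leftMul θ f, leftMul_mem θ f⟩) ∧
      ∀ f g, φ f - φ g = Φ.toCLM ⟨leftMul θ (f - g), leftMul_mem θ (f - g)⟩ := by
  obtain ⟨Φ, hΦ⟩ := hφ
  refine ⟨Φ, hΦ, fun f g => ?_⟩
  rw [hΦ, hΦ, ← map_sub]
  congr 1
  exact Subtype.ext (leftMul_sub θ f g).symm

variable [hθ : Fact (0 < θ)]

/-- The derivative in the direction `κ` is a combination of `∂₁ ± i ∂₂` with coefficients of modulus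
`|κ| / 2`. -/
theorem norm_leftMul_dirDeriv_le {f : 𝓢(Plane, ℂ)} (hf : CommutatorLeOne θ f) (κ : Plane) :
    ‖leftMul θ (dirDeriv κ f)‖ ≤ ‖κ‖ := by
  obtain ⟨h1, h2⟩ := (commutatorLeOne_iff θ f).1 hf
  let w : ℂ := ⟨κ 0, κ 1⟩
  have hw : ‖w‖ = ‖κ‖ := by
    rw [← sq_eq_sq₀ (norm_nonneg _) (norm_nonneg _), ← Complex.normSq_eq_norm_sq,
      Complex.normSq_apply, EuclideanSpace.norm_sq_eq, Fin.sum_univ_two]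
    simp [w, sq]
  have h3 : dirDeriv κ f = ((starRingEnd ℂ) w / 2) • dbar f + (w / 2) • del f := by
    have hw1 : w = κ 0 + κ 1 * Complex.I := Complex.ext (by simp [w]) (by simp [w])
    have hw2 : (starRingEnd ℂ) w = κ 0 - κ 1 * Complex.I :=
      Complex.ext (by simp [w]) (by simp [w])
    ext x
    rw [hw2, hw1]
    simp only [dirDeriv, dbar, del, _root_.add_apply, _root_.sub_apply, _root_.smul_apply,
      smul_eq_mul]
    linear_combination (κ 1 * pd 1 f x) * Complex.I_mul_I
  rw [h3, leftMul_add, leftMul_smul, leftMul_smul, ← hw]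
  refine (norm_add_le _ _).trans ?_
  rw [norm_smul, norm_smul, norm_div, norm_div, RCLike.norm_conj]
  norm_num
  nlinarith [norm_nonneg w]

theorem norm_leftMul_sub_translate_le {f : 𝓢(Plane, ℂ)} (hf : CommutatorLeOne θ f) (κ : Plane) :
    ‖leftMul θ (f - translate κ f)‖ ≤ ‖κ‖ := by
  rw [leftMul_sub, norm_sub_rev]
  exact (norm_leftMul_translate_sub_le θ κ f).trans (norm_leftMul_dirDeriv_le hf κ)

/-- The upper bound: states have norm one, and a translation moves a Lipschitz element by at most
`|κ|`. -/
theorem spectralDist_translateState_le {φ : 𝓢(Plane, ℂ) → ℂ} (hφ : IsState θ φ) (κ : Plane) :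
    spectralDist θ φ (translateState κ φ) ≤ ENNReal.ofReal ‖κ‖ := by
  obtain ⟨Φ, -, hΦ⟩ := hφ.exists_apply_sub
  refine iSup₂_le fun f hf => ?_
  rw [translateState, hΦ, ← ofReal_norm]
  refine ENNReal.ofReal_le_ofReal ((Φ.norm_apply_le _).trans ?_)
  exact norm_leftMul_sub_translate_le hf κ

variable (θ)

theorem antiWick_pd (i : Fin 2) (τ : 𝓢(Plane, ℂ)) :
    antiWick θ (pd i τ) = pd i (antiWick θ τ) := by
  refine coeff_injective θ ?_
  ext v
  rw [coeff_antiWick]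
  fin_cases i
  · simp only [Fin.zero_eta, coeff_pd_zero, _root_.smul_apply, coord_apply, coeff_antiWick,
      smul_eq_mul]
    ring
  · simp only [Fin.mk_one, coeff_pd_one, _root_.smul_apply, coord_apply, coeff_antiWick,
      smul_eq_mul]
    ring

theorem antiWick_add (τ σ : 𝓢(Plane, ℂ)) :
    antiWick θ (τ + σ) = antiWick θ τ + antiWick θ σ := by
  refine coeff_injective θ ?_
  ext v
  simp only [map_add, _root_.add_apply, coeff_antiWick, mul_add]

theorem antiWick_smul (c : ℂ) (τ : 𝓢(Plane, ℂ)) : antiWick θ (c • τ) = c • antiWick θ τ := by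
  refine coeff_injective θ ?_
  ext v
  simp only [map_smul, _root_.smul_apply, coeff_antiWick, smul_eq_mul]
  ring

theorem antiWick_sub (τ σ : 𝓢(Plane, ℂ)) :
    antiWick θ (τ - σ) = antiWick θ τ - antiWick θ σ := by
  rw [sub_eq_add_neg, antiWick_add, ← neg_one_smul ℂ σ, antiWick_smul, neg_one_smul,
    ← sub_eq_add_neg]

theorem antiWick_dbar (τ : 𝓢(Plane, ℂ)) : antiWick θ (dbar τ) = dbar (antiWick θ τ) := by
  rw [dbar, antiWick_add, antiWick_smul, antiWick_pd, antiWick_pd, dbar]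

theorem antiWick_del (τ : 𝓢(Plane, ℂ)) : antiWick θ (del τ) = del (antiWick θ τ) := by
  rw [del, antiWick_sub, antiWick_smul, antiWick_pd, antiWick_pd, del]

theorem antiWick_dirDeriv (κ : Plane) (τ : 𝓢(Plane, ℂ)) :
    antiWick θ (dirDeriv κ τ) = dirDeriv κ (antiWick θ τ) := by
  rw [dirDeriv, antiWick_add, antiWick_smul, antiWick_smul, antiWick_pd, antiWick_pd, dirDeriv]

/-- The anti-Wick quantisation of a Gaussian function is a Gaussian function. -/
theorem antiWick_gauss {b c : ℝ} (hb : 0 < b) (hc : 0 < c) (hbc : 1 / c = 1 / b - θ) :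
    antiWick θ (gauss hc) = ((1 - θ * b : ℝ) : ℂ) • gauss hb := by
  refine coeff_injective θ ?_
  ext v
  have h0 := hθ.out.ne'
  have h1 : 1 / (θ ^ 2 * c) = 1 / (θ ^ 2 * b) - 1 / θ := by
    rw [← one_div_mul_one_div, hbc]
    field_simp
  have h2 : 1 / (Real.pi * θ ^ 2 * c) = (1 - θ * b) * (1 / (Real.pi * θ ^ 2 * b)) := by
    rw [mul_assoc, ← one_div_mul_one_div, h1]
    field_simp
  rw [coeff_antiWick, coeff_gauss, map_smul, _root_.smul_apply, coeff_gauss, smul_eq_mul, h1, h2,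
    ← Complex.ofReal_mul, ← Complex.ofReal_mul, mul_left_comm, ← Real.exp_add]
  congr 1
  rw [show -(1 / θ) * ‖v‖ ^ 2 + -(1 / (θ ^ 2 * b) - 1 / θ) * ‖v‖ ^ 2
    = -(1 / (θ ^ 2 * b)) * ‖v‖ ^ 2 by ring]
  ring

/-- Quantisation commutes with derivatives, and the derivatives `∂₁ ± i ∂₂` of the symbol are
dominated by a Gaussian function of height one. -/
theorem commutatorLeOne_antiWick_symbol {c : ℝ} (hc : 0 < c) {u : Plane} (hu : ‖u‖ = 1) :
    CommutatorLeOne θ (antiWick θ (symbol hc u)) := by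
  have hw : ‖(⟨u 0, u 1⟩ : ℂ)‖ = 1 := by
    have := norm_euclidean_eq u
    rw [hu, one_pow] at this
    exact (pow_eq_one_iff_of_nonneg (norm_nonneg _) two_ne_zero).1 this.symm
  rw [commutatorLeOne_iff, ← antiWick_dbar, ← antiWick_del]
  constructor
  · refine norm_leftMul_antiWick_le θ (by positivity : 0 < c / 4) fun y => ?_
    refine le_of_eq_of_le ?_ (norm_symbol_le hc hw (norm_euclidean_eq y))
    have h1 : dbar (symbol hc u) y = ((⟨u 0, u 1⟩ : ℂ)
        - 2 * c * ((u 0 * y 0 + u 1 * y 1 : ℝ) : ℂ) * (⟨y 0, y 1⟩ : ℂ)) * gauss hc y := by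
      rw [dbar, _root_.add_apply, _root_.smul_apply, pd_symbol_apply, pd_symbol_apply,
        Complex.mk_eq_add_mul_I, Complex.mk_eq_add_mul_I, smul_eq_mul]
      ring
    rw [h1, norm_mul, gauss_apply, Complex.norm_real, Real.norm_of_nonneg (Real.exp_nonneg _)]
  · refine norm_leftMul_antiWick_le θ (by positivity : 0 < c / 4) fun y => ?_
    refine le_of_eq_of_le ?_ (norm_symbol_le (w := (⟨u 0, -u 1⟩ : ℂ)) (z := (⟨y 0, -y 1⟩ : ℂ)) hc
      ?_ (N := ‖y‖) ?_)
    · have h1 : del (symbol hc u) y = ((⟨u 0, -u 1⟩ : ℂ)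
          - 2 * c * ((u 0 * y 0 + (-u 1) * (-y 1) : ℝ) : ℂ) * (⟨y 0, -y 1⟩ : ℂ))
            * gauss hc y := by
        rw [del, _root_.sub_apply, _root_.smul_apply, pd_symbol_apply, pd_symbol_apply,
          Complex.mk_eq_add_mul_I, Complex.mk_eq_add_mul_I, smul_eq_mul]
        push_cast
        ring
      rw [h1, norm_mul, gauss_apply, Complex.norm_real, Real.norm_of_nonneg (Real.exp_nonneg _)]
    · rw [← hw, ← Complex.norm_conj (⟨u 0, u 1⟩ : ℂ)]
      rfl
    · rw [norm_euclidean_eq, ← Complex.norm_conj]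
      rfl

/-- The Lipschitz elements that detect a translation in the direction `u`; they approach the
function `x ↦ ⟨u, x⟩` as `b` tends to zero. -/
theorem exists_detector {b : ℝ} (hb : 0 < b) (hθb : θ * b < 1) {u : Plane} (hu : ‖u‖ = 1) :
    ∃ f : 𝓢(Plane, ℂ), CommutatorLeOne θ f ∧
      (∀ x, f x = (((1 - θ * b) ^ 2 * (u 0 * x 0 + u 1 * x 1) * Real.exp (-b * ‖x‖ ^ 2) : ℝ) : ℂ)) ∧
      ∀ v, ‖coeff θ f v‖ ≤ 2 / θ * (1 / (Real.pi * θ ^ 2 * b)) * (1 / (2 * b)) * ‖v‖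
        * Real.exp (-(1 / (θ ^ 2 * b)) * ‖v‖ ^ 2) := by
  have h0 := hθ.out
  have h1 : 0 < 1 - θ * b := by linarith
  have hc : 0 < b / (1 - θ * b) := by positivity
  have hbc : 1 / (b / (1 - θ * b)) = 1 / b - θ := by field_simp
  refine ⟨_, commutatorLeOne_antiWick_symbol θ hc hu, ?_, ?_⟩
  all_goals
    have hf : antiWick θ (symbol hc u)
        = (-(((1 - θ * b) ^ 2 / (2 * b) : ℝ) : ℂ)) • dirDeriv u (gauss hb) := by
      have h2 := dirDeriv_gauss hc u
      have h3 := antiWick_dirDeriv θ u (gauss hc)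
      rw [h2, antiWick_smul, antiWick_gauss θ hb hc hbc] at h3
      have h4 : dirDeriv u (((1 - θ * b : ℝ) : ℂ) • gauss hb)
          = ((1 - θ * b : ℝ) : ℂ) • dirDeriv u (gauss hb) := by
        simp only [dirDeriv, map_smul]
        module
      rw [h4] at h3
      have h5 : (-(2 * ((b / (1 - θ * b) : ℝ) : ℂ))) ≠ 0 := by
        have : ((b / (1 - θ * b) : ℝ) : ℂ) ≠ 0 := by exact_mod_cast hc.ne'
        simpa using this
      have h6 := congrArg (fun F => (-(2 * ((b / (1 - θ * b) : ℝ) : ℂ)))⁻¹ • F) h3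
      simp only [smul_smul] at h6
      rw [inv_mul_cancel₀ h5, one_smul] at h6
      rw [h6]
      congr 1
      rw [inv_mul_eq_div, div_eq_iff h5]
      have : (((1 - θ * b) ^ 2 / (2 * b) : ℝ)) * (2 * (b / (1 - θ * b))) = 1 - θ * b := by
        field_simp
      rw [neg_mul_neg]
      exact_mod_cast this.symm
    rw [hf]
  · intro x
    rw [dirDeriv_gauss, smul_smul, _root_.smul_apply, symbol, _root_.add_apply,
      _root_.smul_apply, _root_.smul_apply, coord_apply, coord_apply, gauss_apply]
    have hb' : (b : ℂ) ≠ 0 := by exact_mod_cast hb.ne'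
    push_cast
    simp only [smul_eq_mul]
    field_simp
  · intro v
    have hlin : |u 1 * v 0 - u 0 * v 1| ≤ ‖v‖ := by
      have e1 : u 0 ^ 2 + u 1 ^ 2 = 1 := by
        have := EuclideanSpace.norm_sq_eq u
        rw [hu, Fin.sum_univ_two] at this
        simpa using this.symm
      have e2 : ‖v‖ ^ 2 = v 0 ^ 2 + v 1 ^ 2 := by
        simp [EuclideanSpace.norm_sq_eq, Fin.sum_univ_two]
      refine abs_le_of_sq_le_sq ?_ (norm_nonneg v)
      rw [e2]
      nlinarith [sq_nonneg (u 0 * v 0 + u 1 * v 1)]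
    have htc : ‖tc θ‖ = 2 / θ := by
      rw [tc]
      simp [abs_of_pos h0]
    have hlin2 : ‖((u 1 : ℂ) * v 0 - u 0 * v 1)‖ ≤ ‖v‖ := by
      rw [← Real.norm_eq_abs, ← Complex.norm_real] at hlin
      simpa using hlin
    rw [map_smul, _root_.smul_apply, coeff_dirDeriv, coeff_gauss, norm_smul, norm_mul, norm_mul,
      htc, norm_neg, Complex.norm_real, Complex.norm_real,
      Real.norm_of_nonneg (by positivity), Real.norm_of_nonneg (by positivity)]
    have h7 : (1 - θ * b) ^ 2 / (2 * b) ≤ 1 / (2 * b) := by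
      have : (1 - θ * b) ^ 2 ≤ 1 := by
        have : 0 < θ * b := by positivity
        nlinarith
      gcongr
    calc _ ≤ 1 / (2 * b) * (2 / θ * ‖v‖ * (1 / (Real.pi * θ ^ 2 * b)
          * Real.exp (-(1 / (θ ^ 2 * b)) * ‖v‖ ^ 2))) := by
          have : 0 ≤ 1 / (Real.pi * θ ^ 2 * b) * Real.exp (-(1 / (θ ^ 2 * b)) * ‖v‖ ^ 2) := by
            positivity
          gcongr
      _ = _ := by ring

end

section

/-! ### The lower bound by strictly convergent elements -/

theorem tendsto_closureAlg {θ : ℝ} {ι : Type*} {l : Filter ι} {x : ι → closureAlg θ}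
    {a : closureAlg θ}
    (h : Tendsto (fun i => (x i : L2 →L[ℂ] L2)) l (nhds (a : L2 →L[ℂ] L2))) :
    Tendsto x l (nhds a) := tendsto_subtype_rng.2 h

variable (θ : ℝ)

theorem norm_one_sub_twist_le (hθ : 0 < θ) (κ v : Plane) :
    ‖1 - twist θ κ v‖ ≤ 2 / θ * ‖κ‖ * ‖v‖ := by
  have h1 : twist θ κ v
      = Complex.exp (Complex.I * ((-(2 / θ) * (κ 1 * v 0 - κ 0 * v 1) : ℝ) : ℂ)) := by
    rw [twist]
    congr 1
    push_cast
    ring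
  have h2 : |κ 1 * v 0 - κ 0 * v 1| ≤ ‖κ‖ * ‖v‖ := by
    refine abs_le_of_sq_le_sq ?_ (by positivity)
    rw [mul_pow, EuclideanSpace.norm_sq_eq, EuclideanSpace.norm_sq_eq, Fin.sum_univ_two,
      Fin.sum_univ_two]
    simp only [Real.norm_eq_abs, sq_abs]
    nlinarith [sq_nonneg (κ 0 * v 0 + κ 1 * v 1)]
  rw [norm_sub_rev, h1]
  refine (Real.norm_exp_I_mul_ofReal_sub_one_le).trans ?_
  rw [norm_mul, norm_neg, Real.norm_of_nonneg (by positivity), Real.norm_eq_abs, mul_assoc]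
  gcongr

theorem integrable_norm_pow_mul_exp {c : ℝ} (hc : 0 < c) (k : ℕ) :
    Integrable fun v : Plane => ‖v‖ ^ k * Real.exp (-c * ‖v‖ ^ 2) := by
  refine ((gauss hc).integrable_pow_mul volume k).congr (Eventually.of_forall fun v => ?_)
  simp only [gauss_apply]
  rw [Complex.norm_real, Real.norm_of_nonneg (Real.exp_nonneg _)]

/-- The scaling of the third absolute moment of a Gaussian function. -/
theorem integral_norm_pow_three_mul_exp (c : ℝ) {β : ℝ} (hβ : 0 < β) :
    ∫ v : Plane, ‖v‖ ^ 3 * Real.exp (-(c / β ^ 2) * ‖v‖ ^ 2)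
      = β ^ 5 * ∫ v : Plane, ‖v‖ ^ 3 * Real.exp (-c * ‖v‖ ^ 2) := by
  have h := Measure.integral_comp_smul (volume : Measure Plane)
    (fun v : Plane => ‖v‖ ^ 3 * Real.exp (-c * ‖v‖ ^ 2)) β⁻¹
  have h1 : ∀ v : Plane, ‖v‖ ^ 3 * Real.exp (-(c / β ^ 2) * ‖v‖ ^ 2)
      = β ^ 3 * (‖β⁻¹ • v‖ ^ 3 * Real.exp (-c * ‖β⁻¹ • v‖ ^ 2)) := by
    intro v
    rw [norm_smul, norm_inv, Real.norm_of_nonneg hβ.le, ← mul_assoc, ← mul_pow,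
      mul_inv_cancel_left₀ hβ.ne', mul_pow]
    congr 2
    field_simp
  simp only [h1]
  rw [integral_const_mul, h, finrank_euclideanSpace, Fintype.card_fin, smul_eq_mul,
    abs_of_pos (by positivity)]
  generalize ∫ v : Plane, ‖v‖ ^ 3 * Real.exp (-c * ‖v‖ ^ 2) = I
  field_simp

variable {θ} [hθ : Fact (0 < θ)]

/-- A state is continuous along bounded nets of the Moyal algebra that converge strictly to a
scalar. -/
theorem CStarState.tendsto_of_forall_leftMul (Φ : CStarState (closureAlg θ)) {ι : Type*}
    {l : Filter ι} {g : ι → 𝓢(Plane, ℂ)} {M : ℝ} (hM : ∀ i, ‖leftMul θ (g i)‖ ≤ M) {c : ℂ}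
    (h : ∀ F, Tendsto (fun i => leftMul θ (g i) * leftMul θ F) l (nhds (c • leftMul θ F))) :
    Tendsto (fun i => Φ.toCLM ⟨leftMul θ (g i), leftMul_mem θ (g i)⟩) l (nhds c) := by
  refine Φ.tendsto_of_strict (x := fun i => ⟨leftMul θ (g i), leftMul_mem θ (g i)⟩) (M := M)
    (fun i => hM i) fun a => ?_
  refine tendsto_closureAlg ?_
  exact tendsto_mul_of_mem_closureAlg θ hM h a.2

/-- The lower bound: the differences `f - α_κ f` for the detectors `f` in the direction of `κ`
converge strictly to the scalar `-|κ|`. -/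
theorem le_spectralDist_translateState {φ : 𝓢(Plane, ℂ) → ℂ} (hφ : IsState θ φ) (κ : Plane) :
    ENNReal.ofReal ‖κ‖ ≤ spectralDist θ φ (translateState κ φ) := by
  rcases eq_or_ne κ 0 with rfl | hκ
  · simp
  have hκ' := norm_pos_iff.2 hκ
  have h0 := hθ.out
  have hpi := Real.pi_pos
  obtain ⟨Φ, -, hΦ⟩ := hφ.exists_apply_sub
  set u : Plane := ‖κ‖⁻¹ • κ with hu
  have hu1 : ‖u‖ = 1 := by
    rw [hu, norm_smul, norm_inv, norm_norm, inv_mul_cancel₀ hκ'.ne']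
  have huκ : u 0 * κ 0 + u 1 * κ 1 = ‖κ‖ := by
    have h1 : ‖κ‖ ^ 2 = κ 0 ^ 2 + κ 1 ^ 2 := by
      simp [EuclideanSpace.norm_sq_eq, Fin.sum_univ_two]
    simp only [hu, PiLp.smul_apply, smul_eq_mul]
    field_simp
    linarith
  -- a sequence `β` of positive numbers that tends to zero; the detectors decay like
  -- `exp (-β² |x|²)`, and `θ β² < 1` is required for their existence
  obtain ⟨β, hβ, hβθ, hβt⟩ : ∃ β : ℕ → ℝ, (∀ n, 0 < β n) ∧ (∀ n, θ * β n ^ 2 < 1) ∧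
      Tendsto β atTop (nhds 0) := by
    refine ⟨fun n => 1 / (1 + θ) * (1 / ((n : ℝ) + 1)), fun n => by positivity, fun n => ?_, ?_⟩
    · have h1 : 1 / (1 + θ) * (1 / ((n : ℝ) + 1)) ≤ 1 / (1 + θ) := by
        refine mul_le_of_le_one_right (by positivity) ?_
        rw [div_le_one (by positivity)]
        linarith [(n.cast_nonneg : (0 : ℝ) ≤ n)]
      have h2 : θ * (1 / (1 + θ)) ^ 2 < 1 := by
        rw [div_pow, one_pow, mul_one_div, div_lt_one (by positivity)]
        nlinarith
      refine lt_of_le_of_lt ?_ h2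
      gcongr
    · simpa using tendsto_one_div_add_atTop_nhds_zero_nat.const_mul (1 / (1 + θ))
  choose f hf1 hf2 hf3 using fun n => exists_detector θ (pow_pos (hβ n) 2) (hβθ n) hu1
  let g : ℕ → 𝓢(Plane, ℂ) := fun n => f n - translate κ (f n)
  have hgn : ∀ n, ‖leftMul θ (g n)‖ ≤ ‖κ‖ := fun n => norm_leftMul_sub_translate_le (hf1 n) κ
  -- the scalar limit is the limit of `∫ ĝ = g 0`
  have hg0 : Tendsto (fun n => ∫ v, coeff θ (g n) v) atTop (nhds (-(‖κ‖ : ℂ))) := by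
    have h1 : ∀ n, ∫ v, coeff θ (g n) v
        = ((-((1 - θ * β n ^ 2) ^ 2 * ‖κ‖ * Real.exp (-β n ^ 2 * ‖κ‖ ^ 2)) : ℝ) : ℂ) := by
      intro n
      rw [integral_coeff, _root_.sub_apply, translate_apply, zero_add, hf2, hf2, huκ,
        ← Complex.ofReal_sub]
      congr 1
      simp
    simp only [h1]
    have h2 : Tendsto (fun n => -((1 - θ * β n ^ 2) ^ 2 * ‖κ‖ * Real.exp (-β n ^ 2 * ‖κ‖ ^ 2)))
        atTop (nhds (-((1 - θ * 0 ^ 2) ^ 2 * ‖κ‖ * Real.exp (-0 ^ 2 * ‖κ‖ ^ 2)))) := by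
      have hc : Continuous fun t : ℝ => -((1 - θ * t ^ 2) ^ 2 * ‖κ‖
        * Real.exp (-t ^ 2 * ‖κ‖ ^ 2)) := by fun_prop
      exact (hc.tendsto 0).comp hβt
    rw [show -((1 - θ * 0 ^ 2) ^ 2 * ‖κ‖ * Real.exp (-0 ^ 2 * ‖κ‖ ^ 2)) = -‖κ‖ by simp] at h2
    have h3 := (Complex.continuous_ofReal.tendsto _).comp h2
    rw [Complex.ofReal_neg] at h3
    exact h3
  -- the operators `𝓛(g n)` tend strictly to the same constant: the deviation is bounded by the
  -- third moment of a Gaussian function of width `β`, divided by `β⁴`, which scales like `β`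
  have hstrict : ∀ F : 𝓢(Plane, ℂ), Tendsto (fun n => leftMul θ (g n) * leftMul θ F) atTop
      (nhds ((-(‖κ‖ : ℂ)) • leftMul θ F)) := by
    intro F
    obtain ⟨C, hC, hF⟩ := exists_norm_shiftU_mul_leftMul_sub_le θ F
    set M := ∫ v : Plane, ‖v‖ ^ 3 * Real.exp (-(1 / θ ^ 2) * ‖v‖ ^ 2) with hM
    set K := 2 / θ * ‖κ‖ * (2 / θ * (1 / (Real.pi * θ ^ 2)) * (1 / 2)) * C with hK
    have hbd : ∀ n, ‖leftMul θ (g n) * leftMul θ F - (∫ v, coeff θ (g n) v) • leftMul θ F‖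
        ≤ K * M * β n := by
      intro n
      refine (norm_leftMul_mul_sub_le θ F hC hF (g n)).trans ?_
      have hβn := hβ n
      have h1 : ∀ v, ‖coeff θ (g n) v‖ * (C * ‖v‖) ≤ K / β n ^ 4 *
          (‖v‖ ^ 3 * Real.exp (-(1 / θ ^ 2 / β n ^ 2) * ‖v‖ ^ 2)) := by
        intro v
        have h2 : coeff θ (g n) v = (1 - twist θ (-κ) v) * coeff θ (f n) v := by
          rw [map_sub, _root_.sub_apply, coeff_translate]
          ring
        have h3 := norm_one_sub_twist_le θ h0 (-κ) v
        rw [norm_neg] at h3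
        rw [h2, norm_mul]
        have h4 : ‖1 - twist θ (-κ) v‖ * ‖coeff θ (f n) v‖ ≤ (2 / θ * ‖κ‖ * ‖v‖) *
            (2 / θ * (1 / (Real.pi * θ ^ 2 * β n ^ 2)) * (1 / (2 * β n ^ 2)) * ‖v‖
              * Real.exp (-(1 / (θ ^ 2 * β n ^ 2)) * ‖v‖ ^ 2)) :=
          mul_le_mul h3 (hf3 n v) (norm_nonneg _) (by positivity)
        refine (mul_le_mul_of_nonneg_right h4 (by positivity)).trans_eq ?_
        rw [hK, div_div]
        field_simp
      have h5 : 0 < 1 / θ ^ 2 / β n ^ 2 := by positivity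
      have hint := (integrable_norm_pow_mul_exp h5 3).const_mul (K / β n ^ 4)
      refine (integral_mono_of_nonneg (Eventually.of_forall fun v => by positivity) hint
        (Eventually.of_forall h1)).trans_eq ?_
      rw [integral_const_mul, integral_norm_pow_three_mul_exp _ hβn, ← hM]
      field_simp
    have h6 : Tendsto (fun n => leftMul θ (g n) * leftMul θ F
        - (∫ v, coeff θ (g n) v) • leftMul θ F) atTop (nhds 0) := by
      refine squeeze_zero_norm hbd ?_
      simpa using hβt.const_mul (K * M)
    simpa using h6.add (hg0.smul_const (leftMul θ F))
  have hlim : Tendsto (fun n => Φ.toCLM ⟨leftMul θ (g n), leftMul_mem θ (g n)⟩) atTop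
      (nhds (-(‖κ‖ : ℂ))) := Φ.tendsto_of_forall_leftMul hgn hstrict
  have hlim2 : Tendsto (fun n => ‖φ (f n) - translateState κ φ (f n)‖ₑ) atTop
      (nhds (ENNReal.ofReal ‖κ‖)) := by
    have h1 := (continuous_enorm.tendsto _).comp hlim
    rw [enorm_neg, ← ofReal_norm, Complex.norm_real, norm_norm] at h1
    refine h1.congr fun n => ?_
    rw [translateState, hΦ]
    rfl
  refine le_of_tendsto hlim2 (Eventually.of_forall fun n => ?_)
  exact le_iSup₂ (f := fun (F : 𝓢(Plane, ℂ)) (_ : CommutatorLeOne θ F) =>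
    ‖φ F - translateState κ φ F‖ₑ) (f n) (hf1 n)

/-- The distance between a state and its translate is the length of the translation. -/
theorem spectralDist_translateState {φ : 𝓢(Plane, ℂ) → ℂ} (hφ : IsState θ φ) (κ : Plane) :
    spectralDist θ φ (translateState κ φ) = ENNReal.ofReal ‖κ‖ :=
  le_antisymm (spectralDist_translateState_le hφ κ) (le_spectralDist_translateState hφ κ)

end

section

/-! ### Ladder operators on the plane -/

variable (θ : ℝ)

/-- The normalisation `1 / √(2θ)` of the ladder operators. -/
def ladderConst : ℂ := ((1 / Real.sqrt (2 * θ) : ℝ) : ℂ)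

/-- The annihilation operator `(z + (θ/2) (∂₁ + i ∂₂)) / √(2θ)` for left multiplication. -/
def lower : 𝓢(Plane, ℂ) →L[ℂ] 𝓢(Plane, ℂ) := ladderConst θ •
  (coord 0 + Complex.I • coord 1 + (θ / 2 : ℂ) • (pd 0 + Complex.I • pd 1))

/-- The creation operator `(z̄ - (θ/2) (∂₁ - i ∂₂)) / √(2θ)` for left multiplication. -/
def raise : 𝓢(Plane, ℂ) →L[ℂ] 𝓢(Plane, ℂ) := ladderConst θ •
  (coord 0 - Complex.I • coord 1 - (θ / 2 : ℂ) • (pd 0 - Complex.I • pd 1))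

/-- The annihilation operator `(z̄ + (θ/2) (∂₁ - i ∂₂)) / √(2θ)` for right multiplication. -/
def lowerR : 𝓢(Plane, ℂ) →L[ℂ] 𝓢(Plane, ℂ) := ladderConst θ •
  (coord 0 - Complex.I • coord 1 + (θ / 2 : ℂ) • (pd 0 - Complex.I • pd 1))

/-- The creation operator `(z - (θ/2) (∂₁ + i ∂₂)) / √(2θ)` for right multiplication. -/
def raiseR : 𝓢(Plane, ℂ) →L[ℂ] 𝓢(Plane, ℂ) := ladderConst θ •
  (coord 0 + Complex.I • coord 1 - (θ / 2 : ℂ) • (pd 0 + Complex.I • pd 1))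

theorem lower_apply (f : 𝓢(Plane, ℂ)) : lower θ f = ladderConst θ • (coord 0 f
    + Complex.I • coord 1 f + (θ / 2 : ℂ) • (pd 0 f + Complex.I • pd 1 f)) := rfl

theorem raise_apply (f : 𝓢(Plane, ℂ)) : raise θ f = ladderConst θ • (coord 0 f
    - Complex.I • coord 1 f - (θ / 2 : ℂ) • (pd 0 f - Complex.I • pd 1 f)) := rfl

theorem lowerR_apply (f : 𝓢(Plane, ℂ)) : lowerR θ f = ladderConst θ • (coord 0 f
    - Complex.I • coord 1 f + (θ / 2 : ℂ) • (pd 0 f - Complex.I • pd 1 f)) := rfl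

theorem raiseR_apply (f : 𝓢(Plane, ℂ)) : raiseR θ f = ladderConst θ • (coord 0 f
    + Complex.I • coord 1 f - (θ / 2 : ℂ) • (pd 0 f + Complex.I • pd 1 f)) := rfl

theorem coord_comm (f : 𝓢(Plane, ℂ)) : coord 1 (coord 0 f) = coord 0 (coord 1 f) := by
  ext x
  simp only [coord_apply]
  ring

theorem pd_comm (f : 𝓢(Plane, ℂ)) : pd 1 (pd 0 f) = pd 0 (pd 1 f) := by
  have : Fact ((0 : ℝ) < 1) := ⟨one_pos⟩
  refine coeff_injective 1 ?_
  simp only [coeff_pd_zero, coeff_pd_one, map_smul, coord_comm]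
  rw [smul_comm]

theorem ladderConst_sq (hθ : 0 < θ) : ladderConst θ * ladderConst θ * (2 * θ) = 1 := by
  have h : 0 < 2 * θ := by positivity
  have h1 : (1 / Real.sqrt (2 * θ)) * (1 / Real.sqrt (2 * θ)) * (2 * θ) = 1 := by
    rw [div_mul_div_comm, Real.mul_self_sqrt h.le]
    field_simp
  rw [ladderConst]
  exact_mod_cast h1

theorem integral_conj_mul_pd (i : Fin 2) (f g : 𝓢(Plane, ℂ)) :
    ∫ x, (starRingEnd ℂ) (f x) * pd i g x = -∫ x, (starRingEnd ℂ) (pd i f x) * g x := by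
  have h := integral_pd_mul (conjS f) g i
  rw [pd_conjS] at h
  simp only [conjS_apply] at h
  rw [h, neg_neg]

/-- The `L²` inner product of Schwartz functions. -/
def ip (f g : 𝓢(Plane, ℂ)) : ℂ := inner ℂ (f.toLp 2 volume : L2) (g.toLp 2 volume)

theorem toLp_add' (f g : 𝓢(Plane, ℂ)) :
    ((f + g).toLp 2 volume : L2) = f.toLp 2 volume + g.toLp 2 volume :=
  map_add (SchwartzMap.toLpCLM ℂ ℂ 2 (volume : Measure Plane)) f g

theorem toLp_smul' (c : ℂ) (f : 𝓢(Plane, ℂ)) :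
    ((c • f).toLp 2 volume : L2) = c • f.toLp 2 volume :=
  map_smul (SchwartzMap.toLpCLM ℂ ℂ 2 (volume : Measure Plane)) c f

theorem toLp_zero' : ((0 : 𝓢(Plane, ℂ)).toLp 2 volume : L2) = 0 :=
  map_zero (SchwartzMap.toLpCLM ℂ ℂ 2 (volume : Measure Plane))

theorem ip_add_left (f g h : 𝓢(Plane, ℂ)) : ip (f + g) h = ip f h + ip g h := by
  rw [ip, toLp_add', inner_add_left]; rfl

theorem ip_add_right (f g h : 𝓢(Plane, ℂ)) : ip f (g + h) = ip f g + ip f h := by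
  rw [ip, toLp_add', inner_add_right]; rfl

theorem ip_smul_left (c : ℂ) (f g : 𝓢(Plane, ℂ)) :
    ip (c • f) g = (starRingEnd ℂ) c * ip f g := by
  rw [ip, toLp_smul', inner_smul_left]; rfl

theorem ip_smul_right (c : ℂ) (f g : 𝓢(Plane, ℂ)) : ip f (c • g) = c * ip f g := by
  rw [ip, toLp_smul', inner_smul_right]; rfl

theorem ip_sub_left (f g h : 𝓢(Plane, ℂ)) : ip (f - g) h = ip f h - ip g h := by
  rw [sub_eq_add_neg, ip_add_left, ← neg_one_smul ℂ g, ip_smul_left]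
  simp [sub_eq_add_neg]

theorem ip_conj (f g : 𝓢(Plane, ℂ)) : (starRingEnd ℂ) (ip g f) = ip f g := inner_conj_symm _ _

theorem ip_coord (i : Fin 2) (f g : 𝓢(Plane, ℂ)) : ip f (coord i g) = ip (coord i f) g := by
  rw [ip, ip, inner_toL2, inner_toL2]
  congr 1
  funext x
  simp only [coord_apply, map_mul, Complex.conj_ofReal]
  ring

theorem ip_pd (i : Fin 2) (f g : 𝓢(Plane, ℂ)) : ip f (pd i g) = -ip (pd i f) g := by
  rw [ip, ip, inner_toL2, inner_toL2, integral_conj_mul_pd]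

/-- The creation operator is the formal adjoint of the annihilation operator. -/
theorem ip_raise_left (f g : 𝓢(Plane, ℂ)) : ip (raise θ f) g = ip f (lower θ g) := by
  simp only [raise_apply, lower_apply, ip_smul_left, ip_smul_right, ip_add_right,
    ip_sub_left, ip_coord, ip_pd, ladderConst, Complex.conj_ofReal, Complex.conj_I, map_div₀,
    map_ofNat]
  ring

/-- The canonical commutation relation. -/
theorem lower_raise (hθ : 0 < θ) (f : 𝓢(Plane, ℂ)) :
    lower θ (raise θ f) = raise θ (lower θ f) + f := by
  have hc := ladderConst_sq θ hθ
  ext x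
  simp only [lower_apply, raise_apply, map_smul, map_add, map_sub, pd_coord, pd_comm, coord_comm,
    _root_.add_apply, _root_.sub_apply, _root_.smul_apply, smul_eq_mul]
  simp
  linear_combination (f x) * hc + (ladderConst θ ^ 2 * θ * f x) * (-Complex.I_sq)

variable [hθ : Fact (0 < θ)]

theorem tc_inv : (tc θ)⁻¹ = -(Complex.I * θ / 2) := by
  have h0' : (θ : ℂ) ≠ 0 := by exact_mod_cast hθ.out.ne'
  rw [tc, inv_div, div_eq_iff (by simp)]
  linear_combination (θ : ℂ) * Complex.I_sq

theorem mstar_lower_left (f g : 𝓢(Plane, ℂ)) :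
    mstar θ (lower θ f) g = lower θ (mstar θ f g) := by
  simp only [lower_apply, mstar_smul_left, mstar_add_left, mstar_coord_zero_left,
    mstar_coord_one_left, pd_mstar, tc_inv]
  ext x
  simp only [_root_.add_apply, _root_.sub_apply, _root_.smul_apply, smul_eq_mul]
  linear_combination (-ladderConst θ * (θ / 2) * mstar θ f (pd 0 g) x) * Complex.I_sq

theorem mstar_raise_left (f g : 𝓢(Plane, ℂ)) :
    mstar θ (raise θ f) g = raise θ (mstar θ f g) := by
  simp only [raise_apply, mstar_smul_left, mstar_sub_left, mstar_coord_zero_left,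
    mstar_coord_one_left, pd_mstar, tc_inv]
  ext x
  simp only [_root_.add_apply, _root_.sub_apply, _root_.smul_apply, smul_eq_mul]
  linear_combination (ladderConst θ * (θ / 2) * mstar θ f (pd 0 g) x) * Complex.I_sq

theorem mstar_raiseR_left (f g : 𝓢(Plane, ℂ)) :
    mstar θ (raiseR θ f) g = mstar θ f (lower θ g) := by
  simp only [raiseR_apply, lower_apply, mstar_smul_left, mstar_smul_right, mstar_add_left,
    mstar_add_right, mstar_sub_left, mstar_coord_zero_left, mstar_coord_one_left,
    mstar_coord_zero_right, mstar_coord_one_right, tc_inv]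
  ext x
  simp only [_root_.add_apply, _root_.sub_apply, _root_.smul_apply, smul_eq_mul]
  linear_combination (-ladderConst θ * (θ / 2) * (mstar θ f (pd 0 g) x
    + mstar θ (pd 0 f) g x)) * Complex.I_sq

theorem mstar_lowerR_left (f g : 𝓢(Plane, ℂ)) :
    mstar θ (lowerR θ f) g = mstar θ f (raise θ g) := by
  simp only [lowerR_apply, raise_apply, mstar_smul_left, mstar_smul_right, mstar_add_left,
    mstar_sub_left, mstar_sub_right, mstar_coord_zero_left, mstar_coord_one_left,
    mstar_coord_zero_right, mstar_coord_one_right, tc_inv]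
  ext x
  simp only [_root_.add_apply, _root_.sub_apply, _root_.smul_apply, smul_eq_mul]
  linear_combination (ladderConst θ * (θ / 2) * (mstar θ f (pd 0 g) x
    + mstar θ (pd 0 f) g x)) * Complex.I_sq

theorem lower_vacuum : lower θ (vacuum θ) = 0 := by
  have h0' : (θ : ℂ) ≠ 0 := by exact_mod_cast hθ.out.ne'
  rw [lower_apply, pd_vacuum, pd_vacuum]
  ext x
  simp
  field_simp
  ring

theorem lowerR_vacuum : lowerR θ (vacuum θ) = 0 := by
  have h0' : (θ : ℂ) ≠ 0 := by exact_mod_cast hθ.out.ne'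
  rw [lowerR_apply, pd_vacuum, pd_vacuum]
  ext x
  simp
  field_simp
  ring

theorem mstar_vacuum_raise (g : 𝓢(Plane, ℂ)) : mstar θ (vacuum θ) (raise θ g) = 0 := by
  rw [← mstar_lowerR_left, lowerR_vacuum, mstar_zero_left]

theorem lower_mstar_vacuum (g : 𝓢(Plane, ℂ)) : lower θ (mstar θ (vacuum θ) g) = 0 := by
  rw [← mstar_lower_left, lower_vacuum, mstar_zero_left]

/-- The derivative `∂₁ + i ∂₂` is a commutator with the annihilation operator. -/
theorem mstar_dbar_left (f g : 𝓢(Plane, ℂ)) : mstar θ (dbar f) g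
    = (2 * ladderConst θ) • (lower θ (mstar θ f g) - mstar θ f (lower θ g)) := by
  have h : dbar f = (2 * ladderConst θ) • (lower θ f - raiseR θ f) := by
    rw [lower_apply, raiseR_apply, dbar]
    ext x
    simp only [_root_.add_apply, _root_.sub_apply, _root_.smul_apply, smul_eq_mul]
    have hc := ladderConst_sq θ hθ.out
    linear_combination (-(pd 0 f x + Complex.I * pd 1 f x)) * hc
  rw [h, mstar_smul_left, mstar_sub_left, mstar_lower_left, mstar_raiseR_left]

/-- The derivative `∂₁ - i ∂₂` is a commutator with the creation operator. -/
theorem mstar_del_left (f g : 𝓢(Plane, ℂ)) : mstar θ (del f) g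
    = (2 * ladderConst θ) • (mstar θ f (raise θ g) - raise θ (mstar θ f g)) := by
  have h : del f = (2 * ladderConst θ) • (lowerR θ f - raise θ f) := by
    rw [lowerR_apply, raise_apply, del]
    ext x
    simp only [_root_.add_apply, _root_.sub_apply, _root_.smul_apply, smul_eq_mul]
    have hc := ladderConst_sq θ hθ.out
    linear_combination (-(pd 0 f x - Complex.I * pd 1 f x)) * hc
  rw [h, mstar_smul_left, mstar_sub_left, mstar_lowerR_left, mstar_raise_left]

end

section

/-! ### The matrix basis -/

variable {E : Type*} [NormedAddCommGroup E] [NormedSpace ℝ E]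

/-- The normalised power `Tᵐ / √m!` of an operator. -/
def tower (T : 𝓢(E, ℂ) →L[ℂ] 𝓢(E, ℂ)) : ℕ → 𝓢(E, ℂ) →L[ℂ] 𝓢(E, ℂ)
  | 0 => ContinuousLinearMap.id ℂ _
  | m + 1 => ((1 / Real.sqrt (m + 1) : ℝ) : ℂ) • T.comp (tower T m)

theorem tower_zero (T : 𝓢(E, ℂ) →L[ℂ] 𝓢(E, ℂ)) (f : 𝓢(E, ℂ)) : tower T 0 f = f := rfl

theorem tower_succ (T : 𝓢(E, ℂ) →L[ℂ] 𝓢(E, ℂ)) (m : ℕ) (f : 𝓢(E, ℂ)) :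
    tower T (m + 1) f = ((1 / Real.sqrt (m + 1) : ℝ) : ℂ) • T (tower T m f) := rfl

theorem sqrt_succ_ne_zero (m : ℕ) : ((Real.sqrt (m + 1) : ℝ) : ℂ) ≠ 0 := by
  have : Real.sqrt ((m : ℝ) + 1) ≠ 0 := (Real.sqrt_pos.2 (by positivity)).ne'
  exact_mod_cast this

theorem sqrt_succ_smul_one_div (m : ℕ) :
    ((Real.sqrt (m + 1) : ℝ) : ℂ) * ((1 / Real.sqrt (m + 1) : ℝ) : ℂ) = 1 := by
  rw [Complex.ofReal_div, Complex.ofReal_one, mul_one_div, div_self (sqrt_succ_ne_zero m)]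

theorem apply_tower (T : 𝓢(E, ℂ) →L[ℂ] 𝓢(E, ℂ)) (m : ℕ) (f : 𝓢(E, ℂ)) :
    T (tower T m f) = ((Real.sqrt (m + 1) : ℝ) : ℂ) • tower T (m + 1) f := by
  rw [tower_succ, smul_smul, sqrt_succ_smul_one_div, one_smul]

theorem tower_succ' (T : 𝓢(E, ℂ) →L[ℂ] 𝓢(E, ℂ)) (m : ℕ) (f : 𝓢(E, ℂ)) :
    tower T (m + 1) f = ((1 / Real.sqrt (m + 1) : ℝ) : ℂ) • tower T m (T f) := by
  induction m with
  | zero => rfl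
  | succ m ih => rw [tower_succ, ih, map_smul, tower_succ, smul_comm]

theorem tower_apply (T : 𝓢(E, ℂ) →L[ℂ] 𝓢(E, ℂ)) (m : ℕ) (f : 𝓢(E, ℂ)) :
    tower T m (T f) = ((Real.sqrt (m + 1) : ℝ) : ℂ) • tower T (m + 1) f := by
  rw [tower_succ', smul_smul, sqrt_succ_smul_one_div, one_smul]

/-- An annihilation operator `T` lowers the degree of the normalised powers of the creation
operator `S`, applied to a vector that `T` annihilates. -/
theorem apply_tower_of_commutator {T S : 𝓢(E, ℂ) →L[ℂ] 𝓢(E, ℂ)} (hTS : ∀ f, T (S f) = S (T f) + f)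
    {η : 𝓢(E, ℂ)} (hη : T η = 0) (m : ℕ) :
    T (tower S (m + 1) η) = ((Real.sqrt (m + 1) : ℝ) : ℂ) • tower S m η := by
  induction m with
  | zero =>
    rw [tower_succ, tower_zero, map_smul, hTS, hη, map_zero, zero_add]
    simp
  | succ m ih =>
    rw [tower_succ, map_smul, hTS, ih, map_smul, apply_tower, smul_smul]
    have h : ((Real.sqrt (m + 1) : ℝ) : ℂ) * ((Real.sqrt (m + 1) : ℝ) : ℂ) = (m : ℂ) + 1 := by
      rw [← Complex.ofReal_mul, Real.mul_self_sqrt (by positivity)]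
      push_cast
      rfl
    rw [h]
    nth_rewrite 2 [← one_smul ℂ (tower (S) (m + 1) η)]
    rw [← add_smul, smul_smul]
    congr 1
    have h2 : ((Real.sqrt ((m + 1 : ℕ) + 1) : ℝ) : ℂ) * ((Real.sqrt ((m + 1 : ℕ) + 1) : ℝ) : ℂ)
        = (m : ℂ) + 1 + 1 := by
      rw [← Complex.ofReal_mul, Real.mul_self_sqrt (by positivity)]
      push_cast
      rfl
    rw [← h2, ← mul_assoc, mul_comm ((1 / _ : ℝ) : ℂ), sqrt_succ_smul_one_div, one_mul]

variable (θ : ℝ)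

theorem ip_tower_raise_left (m : ℕ) (f g : 𝓢(Plane, ℂ)) :
    ip (tower (raise θ) m f) g = ip f (tower (lower θ) m g) := by
  induction m generalizing f g with
  | zero => rfl
  | succ m ih =>
    rw [tower_succ, tower_succ', ip_smul_left, ip_raise_left, ih, ip_smul_right,
      Complex.conj_ofReal]

variable [hθ : Fact (0 < θ)]

theorem lower_tower_raise {η : 𝓢(Plane, ℂ)} (hη : lower θ η = 0) (m : ℕ) :
    lower θ (tower (raise θ) (m + 1) η)
      = ((Real.sqrt (m + 1) : ℝ) : ℂ) • tower (raise θ) m η :=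
  apply_tower_of_commutator (lower_raise θ hθ.out) hη m

/-- Normal ordering between two vacua: `G aˡ (a†)ᵐ η` is `η` for `l = m` and vanishes otherwise.
The factorials cancel because the powers are normalised. -/
theorem mstar_vacuum_tower_tower {η : 𝓢(Plane, ℂ)} (hη : lower θ η = 0)
    (hη' : mstar θ (vacuum θ) η = η) (l m : ℕ) :
    mstar θ (vacuum θ) (tower (lower θ) l (tower (raise θ) m η)) = if l = m then η else 0 := by
  induction l generalizing m with
  | zero =>
    cases m with
    | zero => simp [tower_zero, hη']
    | succ m => simp [tower_zero, tower_succ, mstar_smul_right, mstar_vacuum_raise]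
  | succ l ih =>
    cases m with
    | zero =>
      simp [tower_succ', tower_zero, hη, mstar_zero_right]
    | succ m =>
      rw [tower_succ', lower_tower_raise θ hη, map_smul, mstar_smul_right, mstar_smul_right, ih]
      by_cases h : l = m
      · subst h
        rw [if_pos rfl, if_pos rfl, smul_smul, mul_comm, sqrt_succ_smul_one_div, one_smul]
      · simp [h]

/-- The matrix units `E m n = (a†)ᵐ ⋆ G ⋆ aⁿ / √(m! n!)` of the Moyal algebra. -/
def matrixUnit (m n : ℕ) : 𝓢(Plane, ℂ) := tower (raise θ) m (tower (raiseR θ) n (vacuum θ))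

theorem mstar_tower_raise_left (m : ℕ) (f g : 𝓢(Plane, ℂ)) :
    mstar θ (tower (raise θ) m f) g = tower (raise θ) m (mstar θ f g) := by
  induction m with
  | zero => rfl
  | succ m ih => rw [tower_succ, mstar_smul_left, mstar_raise_left, ih, tower_succ]

theorem mstar_tower_raiseR_left (m : ℕ) (f g : 𝓢(Plane, ℂ)) :
    mstar θ (tower (raiseR θ) m f) g = mstar θ f (tower (lower θ) m g) := by
  induction m generalizing g with
  | zero => rfl
  | succ m ih =>
    rw [tower_succ, mstar_smul_left, mstar_raiseR_left, ih, tower_succ', mstar_smul_right]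

/-- Left multiplication by a matrix unit first applies annihilation operators, then projects onto
the vacuum, then applies creation operators. -/
theorem mstar_matrixUnit (m n : ℕ) (g : 𝓢(Plane, ℂ)) : mstar θ (matrixUnit θ m n) g
    = tower (raise θ) m (mstar θ (vacuum θ) (tower (lower θ) n g)) := by
  rw [matrixUnit, mstar_tower_raise_left, mstar_tower_raiseR_left]

theorem mstar_matrixUnit_tower {η : 𝓢(Plane, ℂ)} (hη : lower θ η = 0)
    (hη' : mstar θ (vacuum θ) η = η) (k l m : ℕ) :
    mstar θ (matrixUnit θ k l) (tower (raise θ) m η)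
      = if l = m then tower (raise θ) k η else 0 := by
  rw [mstar_matrixUnit, mstar_vacuum_tower_tower θ hη hη']
  split_ifs <;> simp

/-- The multiplication table of the matrix units. -/
theorem leftMul_matrixUnit_mul (k l m n : ℕ) (ψ : L2) :
    leftMul θ (matrixUnit θ k l) (leftMul θ (matrixUnit θ m n) ψ)
      = if l = m then leftMul θ (matrixUnit θ k n) ψ else 0 := by
  refine denseRange_toL2.induction_on
    (p := fun ψ => leftMul θ (matrixUnit θ k l) (leftMul θ (matrixUnit θ m n) ψ)
      = if l = m then leftMul θ (matrixUnit θ k n) ψ else 0) ψ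
    (isClosed_eq (by fun_prop) (by split_ifs <;> fun_prop)) fun g => ?_
  rw [leftMul_toLp, leftMul_toLp, leftMul_toLp, mstar_matrixUnit θ m n,
    mstar_matrixUnit_tower θ (lower_mstar_vacuum θ _) (mstar_vacuum_mstar_vacuum θ _)]
  split_ifs
  · rw [mstar_matrixUnit]
  · exact toLp_zero'

/-- The adjoint of the matrix unit `E m n` is `E n m`. -/
theorem inner_leftMul_matrixUnit_left (m n : ℕ) (χ ψ : L2) :
    inner ℂ (leftMul θ (matrixUnit θ m n) χ) ψ = inner ℂ χ (leftMul θ (matrixUnit θ n m) ψ) := by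
  have h : ∀ f g : 𝓢(Plane, ℂ), ip (mstar θ (matrixUnit θ m n) f) g
      = ip f (mstar θ (matrixUnit θ n m) g) := by
    intro f g
    have hv : ∀ f g : 𝓢(Plane, ℂ), ip (mstar θ (vacuum θ) f) g = ip f (mstar θ (vacuum θ) g) := by
      intro f g
      rw [ip, ip, ← leftMul_toLp, ← leftMul_toLp, inner_leftMul_left, conjS_vacuum]
    have hl : ∀ (n : ℕ) (f g : 𝓢(Plane, ℂ)), ip (tower (lower θ) n f) g
        = ip f (tower (raise θ) n g) := by
      intro n f g
      have := congrArg (starRingEnd ℂ) (ip_tower_raise_left θ n g f)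
      rw [ip, ip, inner_conj_symm, inner_conj_symm] at this
      exact this.symm
    rw [mstar_matrixUnit, mstar_matrixUnit, ip_tower_raise_left, hv, hl]
  refine denseRange_toL2.induction_on₂
    (p := fun χ ψ => inner ℂ (leftMul θ (matrixUnit θ m n) χ) ψ
      = inner ℂ χ (leftMul θ (matrixUnit θ n m) ψ)) (isClosed_eq (by fun_prop) (by fun_prop))
    (fun f g => ?_) χ ψ
  rw [leftMul_toLp, leftMul_toLp]
  exact h f g

/-- A combination of matrix units with at most one entry in every row and every column is bounded
by its largest coefficient. -/
theorem norm_sum_smul_leftMul_matrixUnit_le {ι : Type*} (s : Finset ι) {a b : ι → ℕ}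
    (ha : Function.Injective a) (hb : Function.Injective b) {w : ι → ℂ} {W : ℝ} (hW : 0 ≤ W)
    (hw : ∀ k ∈ s, ‖w k‖ ≤ W) :
    ‖∑ k ∈ s, w k • leftMul θ (matrixUnit θ (a k) (b k))‖ ≤ W := by
  refine ContinuousLinearMap.opNorm_le_bound _ hW fun ψ => ?_
  let q : ι → L2 → L2 := fun k ψ => leftMul θ (matrixUnit θ (b k) (b k)) ψ
  have hq : ∀ k, (inner ℂ ψ (q k ψ)) = ((‖q k ψ‖ ^ 2 : ℝ) : ℂ) := by
    intro k
    have h1 : q k ψ = q k (q k ψ) := by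
      simp only [q]
      rw [leftMul_matrixUnit_mul, if_pos rfl]
    rw [h1]
    simp only [q]
    rw [← inner_leftMul_matrixUnit_left, inner_self_eq_norm_sq_to_K, leftMul_matrixUnit_mul,
      if_pos rfl]
    norm_cast
  -- Bessel's inequality for the projections onto the rows
  have hbessel : ∑ k ∈ s, ‖q k ψ‖ ^ 2 ≤ ‖ψ‖ ^ 2 := by
    have h1 : (inner ℂ (∑ k ∈ s, q k ψ) (∑ k ∈ s, q k ψ) : ℂ)
        = ((∑ k ∈ s, ‖q k ψ‖ ^ 2 : ℝ) : ℂ) := by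
      rw [sum_inner]
      simp only [inner_sum]
      rw [Complex.ofReal_sum]
      refine Finset.sum_congr rfl fun k hk => ?_
      rw [Finset.sum_eq_single k]
      · simp only [q]
        rw [inner_self_eq_norm_sq_to_K]
        norm_cast
      · intro j _ hj
        simp only [q]
        rw [inner_leftMul_matrixUnit_left, leftMul_matrixUnit_mul,
          if_neg fun h => hj (hb h).symm, inner_zero_right]
      · exact fun h => absurd hk h
    have h2 : ‖∑ k ∈ s, q k ψ‖ ^ 2 = ∑ k ∈ s, ‖q k ψ‖ ^ 2 := by
      rw [inner_self_eq_norm_sq_to_K, ← RCLike.ofReal_pow] at h1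
      exact Complex.ofReal_injective h1
    have h3 : ∑ k ∈ s, ‖q k ψ‖ ^ 2 = (inner ℂ ψ (∑ k ∈ s, q k ψ)).re := by
      rw [inner_sum, Complex.re_sum]
      refine Finset.sum_congr rfl fun k _ => ?_
      rw [hq, Complex.ofReal_re]
    have h4 := (Complex.re_le_norm _).trans (norm_inner_le_norm (𝕜 := ℂ) ψ (∑ k ∈ s, q k ψ))
    rw [← h3, ← h2] at h4
    rw [← h2]
    rcases (norm_nonneg (∑ k ∈ s, q k ψ)).eq_or_lt with h0 | h0
    · rw [← h0, zero_pow two_ne_zero]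
      exact sq_nonneg _
    · have h5 : ‖∑ k ∈ s, q k ψ‖ ≤ ‖ψ‖ := by
        rw [sq] at h4
        exact le_of_mul_le_mul_right h4 h0
      gcongr
  have hT : (∑ k ∈ s, w k • leftMul θ (matrixUnit θ (a k) (b k))) ψ
      = ∑ k ∈ s, w k • leftMul θ (matrixUnit θ (a k) (b k)) ψ := by
    simp [_root_.sum_apply]
  have hn : ‖∑ k ∈ s, w k • leftMul θ (matrixUnit θ (a k) (b k)) ψ‖ ^ 2
      = ∑ k ∈ s, ‖w k‖ ^ 2 * ‖q k ψ‖ ^ 2 := by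
    have h1 : (inner ℂ (∑ k ∈ s, w k • leftMul θ (matrixUnit θ (a k) (b k)) ψ)
        (∑ k ∈ s, w k • leftMul θ (matrixUnit θ (a k) (b k)) ψ) : ℂ)
        = ((∑ k ∈ s, ‖w k‖ ^ 2 * ‖q k ψ‖ ^ 2 : ℝ) : ℂ) := by
      rw [sum_inner]
      simp only [inner_sum, inner_smul_left, inner_smul_right]
      rw [Complex.ofReal_sum]
      refine Finset.sum_congr rfl fun k hk => ?_
      rw [Finset.sum_eq_single k]
      · rw [inner_leftMul_matrixUnit_left, leftMul_matrixUnit_mul, if_pos rfl,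
          show leftMul θ (matrixUnit θ (b k) (b k)) ψ = q k ψ from rfl, hq, ← mul_assoc,
          Complex.mul_conj, Complex.normSq_eq_norm_sq,
          Complex.ofReal_mul]
      · intro j _ hj
        rw [inner_leftMul_matrixUnit_left, leftMul_matrixUnit_mul,
          if_neg fun h => hj (ha h).symm, inner_zero_right, mul_zero, mul_zero]
      · exact fun h => absurd hk h
    rw [inner_self_eq_norm_sq_to_K, ← RCLike.ofReal_pow] at h1
    exact Complex.ofReal_injective h1
  rw [hT]
  refine le_of_sq_le_sq ?_ (by positivity)
  rw [hn, mul_pow]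
  refine le_trans (Finset.sum_le_sum fun k hk => ?_)
    ((Finset.mul_sum _ _ _).symm.trans_le (mul_le_mul_of_nonneg_left hbessel (sq_nonneg W)))
  exact mul_le_mul_of_nonneg_right (pow_le_pow_left₀ (norm_nonneg _) (hw k hk) 2) (sq_nonneg _)

/-! ### Oscillator states -/

/-- The normalised oscillator functions `(a†)ⁿ G / √(2πθ n!)` on the plane. -/
def osc (n : ℕ) : 𝓢(Plane, ℂ) :=
  ((1 / Real.sqrt (2 * Real.pi * θ) : ℝ) : ℂ) • tower (raise θ) n (vacuum θ)

/-- The oscillator functions as elements of `L²(ℝ²)`. -/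
def oscL (n : ℕ) : L2 := (osc θ n).toLp 2 volume

theorem raise_osc (n : ℕ) : raise θ (osc θ n) = ((Real.sqrt (n + 1) : ℝ) : ℂ) • osc θ (n + 1) := by
  rw [osc, map_smul, apply_tower, smul_comm, osc]

theorem lower_osc_zero : lower θ (osc θ 0) = 0 := by
  rw [osc, map_smul, tower_zero, lower_vacuum, smul_zero]

theorem lower_osc_succ (n : ℕ) :
    lower θ (osc θ (n + 1)) = ((Real.sqrt (n + 1) : ℝ) : ℂ) • osc θ n := by
  rw [osc, map_smul, lower_tower_raise θ (lower_vacuum θ), smul_comm, osc]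

theorem leftMul_matrixUnit_oscL (k l m : ℕ) :
    leftMul θ (matrixUnit θ k l) (oscL θ m) = if l = m then oscL θ k else 0 := by
  rw [oscL, leftMul_toLp, osc, mstar_smul_right,
    mstar_matrixUnit_tower θ (lower_vacuum θ) (mstar_vacuum_vacuum θ)]
  split_ifs
  · rfl
  · rw [smul_zero, toLp_zero']

theorem ip_osc_zero : ip (osc θ 0) (osc θ 0) = 1 := by
  have h0 := hθ.out
  have hpi := Real.pi_pos
  rw [ip, inner_toL2]
  have h1 : ∀ x, (starRingEnd ℂ) (osc θ 0 x) * osc θ 0 x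
      = ((1 / (2 * Real.pi * θ) * 4 * Real.exp (-(2 / θ) * ‖x‖ ^ 2) : ℝ) : ℂ) := by
    intro x
    rw [osc, tower_zero, _root_.smul_apply, vacuum_apply, smul_eq_mul, ← Complex.ofReal_mul,
      Complex.conj_ofReal, ← Complex.ofReal_mul]
    congr 1
    have h2 : 1 / Real.sqrt (2 * Real.pi * θ) * (1 / Real.sqrt (2 * Real.pi * θ))
        = 1 / (2 * Real.pi * θ) := by
      rw [div_mul_div_comm, Real.mul_self_sqrt (by positivity), one_mul]
    rw [show -(2 / θ) * ‖x‖ ^ 2 = -(1 / θ) * ‖x‖ ^ 2 + -(1 / θ) * ‖x‖ ^ 2 by ring, Real.exp_add,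
      ← h2]
    ring
  simp only [h1]
  rw [integral_complex_ofReal, integral_const_mul,
    integral_exp_neg_mul_norm_sq (by positivity : 0 < 2 / θ)]
  norm_cast
  field_simp
  norm_num

theorem inner_oscL (m n : ℕ) : inner ℂ (oscL θ m) (oscL θ n) = if m = n then (1 : ℂ) else 0 := by
  have h : oscL θ m = leftMul θ (matrixUnit θ m 0) (oscL θ 0) := by
    rw [leftMul_matrixUnit_oscL, if_pos rfl]
  rw [h, inner_leftMul_matrixUnit_left, leftMul_matrixUnit_oscL]
  split_ifs
  · exact ip_osc_zero θ
  · rw [inner_zero_right]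

theorem norm_oscL (n : ℕ) : ‖oscL θ n‖ = 1 := by
  have h := inner_oscL θ n n
  rw [if_pos rfl, inner_self_eq_norm_sq_to_K, ← RCLike.ofReal_pow] at h
  have h2 : ‖oscL θ n‖ ^ 2 = 1 := Complex.ofReal_injective (h.trans Complex.ofReal_one.symm)
  exact (pow_eq_one_iff_of_nonneg (norm_nonneg _) two_ne_zero).1 h2

end

section

/-! ### Matrix elements of the translations between oscillator states -/

section
variable {E : Type*} [NormedAddCommGroup E] [NormedSpace ℝ E]

/-- A family of matrix elements is determined by its first entry and by the recursion relations
that come from the commutation of a Weyl operator with the ladder operators. -/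
theorem eq_of_recursion {s t : ℂ} {c d : ℕ → ℕ → ℂ}
    (hc0 : ∀ m : ℕ, ((Real.sqrt (m + 1) : ℝ) : ℂ) * c (m + 1) 0 = s * c m 0)
    (hc1 : ∀ m n : ℕ, ((Real.sqrt (m + 1) : ℝ) : ℂ) * c (m + 1) (n + 1)
      = ((Real.sqrt (n + 1) : ℝ) : ℂ) * c m n + s * c m (n + 1))
    (hc2 : ∀ n : ℕ, ((Real.sqrt (n + 1) : ℝ) : ℂ) * c 0 (n + 1) = t * c 0 n)
    (hd0 : ∀ m : ℕ, ((Real.sqrt (m + 1) : ℝ) : ℂ) * d (m + 1) 0 = s * d m 0)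
    (hd1 : ∀ m n : ℕ, ((Real.sqrt (m + 1) : ℝ) : ℂ) * d (m + 1) (n + 1)
      = ((Real.sqrt (n + 1) : ℝ) : ℂ) * d m n + s * d m (n + 1))
    (hd2 : ∀ n : ℕ, ((Real.sqrt (n + 1) : ℝ) : ℂ) * d 0 (n + 1) = t * d 0 n)
    (h : c 0 0 = d 0 0) (m n : ℕ) : c m n = d m n := by
  induction m generalizing n with
  | zero =>
    induction n with
    | zero => exact h
    | succ n ih => exact mul_left_cancel₀ (sqrt_succ_ne_zero n) (by rw [hc2, hd2, ih])
  | succ m ih =>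
    refine mul_left_cancel₀ (sqrt_succ_ne_zero m) ?_
    cases n with
    | zero => rw [hc0, hd0, ih]
    | succ n => rw [hc1, hd1, ih, ih]

/-- The recursion relations for the matrix elements `p (h m) (V (h n))` of an operator `V` that
commutes with the ladder operators `T` and `S` up to scalars. -/
theorem recursion_of_commutator {T S : 𝓢(E, ℂ) →L[ℂ] 𝓢(E, ℂ)} {V : 𝓢(E, ℂ) → 𝓢(E, ℂ)} {s t : ℂ}
    {p : 𝓢(E, ℂ) → 𝓢(E, ℂ) → ℂ} {h : ℕ → 𝓢(E, ℂ)}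
    (hT0 : T (h 0) = 0) (hT : ∀ n : ℕ, T (h (n + 1)) = ((Real.sqrt (n + 1) : ℝ) : ℂ) • h n)
    (hS : ∀ n : ℕ, S (h n) = ((Real.sqrt (n + 1) : ℝ) : ℂ) • h (n + 1))
    (hTV : ∀ f, T (V f) = V (T f) + s • V f) (hSV : ∀ f, V (S f) = S (V f) + t • V f)
    (hVs : ∀ (c : ℂ) f, V (c • f) = c • V f)
    (hps : ∀ (c : ℂ) f g, p f (c • g) = c * p f g)
    (hpr : ∀ (c : ℝ) f g, p ((c : ℂ) • f) g = c * p f g)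
    (hpa : ∀ f g g', p f (g + g') = p f g + p f g') (hpS : ∀ f g, p (S f) g = p f (T g))
    (hpT : ∀ f g, p f (S g) = p (T f) g) :
    (∀ m : ℕ, ((Real.sqrt (m + 1) : ℝ) : ℂ) * p (h (m + 1)) (V (h 0)) = s * p (h m) (V (h 0))) ∧
    (∀ m n : ℕ, ((Real.sqrt (m + 1) : ℝ) : ℂ) * p (h (m + 1)) (V (h (n + 1)))
      = ((Real.sqrt (n + 1) : ℝ) : ℂ) * p (h m) (V (h n)) + s * p (h m) (V (h (n + 1)))) ∧
    (∀ n : ℕ, ((Real.sqrt (n + 1) : ℝ) : ℂ) * p (h 0) (V (h (n + 1))) = t * p (h 0) (V (h n))) := by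
  have hp0 : ∀ f, p f 0 = 0 := fun f => by rw [← zero_smul ℂ (0 : 𝓢(E, ℂ)), hps, zero_mul]
  have hp0' : ∀ f, p 0 f = 0 := fun f => by
    rw [← zero_smul ℂ (0 : 𝓢(E, ℂ)), ← Complex.ofReal_zero, hpr, Complex.ofReal_zero, zero_mul]
  have hV0 : V 0 = 0 := by simpa using hVs 0 0
  refine ⟨fun m => ?_, fun m n => ?_, fun n => ?_⟩
  · rw [← hpr, ← hS, hpS, hTV, hT0, hV0, zero_add, hps]
  · rw [← hpr, ← hS, hpS, hTV, hT, hVs, hpa, hps, hps]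
  · rw [← hps, ← hVs, ← hS, hSV, hpa, hpT, hT0, hp0', zero_add, hps]

end

variable (θ : ℝ)

theorem shiftS_smul (v : Plane) (c : ℂ) (f : 𝓢(Plane, ℂ)) :
    shiftS θ v (c • f) = c • shiftS θ v f := by
  ext x
  simp only [shiftS_apply, _root_.smul_apply, smul_eq_mul]
  ring

theorem coord_shiftS (i : Fin 2) (v : Plane) (f : 𝓢(Plane, ℂ)) :
    coord i (shiftS θ v f) = shiftS θ v (coord i f) - (v i : ℂ) • shiftS θ v f := by
  ext x
  simp only [shiftS_apply, coord_apply, _root_.sub_apply, _root_.smul_apply, smul_eq_mul,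
    PiLp.add_apply, Complex.ofReal_add]
  ring

theorem pd_shiftS (i : Fin 2) (v : Plane) (f : 𝓢(Plane, ℂ)) : pd i (shiftS θ v f)
    = (Complex.I * phase θ v (e i)) • shiftS θ v f + shiftS θ v (pd i f) :=
  lineDerivOp_wave _ _ _ _

theorem shiftS_add (v : Plane) (f g : 𝓢(Plane, ℂ)) :
    shiftS θ v (f + g) = shiftS θ v f + shiftS θ v g := by
  ext x
  simp only [shiftS_apply, _root_.add_apply]
  ring

theorem shiftS_sub (v : Plane) (f g : 𝓢(Plane, ℂ)) :
    shiftS θ v (f - g) = shiftS θ v f - shiftS θ v g := by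
  ext x
  simp only [shiftS_apply, _root_.sub_apply]
  ring

theorem lower_shiftS (hθ : θ ≠ 0) (v : Plane) (f : 𝓢(Plane, ℂ)) : lower θ (shiftS θ v f)
    = shiftS θ v (lower θ f) + (-(2 * ladderConst θ * (v 0 + Complex.I * v 1))) • shiftS θ v f := by
  have h0' : (θ : ℂ) ≠ 0 := by exact_mod_cast hθ
  simp only [lower_apply, coord_shiftS, pd_shiftS, shiftS_smul, shiftS_add, phase_apply]
  ext x
  simp only [_root_.add_apply, _root_.sub_apply, _root_.smul_apply, smul_eq_mul]
  simp
  field_simp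
  linear_combination (2*ladderConst θ * (v 0) * shiftS θ v f x) * Complex.I_sq

theorem raise_shiftS (hθ : θ ≠ 0) (v : Plane) (f : 𝓢(Plane, ℂ)) : shiftS θ v (raise θ f)
    = raise θ (shiftS θ v f) + (2 * ladderConst θ * (v 0 - Complex.I * v 1)) • shiftS θ v f := by
  have h0' : (θ : ℂ) ≠ 0 := by exact_mod_cast hθ
  simp only [raise_apply, coord_shiftS, pd_shiftS, shiftS_smul, shiftS_sub, phase_apply]
  ext x
  simp only [_root_.add_apply, _root_.sub_apply, _root_.smul_apply, smul_eq_mul]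
  simp
  field_simp
  linear_combination (-2*ladderConst θ * (v 0) * shiftS θ v f x) * Complex.I_sq

variable [hθ : Fact (0 < θ)]

/-- The vacuum expectation value of a twisted translation. The integral is the value at `v` of the
Moyal square of the vacuum, so that idempotence of the vacuum evaluates it. -/
theorem inner_oscL_zero_shift (v : Plane) : inner ℂ (oscL θ 0) (shift θ v (oscL θ 0))
    = ((Real.exp (-(1 / θ) * ‖v‖ ^ 2) : ℝ) : ℂ) := by
  have h0 := hθ.out
  have hpi := Real.pi_pos
  have h1 := congrArg (fun f : 𝓢(Plane, ℂ) => (starRingEnd ℂ) (f v)) (mstar_vacuum_vacuum θ)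
  simp only [mstar, coeff_vacuum, tconv_smul_left, _root_.smul_apply, tconv_apply] at h1
  rw [vacuum_apply, Complex.conj_ofReal, smul_eq_mul, map_mul, ← integral_conj] at h1
  have h2 : ∀ x, (starRingEnd ℂ) (osc θ 0 x) * shiftS θ v (osc θ 0) x = (1 / (2 * Real.pi * θ) : ℂ)
      * (starRingEnd ℂ) (vacuum θ x * (twist θ (-v) x * vacuum θ (v + x))) := by
    intro x
    have h3 : ((1 / Real.sqrt (2 * Real.pi * θ) : ℝ) : ℂ)
        * ((1 / Real.sqrt (2 * Real.pi * θ) : ℝ) : ℂ)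
        = 1 / (2 * Real.pi * θ) := by
      rw [← Complex.ofReal_mul, div_mul_div_comm, Real.mul_self_sqrt (by positivity), one_mul]
      push_cast
      rfl
    have h4 : (starRingEnd ℂ) (twist θ (-v) x) = twist θ (-x) v := by
      rw [conj_twist, neg_neg, twist_eq, twist_eq]
      simp only [PiLp.neg_apply]
      push_cast
      ring_nf
    rw [← h3, shiftS_apply]
    simp only [osc, tower_zero, _root_.smul_apply, smul_eq_mul, map_mul, h4,
      Complex.conj_ofReal, vacuum_apply]
    rw [add_comm v x]
    ring
  rw [oscL, shift_toLp, inner_toL2]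
  simp only [h2]
  rw [integral_const_mul]
  have h5 : (starRingEnd ℂ) (1 / (Real.pi * θ) : ℂ) = 1 / (Real.pi * θ) := by simp
  rw [h5] at h1
  have hpi' : (Real.pi : ℂ) ≠ 0 := by exact_mod_cast hpi.ne'
  have h0' : (θ : ℂ) ≠ 0 := by exact_mod_cast h0.ne'
  rw [Complex.ofReal_mul, Complex.ofReal_ofNat] at h1
  field_simp at h1 ⊢
  linear_combination h1

/-- The recursion relations for the matrix elements of the twisted translations. -/
theorem recursion_shift (v : Plane) :
    (∀ m : ℕ, ((Real.sqrt (m + 1) : ℝ) : ℂ) * inner ℂ (oscL θ (m + 1)) (shift θ v (oscL θ 0))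
      = (-(2 * ladderConst θ * (v 0 + Complex.I * v 1))) *
        inner ℂ (oscL θ m) (shift θ v (oscL θ 0))) ∧
    (∀ m n : ℕ, ((Real.sqrt (m + 1) : ℝ) : ℂ) *
        inner ℂ (oscL θ (m + 1)) (shift θ v (oscL θ (n + 1)))
      = ((Real.sqrt (n + 1) : ℝ) : ℂ) * inner ℂ (oscL θ m) (shift θ v (oscL θ n)) +
        (-(2 * ladderConst θ * (v 0 + Complex.I * v 1))) *
        inner ℂ (oscL θ m) (shift θ v (oscL θ (n + 1)))) ∧
    (∀ n : ℕ, ((Real.sqrt (n + 1) : ℝ) : ℂ) * inner ℂ (oscL θ 0) (shift θ v (oscL θ (n + 1)))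
      = (2 * ladderConst θ * (v 0 - Complex.I * v 1)) *
        inner ℂ (oscL θ 0) (shift θ v (oscL θ n))) := by
  simp only [oscL, shift_toLp]
  refine recursion_of_commutator (T := lower θ) (S := raise θ) (V := shiftS θ v) (p := ip)
    (h := osc θ) (lower_osc_zero θ) (lower_osc_succ θ) (raise_osc θ) (lower_shiftS θ hθ.out.ne' v)
    (raise_shiftS θ hθ.out.ne' v) (shiftS_smul θ v) ?_ ?_ ?_ ?_ ?_
  · exact fun c f g => ip_smul_right c f g
  · exact fun c f g => by rw [ip_smul_left, Complex.conj_ofReal]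
  · exact ip_add_right
  · exact ip_raise_left θ
  · intro f g
    rw [← ip_conj, ip_raise_left, ip_conj]

/-! ### Schwartz functions of one variable -/

/-- Multiplication by the variable on Schwartz functions of one variable. -/
def mulVar : 𝓢(ℝ, ℂ) →L[ℂ] 𝓢(ℝ, ℂ) := SchwartzMap.smulLeftCLM ℂ fun x : ℝ => (x : ℂ)

theorem mulVar_apply (f : 𝓢(ℝ, ℂ)) (x : ℝ) : mulVar f x = x * f x := by
  have h : Function.HasTemperateGrowth fun x : ℝ => (x : ℂ) := Complex.ofRealCLM.hasTemperateGrowth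
  simp [mulVar, SchwartzMap.smulLeftCLM_apply_apply h]

/-- The derivative on Schwartz functions of one variable. -/
def dVar : 𝓢(ℝ, ℂ) →L[ℂ] 𝓢(ℝ, ℂ) := LineDeriv.lineDerivOpCLM ℂ 𝓢(ℝ, ℂ) (1 : ℝ)

theorem dVar_eq (f : 𝓢(ℝ, ℂ)) : dVar f = ∂_{(1 : ℝ)} f := rfl

theorem dVar_apply (f : 𝓢(ℝ, ℂ)) (x : ℝ) : dVar f x = deriv f x := by
  rw [dVar_eq, SchwartzMap.lineDerivOp_apply_eq_fderiv, fderiv_apply_one_eq_deriv]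

theorem dVar_mulVar (f : 𝓢(ℝ, ℂ)) : dVar (mulVar f) = f + mulVar (dVar f) := by
  ext x
  have h : ⇑(mulVar f) = fun x : ℝ => (x : ℂ) * f x := funext (mulVar_apply f)
  have h1 : HasDerivAt (fun x : ℝ => (x : ℂ) * f x) (1 * f x + x * deriv f x) x :=
    (Complex.ofRealCLM.hasDerivAt (x := x)).mul (f.hasDerivAt x)
  rw [dVar_apply, h, h1.deriv, _root_.add_apply, mulVar_apply, dVar_apply, one_mul]

end

section

/-! ### Ladder and Weyl operators in one variable -/

variable (θ : ℝ)

/-- The annihilation operator `(x + θ d/dx) / √(2θ)` in one variable. -/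
def lowerVar : 𝓢(ℝ, ℂ) →L[ℂ] 𝓢(ℝ, ℂ) := ladderConst θ • (mulVar + (θ : ℂ) • dVar)

/-- The creation operator `(x - θ d/dx) / √(2θ)` in one variable. -/
def raiseVar : 𝓢(ℝ, ℂ) →L[ℂ] 𝓢(ℝ, ℂ) := ladderConst θ • (mulVar - (θ : ℂ) • dVar)

theorem lowerVar_apply (f : 𝓢(ℝ, ℂ)) :
    lowerVar θ f = ladderConst θ • (mulVar f + (θ : ℂ) • dVar f) := rfl

theorem raiseVar_apply (f : 𝓢(ℝ, ℂ)) :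
    raiseVar θ f = ladderConst θ • (mulVar f - (θ : ℂ) • dVar f) := rfl

theorem lowerVar_raiseVar (hθ : 0 < θ) (f : 𝓢(ℝ, ℂ)) :
    lowerVar θ (raiseVar θ f) = raiseVar θ (lowerVar θ f) + f := by
  have hc := ladderConst_sq θ hθ
  ext x
  simp only [lowerVar_apply, raiseVar_apply, map_smul, map_add, map_sub, dVar_mulVar,
    _root_.add_apply, _root_.sub_apply, _root_.smul_apply, smul_eq_mul]
  linear_combination (f x) * hc

/-- The bilinear pairing `∫ f g` of Schwartz functions of one variable. -/
def pair (f g : 𝓢(ℝ, ℂ)) : ℂ := ∫ x, f x * g x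

theorem integrable_pair (f g : 𝓢(ℝ, ℂ)) : Integrable fun x => f x * g x :=
  f.integrable.mul_bdd (c := SchwartzMap.seminorm ℝ 0 0 g) g.continuous.aestronglyMeasurable
    (Eventually.of_forall fun x => g.norm_le_seminorm ℝ x)

theorem pair_add_right (f g g' : 𝓢(ℝ, ℂ)) : pair f (g + g') = pair f g + pair f g' := by
  rw [pair, pair, pair, ← integral_add (integrable_pair f g) (integrable_pair f g')]
  simp only [_root_.add_apply, mul_add]

theorem pair_smul_right (c : ℂ) (f g : 𝓢(ℝ, ℂ)) : pair f (c • g) = c * pair f g := by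
  rw [pair, pair, ← integral_const_mul]
  congr 1
  funext x
  rw [_root_.smul_apply, smul_eq_mul]
  ring

theorem pair_comm (f g : 𝓢(ℝ, ℂ)) : pair f g = pair g f := by
  simp only [pair, mul_comm]

theorem pair_smul_left (c : ℂ) (f g : 𝓢(ℝ, ℂ)) : pair (c • f) g = c * pair f g := by
  rw [pair_comm, pair_smul_right, pair_comm]

theorem pair_mulVar (f g : 𝓢(ℝ, ℂ)) : pair f (mulVar g) = pair (mulVar f) g := by
  rw [pair, pair]
  congr 1
  funext x
  rw [mulVar_apply, mulVar_apply]
  ring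

theorem pair_dVar (f g : 𝓢(ℝ, ℂ)) : pair f (dVar g) = -pair (dVar f) g :=
  SchwartzMap.integral_mul_lineDerivOp_right_eq_neg_left f g 1

theorem pair_raiseVar_right (f g : 𝓢(ℝ, ℂ)) : pair f (raiseVar θ g) = pair (lowerVar θ f) g := by
  rw [raiseVar_apply, lowerVar_apply, pair_smul_right, pair_smul_left, sub_eq_add_neg,
    ← neg_smul, pair_add_right, pair_smul_right, pair_comm (_ + _), pair_add_right,
    pair_smul_right, pair_mulVar, pair_dVar, pair_comm g (mulVar f), pair_comm g (dVar f)]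
  ring

theorem pair_raiseVar_left (f g : 𝓢(ℝ, ℂ)) : pair (raiseVar θ f) g = pair f (lowerVar θ g) := by
  rw [pair_comm, pair_raiseVar_right, pair_comm]

/-- The Weyl operators on Schwartz functions. -/
def weylS (k : Plane) (f : 𝓢(ℝ, ℂ)) : 𝓢(ℝ, ℂ) :=
  Complex.exp ((Complex.I / θ) * ((k 0 * k 1 / 2 : ℝ) : ℂ)) •
    wave ((k 0 / θ) • ContinuousLinearMap.id ℝ ℝ) (k 1) f

theorem weylS_apply (k : Plane) (f : 𝓢(ℝ, ℂ)) (x : ℝ) : weylS θ k f x = weyl θ k f x := by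
  rw [weylS, _root_.smul_apply, wave_apply, weyl, smul_eq_mul, ← mul_assoc, ← Complex.exp_add]
  congr 2
  simp
  ring

theorem weylS_smul (k : Plane) (c : ℂ) (f : 𝓢(ℝ, ℂ)) : weylS θ k (c • f) = c • weylS θ k f := by
  ext x
  simp only [weylS_apply, weyl, _root_.smul_apply, smul_eq_mul]
  ring

theorem weylS_add (k : Plane) (f g : 𝓢(ℝ, ℂ)) :
    weylS θ k (f + g) = weylS θ k f + weylS θ k g := by
  ext x
  simp only [weylS_apply, weyl, _root_.add_apply]
  ring

theorem weylS_sub (k : Plane) (f g : 𝓢(ℝ, ℂ)) :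
    weylS θ k (f - g) = weylS θ k f - weylS θ k g := by
  ext x
  simp only [weylS_apply, weyl, _root_.sub_apply]
  ring

theorem mulVar_weylS (k : Plane) (f : 𝓢(ℝ, ℂ)) :
    mulVar (weylS θ k f) = weylS θ k (mulVar f) - (k 1 : ℂ) • weylS θ k f := by
  ext x
  simp only [mulVar_apply, weylS_apply, weyl, _root_.sub_apply, _root_.smul_apply, smul_eq_mul,
    Complex.ofReal_add]
  ring

theorem dVar_weylS (k : Plane) (f : 𝓢(ℝ, ℂ)) :
    dVar (weylS θ k f) = weylS θ k (dVar f) + (Complex.I * k 0 / θ) • weylS θ k f := by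
  rw [weylS, weylS, map_smul, dVar_eq, lineDerivOp_wave, smul_add, smul_comm, add_comm]
  congr 2
  simp
  ring

theorem lowerVar_weylS (hθ : θ ≠ 0) (k : Plane) (f : 𝓢(ℝ, ℂ)) : lowerVar θ (weylS θ k f)
    = weylS θ k (lowerVar θ f) + (ladderConst θ * (Complex.I * k 0 - k 1)) • weylS θ k f := by
  have h0' : (θ : ℂ) ≠ 0 := by exact_mod_cast hθ
  simp only [lowerVar_apply, mulVar_weylS, dVar_weylS, weylS_smul, weylS_add]
  ext x
  simp only [_root_.add_apply, _root_.sub_apply, _root_.smul_apply, smul_eq_mul]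
  field_simp
  ring

theorem raiseVar_weylS (hθ : θ ≠ 0) (k : Plane) (f : 𝓢(ℝ, ℂ)) : weylS θ k (raiseVar θ f)
    = raiseVar θ (weylS θ k f) + (ladderConst θ * (Complex.I * k 0 + k 1)) • weylS θ k f := by
  have h0' : (θ : ℂ) ≠ 0 := by exact_mod_cast hθ
  simp only [raiseVar_apply, mulVar_weylS, dVar_weylS, weylS_smul, weylS_sub]
  ext x
  simp only [_root_.add_apply, _root_.sub_apply, _root_.smul_apply, smul_eq_mul]
  field_simp
  ring

variable [hθ : Fact (0 < θ)]

theorem inv_two_theta_pos : 0 < 1 / (2 * θ) := by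
  have := hθ.out
  positivity

/-- The Gaussian `exp (-x²/(2θ))`. -/
def gaussVar : 𝓢(ℝ, ℂ) := (exists_gaussian ℝ (inv_two_theta_pos θ)).choose

theorem gaussVar_apply (x : ℝ) : gaussVar θ x = ((Real.exp (-x ^ 2 / (2 * θ)) : ℝ) : ℂ) := by
  rw [gaussVar, (exists_gaussian ℝ (inv_two_theta_pos θ)).choose_spec]
  congr 2
  rw [Real.norm_eq_abs, sq_abs]
  ring

theorem hasDerivAt_gaussVar (x : ℝ) :
    HasDerivAt (fun x : ℝ => Real.exp (-x ^ 2 / (2 * θ)))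
      (-(x / θ) * Real.exp (-x ^ 2 / (2 * θ))) x := by
  have h0 := hθ.out.ne'
  refine ((((hasDerivAt_id x).pow 2).neg.div_const (2 * θ)).exp).congr_deriv ?_
  simp
  field_simp

theorem sqrt_two_div : Real.sqrt (2 / θ) = 1 / Real.sqrt (2 * θ) * 2 := by
  have h0 := hθ.out
  have h : 0 < Real.sqrt (2 * θ) := Real.sqrt_pos.2 (by positivity)
  rw [show 2 / θ = 4 / (2 * θ) by field_simp; norm_num, Real.sqrt_div (by norm_num),
    show (4 : ℝ) = 2 ^ 2 by norm_num, Real.sqrt_sq (by norm_num)]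
  ring

/-- The creation operator generates the Hermite functions: this is the recursion relation of the
Hermite polynomials. -/
theorem tower_raiseVar_gaussVar_apply (n : ℕ) (x : ℝ) : tower (raiseVar θ) n (gaussVar θ) x
    = ((1 / Real.sqrt n.factorial * Polynomial.aeval (x * Real.sqrt (2 / θ)) (Polynomial.hermite n)
      * Real.exp (-x ^ 2 / (2 * θ)) : ℝ) : ℂ) := by
  have h0 := hθ.out
  induction n generalizing x with
  | zero => simp [tower_zero, gaussVar_apply]
  | succ n ih =>
    have hd : dVar (tower (raiseVar θ) n (gaussVar θ)) x
        = ((1 / Real.sqrt n.factorial * (Real.sqrt (2 / θ) *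
          Polynomial.aeval (x * Real.sqrt (2 / θ)) (Polynomial.derivative (Polynomial.hermite n))
          - x / θ * Polynomial.aeval (x * Real.sqrt (2 / θ)) (Polynomial.hermite n))
          * Real.exp (-x ^ 2 / (2 * θ)) : ℝ) : ℂ) := by
      rw [dVar_apply, show ⇑(tower (raiseVar θ) n (gaussVar θ)) = _ from funext ih]
      refine HasDerivAt.deriv (HasDerivAt.ofReal_comp ?_)
      have h1 := ((Polynomial.hermite n).hasDerivAt_aeval (x * Real.sqrt (2 / θ))).comp x
        ((hasDerivAt_id x).mul_const (Real.sqrt (2 / θ)))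
      refine ((h1.const_mul (1 / Real.sqrt n.factorial)).mul
        (hasDerivAt_gaussVar θ x)).congr_deriv ?_
      simp only [Function.comp, id]
      ring
    rw [tower_succ, raiseVar_apply, _root_.smul_apply, _root_.smul_apply, _root_.sub_apply,
      _root_.smul_apply, mulVar_apply, ih, hd, Polynomial.hermite_succ, map_sub, map_mul,
      Polynomial.aeval_X, Nat.factorial_succ, ladderConst]
    simp only [smul_eq_mul, ← Complex.ofReal_mul, ← Complex.ofReal_sub]
    congr 1
    have hs : Real.sqrt (((n + 1) * n.factorial : ℕ) : ℝ)
        = Real.sqrt (n + 1) * Real.sqrt n.factorial := by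
      rw [Nat.cast_mul, Real.sqrt_mul (by positivity)]
      push_cast
      rfl
    rw [hs, sqrt_two_div]
    have h2 : Real.sqrt (2 * θ) ^ 2 = 2 * θ := Real.sq_sqrt (by positivity)
    have h3 : 0 < Real.sqrt (2 * θ) := Real.sqrt_pos.2 (by positivity)
    have h4 : 0 < Real.sqrt ((n : ℝ) + 1) := Real.sqrt_pos.2 (by positivity)
    have h5 : 0 < Real.sqrt (n.factorial : ℝ) := Real.sqrt_pos.2 (by positivity)
    generalize Polynomial.aeval (x * (1 / Real.sqrt (2 * θ) * 2)) (Polynomial.hermite n) = A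
    generalize Polynomial.aeval (x * (1 / Real.sqrt (2 * θ) * 2))
      (Polynomial.derivative (Polynomial.hermite n)) = B
    field_simp
    linear_combination B * h2

/-- The eigenfunctions of the harmonic oscillator as Schwartz functions. -/
def eigenS (n : ℕ) : 𝓢(ℝ, ℂ) :=
  (((Real.pi * θ) ^ (-(1 / 4) : ℝ) : ℝ) : ℂ) • tower (raiseVar θ) n (gaussVar θ)

theorem eigenS_apply (n : ℕ) (x : ℝ) : eigenS θ n x = eigenfunction θ n x := by
  rw [eigenS, _root_.smul_apply, tower_raiseVar_gaussVar_apply, eigenfunction, smul_eq_mul,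
    ← Complex.ofReal_mul]
  congr 1
  ring

theorem coe_eigenS (n : ℕ) : ⇑(eigenS θ n) = eigenfunction θ n := funext (eigenS_apply θ n)

theorem lowerVar_gaussVar : lowerVar θ (gaussVar θ) = 0 := by
  have h0' : (θ : ℂ) ≠ 0 := by exact_mod_cast hθ.out.ne'
  ext x
  have h : dVar (gaussVar θ) x = ((-(x / θ) * Real.exp (-x ^ 2 / (2 * θ)) : ℝ) : ℂ) := by
    rw [dVar_apply, show ⇑(gaussVar θ) = _ from funext (gaussVar_apply θ)]
    exact (hasDerivAt_gaussVar θ x).ofReal_comp.deriv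
  rw [lowerVar_apply, _root_.smul_apply, _root_.add_apply, _root_.smul_apply, h, mulVar_apply,
    gaussVar_apply]
  push_cast
  simp only [smul_eq_mul]
  field_simp
  simp

/-- The recursion relations for the matrix elements of the Weyl operators. -/
theorem recursion_weyl (k : Plane) :
    (∀ m : ℕ, ((Real.sqrt (m + 1) : ℝ) : ℂ) * pair (eigenS θ (m + 1)) (weylS θ k (eigenS θ 0))
      = (ladderConst θ * (Complex.I * k 0 - k 1)) *
        pair (eigenS θ m) (weylS θ k (eigenS θ 0))) ∧
    (∀ m n : ℕ, ((Real.sqrt (m + 1) : ℝ) : ℂ) *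
        pair (eigenS θ (m + 1)) (weylS θ k (eigenS θ (n + 1)))
      = ((Real.sqrt (n + 1) : ℝ) : ℂ) * pair (eigenS θ m) (weylS θ k (eigenS θ n)) +
        (ladderConst θ * (Complex.I * k 0 - k 1)) *
        pair (eigenS θ m) (weylS θ k (eigenS θ (n + 1)))) ∧
    (∀ n : ℕ, ((Real.sqrt (n + 1) : ℝ) : ℂ) * pair (eigenS θ 0) (weylS θ k (eigenS θ (n + 1)))
      = (ladderConst θ * (Complex.I * k 0 + k 1)) *
        pair (eigenS θ 0) (weylS θ k (eigenS θ n))) := by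
  refine recursion_of_commutator (T := lowerVar θ) (S := raiseVar θ) ?_ ?_ ?_
    (lowerVar_weylS θ hθ.out.ne' k) (raiseVar_weylS θ hθ.out.ne' k) (weylS_smul θ k)
    pair_smul_right (fun c f g => pair_smul_left c f g) pair_add_right (pair_raiseVar_left θ)
    (pair_raiseVar_right θ)
  · rw [eigenS, map_smul, tower_zero, lowerVar_gaussVar, smul_zero]
  · intro n
    rw [eigenS, map_smul, apply_tower_of_commutator (lowerVar_raiseVar θ hθ.out)
      (lowerVar_gaussVar θ), smul_comm, eigenS]
  · intro n
    rw [eigenS, map_smul, apply_tower, smul_comm, eigenS]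

/-- The vacuum expectation value of a Weyl operator, a Gaussian integral. For `k = (-2v₂, 2v₁)`
it is the vacuum expectation value of the twisted translation by `v`. -/
theorem pair_eigenS_zero_weylS (k : Plane) : pair (eigenS θ 0) (weylS θ k (eigenS θ 0))
    = ((Real.exp (-(1 / (4 * θ)) * ‖k‖ ^ 2) : ℝ) : ℂ) := by
  have h0 := hθ.out
  have h0' : (θ : ℂ) ≠ 0 := by exact_mod_cast h0.ne'
  have hpi := Real.pi_pos
  set C : ℝ := (Real.pi * θ) ^ (-(1 / 4) : ℝ) with hC
  have h1 : ∀ x : ℝ, eigenS θ 0 x * weylS θ k (eigenS θ 0) x = (C * C : ℂ) *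
      Complex.exp (-(1 / θ) * (x : ℂ) ^ 2 + ((Complex.I * k 0 - k 1) / θ) * x
        + (Complex.I * k 0 * k 1 - k 1 ^ 2) / (2 * θ)) := by
    intro x
    rw [weylS_apply, weyl, eigenS, _root_.smul_apply, _root_.smul_apply, tower_zero,
      gaussVar_apply, gaussVar_apply, Complex.ofReal_exp, Complex.ofReal_exp, smul_eq_mul,
      smul_eq_mul, ← hC]
    calc _ = (C * C : ℂ) * (Complex.exp ((-x ^ 2 / (2 * θ) : ℝ) : ℂ)
          * Complex.exp ((Complex.I / θ) * ((k 0 * x + k 0 * k 1 / 2 : ℝ) : ℂ))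
          * Complex.exp ((-(x + k 1) ^ 2 / (2 * θ) : ℝ) : ℂ)) := by ring
      _ = _ := by
        rw [← Complex.exp_add, ← Complex.exp_add]
        congr 2
        push_cast
        field_simp
        ring
  have h2 : (-(1 / θ) : ℂ).re < 0 := by
    rw [← Complex.ofReal_one, ← Complex.ofReal_div, ← Complex.ofReal_neg, Complex.ofReal_re]
    have : 0 < 1 / θ := by positivity
    linarith
  have h3 : (Real.pi / -(-(1 / θ)) : ℂ) ^ (1 / 2 : ℂ)
      = (((Real.pi * θ) ^ (1 / 2 : ℝ) : ℝ) : ℂ) := by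
    rw [Complex.ofReal_cpow (by positivity)]
    congr 1
    · push_cast
      field_simp
    · push_cast
      rfl
  have h4 : C * C * (Real.pi * θ) ^ (1 / 2 : ℝ) = 1 := by
    rw [hC, ← Real.rpow_add (by positivity), ← Real.rpow_add (by positivity)]
    norm_num
  rw [pair]
  simp only [h1]
  rw [integral_const_mul, integral_cexp_quadratic h2, h3, ← mul_assoc, ← Complex.ofReal_mul,
    ← Complex.ofReal_mul, h4, Complex.ofReal_one, one_mul, Complex.ofReal_exp,
    EuclideanSpace.norm_sq_eq, Fin.sum_univ_two]
  congr 1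
  simp only [Real.norm_eq_abs, sq_abs]
  push_cast
  field_simp
  linear_combination (2 * (k 0 : ℂ) ^ 2) * Complex.I_sq

/-- The matrix elements of the Weyl operators in the Schrödinger representation agree with the
matrix elements of the twisted translations. -/
theorem pair_weylS_eq_inner_shift (v : Plane) (m n : ℕ) :
    pair (eigenS θ m) (weylS θ !₂[-2 * v 1, 2 * v 0] (eigenS θ n))
      = inner ℂ (oscL θ m) (shift θ v (oscL θ n)) := by
  have hk : (!₂[-2 * v 1, 2 * v 0] : Plane) 0 = -2 * v 1 := rfl
  have hk' : (!₂[-2 * v 1, 2 * v 0] : Plane) 1 = 2 * v 0 := rfl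
  obtain ⟨h1, h2, h3⟩ := recursion_weyl θ !₂[-2 * v 1, 2 * v 0]
  obtain ⟨h1', h2', h3'⟩ := recursion_shift θ v
  have e1 : ladderConst θ * (Complex.I * ((-2 * v 1 : ℝ) : ℂ) - ((2 * v 0 : ℝ) : ℂ))
      = -(2 * ladderConst θ * (v 0 + Complex.I * v 1)) := by push_cast; ring
  have e2 : ladderConst θ * (Complex.I * ((-2 * v 1 : ℝ) : ℂ) + ((2 * v 0 : ℝ) : ℂ))
      = 2 * ladderConst θ * (v 0 - Complex.I * v 1) := by push_cast; ring
  rw [hk, hk', e1] at h1 h2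
  rw [hk, hk', e2] at h3
  refine eq_of_recursion
    (c := fun m n => pair (eigenS θ m) (weylS θ !₂[-2 * v 1, 2 * v 0] (eigenS θ n)))
    (d := fun m n => inner ℂ (oscL θ m) (shift θ v (oscL θ n))) h1 h2 h3 h1' h2' h3' ?_ m n
  beta_reduce
  rw [pair_eigenS_zero_weylS, inner_oscL_zero_shift, EuclideanSpace.norm_sq_eq,
    EuclideanSpace.norm_sq_eq, Fin.sum_univ_two, Fin.sum_univ_two, hk, hk']
  simp only [Real.norm_eq_abs, sq_abs]
  congr 2
  have := hθ.out.ne'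
  field_simp
  ring

end

section

/-! ### The Schrödinger and the left regular representation -/

variable (θ : ℝ)

/-- The linear isometry `v ↦ (-v₂, v₁)`. -/
def rot : Plane ≃ₗᵢ[ℝ] Plane :=
  LinearIsometry.toLinearIsometryEquiv
    { toFun := fun v => !₂[-v 1, v 0]
      map_add' := fun v w => by ext i; fin_cases i <;> simp; ring
      map_smul' := fun c v => by ext i; fin_cases i <;> simp
      norm_map' := fun v => by
        simp [EuclideanSpace.norm_eq, Fin.sum_univ_two, add_comm] } rfl

theorem two_smul_rot (v : Plane) : (2 : ℝ) • rot v = !₂[-2 * v 1, 2 * v 0] := by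
  have h : rot v = !₂[-v 1, v 0] := rfl
  rw [h]
  ext i
  fin_cases i <;> simp

theorem integral_comp_two_smul_rot (F : Plane → ℂ) :
    ∫ v, F ((2 : ℝ) • rot v) = (1 / 4 : ℂ) * ∫ k, F k := by
  rw [rot.measurePreserving.integral_comp rot.toHomeomorph.measurableEmbedding
    (fun v => F ((2 : ℝ) • v)), Measure.integral_comp_smul volume F 2]
  simp
  norm_num

variable [hθ : Fact (0 < θ)]

/-- The Fourier coefficients in the definition of the Schrödinger representation and the symplectic
Fourier transform differ by the change of variables `k = (-2v₂, 2v₁)`, whose Jacobian is `4`. -/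
theorem fourierCoeff_two_smul_rot (f : 𝓢(Plane, ℂ)) (v : Plane) :
    fourierCoeff θ f ((2 : ℝ) • rot v) = (1 / 4 : ℂ) * coeff θ f v := by
  rw [two_smul_rot, fourierCoeff, coeff_apply, ← mul_assoc]
  congr 1
  · have hpi : (Real.pi : ℂ) ≠ 0 := by exact_mod_cast Real.pi_ne_zero
    have h0' : (θ : ℂ) ≠ 0 := by exact_mod_cast hθ.out.ne'
    field_simp
    norm_num
  · congr 1
    funext x
    rw [twist]
    congr 2
    simp
    ring

theorem exists_fourierCoeff (f : 𝓢(Plane, ℂ)) :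
    ∃ F : 𝓢(Plane, ℂ), ∀ k, fourierCoeff θ f k = F k := by
  let J : Plane ≃L[ℝ] Plane := rot.toContinuousLinearEquiv.trans
    (ContinuousLinearEquiv.smulLeft (Units.mk0 (2 : ℝ) two_ne_zero))
  refine ⟨(1 / 4 : ℂ) • SchwartzMap.compCLMOfContinuousLinearEquiv ℂ J.symm (coeff θ f),
    fun k => ?_⟩
  have h := fourierCoeff_two_smul_rot θ f (J.symm k)
  have h2 : (2 : ℝ) • rot (J.symm k) = k := J.apply_symm_apply k
  rw [h2] at h
  rw [h]
  rfl

/-- The eigenstates of the harmonic oscillator are the vector states of the oscillator functions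
on the plane: the Schrödinger representation and the left regular one have the same matrix
elements. -/
theorem eigenstate_eq (m : ℕ) (f : 𝓢(Plane, ℂ)) :
    eigenstate θ m f = inner ℂ (oscL θ m) (leftMul θ f (oscL θ m)) := by
  obtain ⟨F, hF⟩ := exists_fourierCoeff θ f
  set C := SchwartzMap.seminorm ℝ 0 0 (eigenS θ m) with hC
  have hi : Integrable (Function.uncurry fun (x : ℝ) (k : Plane) =>
      eigenS θ m x * (F k * weyl θ k (eigenS θ m) x)) := by
    have h1 : Integrable fun p : ℝ × Plane => eigenS θ m p.1 * F p.2 :=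
      (eigenS θ m).integrable.mul_prod F.integrable
    have h2 : Continuous fun p : ℝ × Plane => weyl θ p.2 (eigenS θ m) p.1 := by
      unfold weyl
      have := (eigenS θ m).continuous
      fun_prop
    refine (h1.mul_bdd (c := C) h2.aestronglyMeasurable (Eventually.of_forall fun p => ?_)).congr
      (Eventually.of_forall fun p => ?_)
    · have h3 : ∀ r : ℝ, Complex.I / θ * (r : ℂ) = ((r / θ : ℝ) : ℂ) * Complex.I := fun r => by
        push_cast
        ring
      rw [weyl, norm_mul, h3, Complex.norm_exp_ofReal_mul_I, one_mul]
      exact (eigenS θ m).norm_le_seminorm ℝ _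
    · simp only [Function.uncurry]
      ring
  have h1 : eigenstate θ m f
      = ∫ x, ∫ k, eigenS θ m x * (F k * weyl θ k (eigenS θ m) x) := by
    rw [eigenstate]
    congr 1
    funext x
    rw [integral_const_mul, schrodinger, eigenS_apply, coe_eigenS]
    simp only [hF]
    rw [eigenfunction, Complex.conj_ofReal]
  rw [h1, integral_integral_swap hi, inner_leftMul]
  have h2 : ∀ k, ∫ x, eigenS θ m x * (F k * weyl θ k (eigenS θ m) x)
      = F k * pair (eigenS θ m) (weylS θ k (eigenS θ m)) := by
    intro k
    rw [pair, ← integral_const_mul]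
    congr 1
    funext x
    rw [weylS_apply]
    ring
  simp only [h2, ← pair_weylS_eq_inner_shift, ← two_smul_rot]
  have h3 : ∀ v, coeff θ f v = 4 * F ((2 : ℝ) • rot v) := by
    intro v
    rw [← hF, fourierCoeff_two_smul_rot]
    ring
  simp only [h3, mul_assoc]
  rw [integral_const_mul, integral_comp_two_smul_rot
    (fun k => F k * pair (eigenS θ m) (weylS θ k (eigenS θ m)))]
  ring

end

section

/-! ### Normal ordering and the levels of the oscillator -/

section
variable {E : Type*} [NormedAddCommGroup E] [NormedSpace ℝ E]

/-- The normalised powers of the annihilation operator `T` act on the image of the creation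
operator `S` up to an element of this image. -/
theorem tower_apply_of_commutator {T S : 𝓢(E, ℂ) →L[ℂ] 𝓢(E, ℂ)} (hTS : ∀ f, T (S f) = S (T f) + f)
    (m : ℕ) (f : 𝓢(E, ℂ)) : tower T (m + 1) (S f)
      = S (tower T (m + 1) f) + ((Real.sqrt (m + 1) : ℝ) : ℂ) • tower T m f := by
  induction m with
  | zero => simp [tower_succ, tower_zero, hTS]
  | succ m ih =>
    have hs : ((Real.sqrt (m + 1) : ℝ) : ℂ) * ((Real.sqrt (m + 1) : ℝ) : ℂ) = (m : ℂ) + 1 := by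
      rw [← Complex.ofReal_mul, Real.mul_self_sqrt (by positivity)]
      push_cast
      rfl
    have hs' : ((1 / Real.sqrt ((m + 1 : ℕ) + 1) : ℝ) : ℂ) * ((m : ℂ) + 1 + 1)
        = ((Real.sqrt ((m + 1 : ℕ) + 1) : ℝ) : ℂ) := by
      have h2 : ((Real.sqrt ((m + 1 : ℕ) + 1) : ℝ) : ℂ) * ((Real.sqrt ((m + 1 : ℕ) + 1) : ℝ) : ℂ)
          = (m : ℂ) + 1 + 1 := by
        rw [← Complex.ofReal_mul, Real.mul_self_sqrt (by positivity)]
        push_cast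
        rfl
      rw [← h2, ← mul_assoc, mul_comm ((1 / _ : ℝ) : ℂ), sqrt_succ_smul_one_div, one_mul]
    rw [tower_succ, ih, map_add, map_smul, hTS, apply_tower T m, smul_smul, hs,
      tower_succ T (m + 1), map_smul, ← hs', mul_smul]
    simp only [add_smul, one_smul, smul_add]
    abel

end

variable (θ : ℝ)

/-- The distance `√(θ/2) ∑_{j=1}^n 1/√j` from the ground state to the `n`-th eigenstate. -/
def level (n : ℕ) : ℝ := Real.sqrt (θ / 2) * ∑ j ∈ Finset.range n, 1 / Real.sqrt (j + 1)

theorem level_zero : level θ 0 = 0 := by simp [level]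

theorem level_succ (n : ℕ) :
    level θ (n + 1) = level θ n + Real.sqrt (θ / 2) * (1 / Real.sqrt (n + 1)) := by
  rw [level, Finset.sum_range_succ, mul_add, level]

theorem level_mono : Monotone (level θ) :=
  monotone_nat_of_le_succ fun n => by
    rw [level_succ]
    have : 0 ≤ Real.sqrt (θ / 2) * (1 / Real.sqrt (n + 1)) := by positivity
    linarith

theorem level_nonneg (n : ℕ) : 0 ≤ level θ n := by
  rw [← level_zero θ]
  exact level_mono θ (Nat.zero_le n)

theorem level_sub_level {m n : ℕ} (hmn : m ≤ n) : level θ n - level θ m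
    = Real.sqrt (θ / 2) * ∑ k ∈ Finset.Icc (m + 1) n, 1 / Real.sqrt k := by
  induction n, hmn using Nat.le_induction with
  | base => simp
  | succ n hmn ih =>
    rw [Finset.sum_Icc_succ_top (by omega), mul_add, ← ih, level_succ]
    push_cast
    ring

/-- Each of the `n` summands of the level is at least the last one, so the levels are unbounded. -/
theorem sqrt_mul_sqrt_le_level (n : ℕ) : Real.sqrt (θ / 2) * Real.sqrt n ≤ level θ n := by
  rw [level]
  refine mul_le_mul_of_nonneg_left ?_ (Real.sqrt_nonneg _)
  rcases Nat.eq_zero_or_pos n with rfl | hn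
  · simp
  have hn' : (0 : ℝ) < n := by exact_mod_cast hn
  have h : ∀ j ∈ Finset.range n, 1 / Real.sqrt n ≤ 1 / Real.sqrt (j + 1) := fun j hj => by
    have h1 : ((j : ℝ) + 1) ≤ n := by exact_mod_cast Finset.mem_range.1 hj
    exact one_div_le_one_div_of_le (Real.sqrt_pos.2 (by positivity)) (Real.sqrt_le_sqrt h1)
  calc Real.sqrt n = n * (1 / Real.sqrt n) := by rw [mul_one_div, Real.div_sqrt]
    _ ≤ _ := by simpa using Finset.card_nsmul_le_sum _ _ _ h

variable [hθ : Fact (0 < θ)]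

/-! ### Diagonal elements of the Moyal algebra -/

/-- The operator `𝓛(f)` is determined by its values on Schwartz functions. -/
theorem leftMul_ext {T : L2 →L[ℂ] L2} {f : 𝓢(Plane, ℂ)}
    (h : ∀ g : 𝓢(Plane, ℂ), ((mstar θ f g).toLp 2 volume : L2) = T (g.toLp 2 volume)) :
    leftMul θ f = T := by
  ext1 ψ
  refine denseRange_toL2.induction_on (p := fun ψ => leftMul θ f ψ = T ψ) ψ
    (isClosed_eq (leftMul θ f).continuous T.continuous) fun g => ?_
  rw [leftMul_toLp, h]

theorem norm_leftMul_matrixUnit_le (k l : ℕ) : ‖leftMul θ (matrixUnit θ k l)‖ ≤ 1 := by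
  have h := norm_sum_smul_leftMul_matrixUnit_le θ {(0 : ℕ)} (a := fun n => n + k)
    (b := fun n => n + l) (add_left_injective k) (add_left_injective l) (w := fun _ => 1)
    zero_le_one (by simp)
  simpa using h

/-- The diagonal element `∑_{k < N} c k • E k k`. -/
def diagonal (N : ℕ) (c : ℕ → ℝ) : 𝓢(Plane, ℂ) :=
  ∑ k ∈ Finset.range N, (c k : ℂ) • matrixUnit θ k k

theorem leftMul_diagonal (N : ℕ) (c : ℕ → ℝ) : leftMul θ (diagonal θ N c)
    = ∑ k ∈ Finset.range N, (c k : ℂ) • leftMul θ (matrixUnit θ k k) := by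
  rw [diagonal, leftMul_sum]
  simp only [leftMul_smul]

theorem leftMul_diagonal_oscL {N : ℕ} {c : ℕ → ℝ} (hc : ∀ k, N ≤ k → c k = 0) (k : ℕ) :
    leftMul θ (diagonal θ N c) (oscL θ k) = (c k : ℂ) • oscL θ k := by
  rw [leftMul_diagonal, _root_.sum_apply]
  simp only [_root_.smul_apply, leftMul_matrixUnit_oscL]
  by_cases hk : k < N
  · rw [Finset.sum_eq_single k (fun j _ hj => by rw [if_neg hj, smul_zero])
      fun h => absurd (Finset.mem_range.2 hk) h, if_pos rfl]
  · rw [hc k (not_lt.1 hk), Complex.ofReal_zero, zero_smul]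
    refine Finset.sum_eq_zero fun j hj => ?_
    rw [if_neg (by rintro rfl; exact hk (Finset.mem_range.1 hj)), smul_zero]

theorem mstar_diagonal (N : ℕ) (c : ℕ → ℝ) (g : 𝓢(Plane, ℂ)) : mstar θ (diagonal θ N c) g
    = ∑ k ∈ Finset.range N, (c k : ℂ) • mstar θ (matrixUnit θ k k) g := by
  induction N with
  | zero => simp [diagonal, mstar_zero_left]
  | succ N ih =>
    have h : diagonal θ (N + 1) c = diagonal θ N c + (c N : ℂ) • matrixUnit θ N N :=
      Finset.sum_range_succ _ _
    rw [h, mstar_add_left, mstar_smul_left, ih, Finset.sum_range_succ]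

theorem lower_mstar_matrixUnit_zero (g : 𝓢(Plane, ℂ)) :
    lower θ (mstar θ (matrixUnit θ 0 0) g) = 0 := by
  rw [mstar_matrixUnit, tower_zero, tower_zero, lower_mstar_vacuum]

theorem lower_mstar_matrixUnit_succ (k l : ℕ) (g : 𝓢(Plane, ℂ)) :
    lower θ (mstar θ (matrixUnit θ (k + 1) l) g)
      = ((Real.sqrt (k + 1) : ℝ) : ℂ) • mstar θ (matrixUnit θ k l) g := by
  rw [mstar_matrixUnit, mstar_matrixUnit, lower_tower_raise θ (lower_mstar_vacuum θ _)]

theorem raise_mstar_matrixUnit (k l : ℕ) (g : 𝓢(Plane, ℂ)) :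
    raise θ (mstar θ (matrixUnit θ k l) g)
      = ((Real.sqrt (k + 1) : ℝ) : ℂ) • mstar θ (matrixUnit θ (k + 1) l) g := by
  rw [mstar_matrixUnit, mstar_matrixUnit, apply_tower]

theorem mstar_matrixUnit_lower (k l : ℕ) (g : 𝓢(Plane, ℂ)) :
    mstar θ (matrixUnit θ k l) (lower θ g)
      = ((Real.sqrt (l + 1) : ℝ) : ℂ) • mstar θ (matrixUnit θ k (l + 1)) g := by
  rw [mstar_matrixUnit, mstar_matrixUnit, tower_apply, mstar_smul_right, map_smul]

theorem mstar_matrixUnit_raise_zero (g : 𝓢(Plane, ℂ)) :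
    mstar θ (matrixUnit θ 0 0) (raise θ g) = 0 := by
  rw [mstar_matrixUnit, tower_zero, tower_zero, mstar_vacuum_raise]

theorem mstar_matrixUnit_raise_succ (k l : ℕ) (g : 𝓢(Plane, ℂ)) :
    mstar θ (matrixUnit θ k (l + 1)) (raise θ g)
      = ((Real.sqrt (l + 1) : ℝ) : ℂ) • mstar θ (matrixUnit θ k l) g := by
  rw [mstar_matrixUnit, mstar_matrixUnit, tower_apply_of_commutator (lower_raise θ hθ.out),
    mstar_add_right, mstar_vacuum_raise, zero_add, mstar_smul_right, map_smul]

/-- Summation by parts for a family that vanishes at both ends. -/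
theorem sum_range_shift {M : Type*} [AddCommMonoid M] {u : ℕ → M} {N : ℕ} (h0 : u 0 = 0)
    (hN : u N = 0) : ∑ k ∈ Finset.range N, u k = ∑ k ∈ Finset.range N, u (k + 1) := by
  have h := Finset.sum_range_succ' u N
  rwa [Finset.sum_range_succ, h0, hN, add_zero, add_zero] at h

/-- The weights of the off-diagonal matrix units in the derivatives of a diagonal element. -/
def diagonalWeight (c : ℕ → ℝ) (k : ℕ) : ℂ :=
  2 * ladderConst θ * Real.sqrt (k + 1) * (c (k + 1) - c k)

/-- The derivative `∂₁ + i ∂₂` moves the entries of a diagonal element to the upper off-diagonal. -/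
theorem leftMul_dbar_diagonal {N : ℕ} {c : ℕ → ℝ} (hc : c N = 0) :
    leftMul θ (dbar (diagonal θ N c)) = ∑ k ∈ Finset.range N,
      diagonalWeight θ c k • leftMul θ (matrixUnit θ k (k + 1)) := by
  refine leftMul_ext θ fun g => ?_
  have h1 : mstar θ (dbar (diagonal θ N c)) g = ∑ k ∈ Finset.range N,
      diagonalWeight θ c k • mstar θ (matrixUnit θ k (k + 1)) g := by
    rw [mstar_dbar_left, mstar_diagonal, mstar_diagonal, map_sum]
    simp only [map_smul]
    rw [sum_range_shift (u := fun k => (c k : ℂ) • lower θ (mstar θ (matrixUnit θ k k) g))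
      (by rw [lower_mstar_matrixUnit_zero, smul_zero]) (by simp [hc]), ← Finset.sum_sub_distrib,
      Finset.smul_sum]
    refine Finset.sum_congr rfl fun k _ => ?_
    rw [lower_mstar_matrixUnit_succ, mstar_matrixUnit_lower, smul_smul, smul_smul, ← sub_smul,
      smul_smul, diagonalWeight]
    congr 1
    ring
  rw [h1, _root_.sum_apply, ← SchwartzMap.toLpCLM_apply (𝕜 := ℂ), map_sum]
  refine Finset.sum_congr rfl fun k _ => ?_
  rw [map_smul, _root_.smul_apply, leftMul_toLp]
  rfl

/-- The derivative `∂₁ - i ∂₂` moves the entries of a diagonal element to the lower off-diagonal. -/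
theorem leftMul_del_diagonal {N : ℕ} {c : ℕ → ℝ} (hc : c N = 0) :
    leftMul θ (del (diagonal θ N c)) = ∑ k ∈ Finset.range N,
      diagonalWeight θ c k • leftMul θ (matrixUnit θ (k + 1) k) := by
  refine leftMul_ext θ fun g => ?_
  have h1 : mstar θ (del (diagonal θ N c)) g = ∑ k ∈ Finset.range N,
      diagonalWeight θ c k • mstar θ (matrixUnit θ (k + 1) k) g := by
    rw [mstar_del_left, mstar_diagonal, mstar_diagonal, map_sum]
    simp only [map_smul]
    rw [sum_range_shift (u := fun k => (c k : ℂ) • mstar θ (matrixUnit θ k k) (raise θ g))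
      (by rw [mstar_matrixUnit_raise_zero, smul_zero]) (by simp [hc]), ← Finset.sum_sub_distrib,
      Finset.smul_sum]
    refine Finset.sum_congr rfl fun k _ => ?_
    rw [mstar_matrixUnit_raise_succ, raise_mstar_matrixUnit, smul_smul, smul_smul, ← sub_smul,
      smul_smul, diagonalWeight]
    congr 1
    ring
  rw [h1, _root_.sum_apply, ← SchwartzMap.toLpCLM_apply (𝕜 := ℂ), map_sum]
  refine Finset.sum_congr rfl fun k _ => ?_
  rw [map_smul, _root_.smul_apply, leftMul_toLp]
  rfl

theorem commutatorLeOne_diagonal {N : ℕ} {c : ℕ → ℝ} (hc : c N = 0)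
    (h : ∀ k < N, ‖diagonalWeight θ c k‖ ≤ 1) : CommutatorLeOne θ (diagonal θ N c) := by
  rw [commutatorLeOne_iff, leftMul_dbar_diagonal θ hc, leftMul_del_diagonal θ hc]
  have h' : ∀ k ∈ Finset.range N, ‖diagonalWeight θ c k‖ ≤ 1 := fun k hk =>
    h k (Finset.mem_range.1 hk)
  exact ⟨norm_sum_smul_leftMul_matrixUnit_le θ _ Function.injective_id (add_left_injective 1)
    zero_le_one h', norm_sum_smul_leftMul_matrixUnit_le θ _ (add_left_injective 1)
    Function.injective_id zero_le_one h'⟩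

/-! ### The distance between the eigenstates -/

theorem two_mul_ladderConst_mul : 2 * ladderConst θ * ((Real.sqrt (θ / 2) : ℝ) : ℂ) = 1 := by
  have h0 := hθ.out
  have h : 2 * (1 / Real.sqrt (2 * θ)) * Real.sqrt (θ / 2) = 1 := by
    rw [show 2 * θ = 4 * (θ / 2) by ring, Real.sqrt_mul (by norm_num),
      show (4 : ℝ) = 2 ^ 2 by norm_num, Real.sqrt_sq (by norm_num)]
    have : 0 < Real.sqrt (θ / 2) := Real.sqrt_pos.2 (by positivity)
    field_simp
  rw [ladderConst]
  exact_mod_cast h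

/-- The element of the algebra that realises the distances between the first `N` eigenstates:
all of its weights have modulus one. -/
theorem exists_diagonal_detector (N : ℕ) : ∃ f : 𝓢(Plane, ℂ), CommutatorLeOne θ f ∧
    ∀ k, leftMul θ f (oscL θ k) = ((level θ N - level θ (min k N) : ℝ) : ℂ) • oscL θ k := by
  refine ⟨diagonal θ N fun k => level θ N - level θ (min k N),
    commutatorLeOne_diagonal θ (by simp) fun k hk => ?_,
    leftMul_diagonal_oscL θ fun k hk => by simp [hk]⟩
  have h : diagonalWeight θ (fun k => level θ N - level θ (min k N)) k = -1 := by
    rw [diagonalWeight, min_eq_left hk.le, min_eq_left (Nat.succ_le_of_lt hk), level_succ]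
    have h1 := two_mul_ladderConst_mul θ
    have h2 := sqrt_succ_smul_one_div k
    push_cast at h2 ⊢
    linear_combination (-(Real.sqrt (k + 1) * (1 / Real.sqrt (k + 1)) : ℂ)) * h1 - h2
  rw [h, norm_neg, norm_one]

theorem isState_eigenstate (n : ℕ) : IsState θ (eigenstate θ n) := by
  rw [funext (eigenstate_eq θ n)]
  refine isState_inner θ (norm_oscL θ n) fun r hr =>
    ⟨matrixUnit θ n n, norm_leftMul_matrixUnit_le θ n n, ?_⟩
  rw [leftMul_matrixUnit_oscL, if_pos rfl, inner_oscL, if_pos rfl, norm_one]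
  exact hr.le

/-- The derivative `∂₁ + i ∂₂` detects the difference between consecutive eigenstates. -/
theorem inner_leftMul_dbar (f : 𝓢(Plane, ℂ)) (k : ℕ) :
    inner ℂ (oscL θ k) (leftMul θ (dbar f) (oscL θ (k + 1)))
      = 2 * ladderConst θ * Real.sqrt (k + 1) *
        (eigenstate θ (k + 1) f - eigenstate θ k f) := by
  rw [eigenstate_eq, eigenstate_eq]
  simp only [oscL, leftMul_toLp]
  change ip _ _ = _ * (ip _ _ - ip _ _)
  have h : ∀ g h : 𝓢(Plane, ℂ), g - h = g + (-1 : ℂ) • h := fun g h => by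
    rw [neg_one_smul, sub_eq_add_neg]
  rw [mstar_dbar_left, ip_smul_right, h, ip_add_right, ip_smul_right, ← ip_raise_left, raise_osc,
    ip_smul_left, lower_osc_succ, mstar_smul_right, ip_smul_right, Complex.conj_ofReal]
  ring

/-- The Lipschitz condition bounds the matrix element of `∂₁f + i ∂₂f` between consecutive
oscillator functions by one. -/
theorem norm_eigenstate_succ_sub_le {f : 𝓢(Plane, ℂ)} (hf : CommutatorLeOne θ f) (k : ℕ) :
    ‖eigenstate θ (k + 1) f - eigenstate θ k f‖ ≤ level θ (k + 1) - level θ k := by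
  have h1 : ‖(inner ℂ (oscL θ k) (leftMul θ (dbar f) (oscL θ (k + 1))) : ℂ)‖ ≤ 1 := by
    refine (norm_inner_le_norm (𝕜 := ℂ) _ _).trans ?_
    rw [norm_oscL, one_mul]
    refine (ContinuousLinearMap.le_opNorm _ _).trans ?_
    rw [norm_oscL, mul_one]
    exact ((commutatorLeOne_iff θ f).1 hf).1
  have h2 := two_mul_ladderConst_mul θ
  have h3 := sqrt_succ_smul_one_div k
  have h4 : eigenstate θ (k + 1) f - eigenstate θ k f
      = ((Real.sqrt (θ / 2) * (1 / Real.sqrt (k + 1)) : ℝ) : ℂ)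
        * inner ℂ (oscL θ k) (leftMul θ (dbar f) (oscL θ (k + 1))) := by
    rw [inner_leftMul_dbar, Complex.ofReal_mul]
    linear_combination (-(eigenstate θ (k + 1) f - eigenstate θ k f)) * h3
      - (eigenstate θ (k + 1) f - eigenstate θ k f) *
        (((Real.sqrt (k + 1) : ℝ) : ℂ) * ((1 / Real.sqrt (k + 1) : ℝ) : ℂ)) * h2
  have h5 : 0 ≤ Real.sqrt (θ / 2) * (1 / Real.sqrt (k + 1)) := by positivity
  rw [h4, norm_mul, Complex.norm_real, Real.norm_of_nonneg h5, level_succ, add_sub_cancel_left]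
  exact mul_le_of_le_one_right h5 h1

theorem norm_eigenstate_sub_le {f : 𝓢(Plane, ℂ)} (hf : CommutatorLeOne θ f) {m n : ℕ}
    (hmn : m ≤ n) : ‖eigenstate θ m f - eigenstate θ n f‖ ≤ level θ n - level θ m := by
  induction n, hmn using Nat.le_induction with
  | base => simp
  | succ n hmn ih =>
    have h1 := norm_eigenstate_succ_sub_le θ hf n
    have h2 := norm_sub_le_norm_sub_add_norm_sub (eigenstate θ m f) (eigenstate θ n f)
      (eigenstate θ (n + 1) f)
    rw [norm_sub_rev (eigenstate θ n f)] at h2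
    linarith

/-- The distance between eigenstates is the difference of their levels. -/
theorem spectralDist_eigenstate {m n : ℕ} (hmn : m ≤ n) :
    spectralDist θ (eigenstate θ m) (eigenstate θ n)
      = ENNReal.ofReal (level θ n - level θ m) := by
  refine le_antisymm (iSup₂_le fun f hf => ?_) ?_
  · rw [← ofReal_norm]
    exact ENNReal.ofReal_le_ofReal (norm_eigenstate_sub_le θ hf hmn)
  · obtain ⟨f, hf, hval⟩ := exists_diagonal_detector θ n
    refine le_iSup₂_of_le f hf ?_
    rw [eigenstate_eq, eigenstate_eq, hval, hval, inner_smul_right, inner_smul_right, inner_oscL,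
      inner_oscL, if_pos rfl, if_pos rfl, mul_one, mul_one, min_self, min_eq_left hmn,
      ← Complex.ofReal_sub, sub_self, sub_zero, ← ofReal_norm, Complex.norm_real]
    exact ENNReal.ofReal_le_ofReal (Real.le_norm_self _)

/-! ### States at infinite distance -/

theorem hasSum_weights : HasSum (fun j : ℕ => 3 * (1 / 4 : ℝ) ^ (j + 1)) 1 := by
  have h := (hasSum_geometric_of_lt_one (by norm_num : (0 : ℝ) ≤ 1 / 4) (by norm_num)).mul_left
    (3 / 4 : ℝ)
  rw [show (3 / 4 : ℝ) * (1 - 1 / 4)⁻¹ = 1 by norm_num] at h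
  refine h.congr_fun fun j => ?_
  ring

/-- A superposition of oscillator functions of rapidly increasing energy: the expectation value of
an operator that is diagonal in the oscillator basis is a weighted mean of its eigenvalues. -/
theorem exists_superposition : ∃ ξ : L2, ∀ (T : L2 →L[ℂ] L2) (d : ℕ → ℝ),
    (∀ k, T (oscL θ k) = (d k : ℂ) • oscL θ k) →
    HasSum (fun j : ℕ => ((3 * (1 / 4 : ℝ) ^ (j + 1) * d (64 ^ j) : ℝ) : ℂ)) (inner ℂ ξ (T ξ)) := by
  -- the weights `a j ^ 2 = 3 · 4^{-(j+1)}` sum up to one, while the levels of the components grow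
  -- like `√(64 ^ j) = 8 ^ j`
  let a : ℕ → ℝ := fun j => Real.sqrt 3 * (1 / 2) ^ (j + 1)
  let n : ℕ → ℕ := fun j => 64 ^ j
  have hn : Function.Injective n := Nat.pow_right_injective (by norm_num)
  have ha : Summable a := by
    have h := (summable_geometric_of_lt_one (by norm_num : (0 : ℝ) ≤ 1 / 2) (by norm_num)).mul_left
      (Real.sqrt 3 * (1 / 2))
    refine h.congr fun j => ?_
    simp only [a]
    ring
  have hs : Summable fun j => (a j : ℂ) • oscL θ (n j) := by
    refine Summable.of_norm (ha.congr fun j => ?_)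
    rw [norm_smul, norm_oscL, mul_one, Complex.norm_real, Real.norm_of_nonneg (by positivity)]
  obtain ⟨ξ, hξ⟩ := hs
  refine ⟨ξ, fun T d hT => ?_⟩
  have h1 : ∀ i, inner ℂ (oscL θ (n i)) ξ = (a i : ℂ) := by
    intro i
    have h2 := hξ.mapL (innerSL ℂ (oscL θ (n i)))
    have h3 : HasSum (fun j => (innerSL ℂ (oscL θ (n i))) ((a j : ℂ) • oscL θ (n j)))
        (a i : ℂ) := by
      convert hasSum_ite_eq i (a i : ℂ) using 2 with j
      rw [map_smul, innerSL_apply_apply, inner_oscL, smul_eq_mul]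
      by_cases hij : j = i
      · simp [hij]
      · rw [if_neg (fun h => hij (hn h).symm), if_neg hij, mul_zero]
    exact h2.unique h3
  have h4 := (hξ.mapL T).mapL (innerSL ℂ ξ)
  refine h4.congr_fun fun j => ?_
  have h5 : inner ℂ ξ (oscL θ (n j)) = (a j : ℂ) := by
    rw [← inner_conj_symm, h1, Complex.conj_ofReal]
  rw [innerSL_apply_apply, map_smul, hT, inner_smul_right, inner_smul_right, h5,
    ← Complex.ofReal_mul, ← Complex.ofReal_mul]
  congr 1
  simp only [a, n]
  have h6 : Real.sqrt 3 * Real.sqrt 3 = 3 := Real.mul_self_sqrt (by norm_num)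
  rw [show (1 / 4 : ℝ) = (1 / 2) * (1 / 2) by norm_num, mul_pow]
  linear_combination (-((1 / 2 : ℝ) ^ (j + 1) * (1 / 2 : ℝ) ^ (j + 1) * d (64 ^ j))) * h6

/-- A state at infinite distance from the ground state: the superposition has infinite mean level.
The detector with cut-off `64ᴶ` separates the two states at least by the weight `3 · 4^{-(J+1)}` of
the component `64ᴶ` times its level, which is of order `8ᴶ`. -/
theorem exists_spectralDist_eq_top :
    ∃ φ, IsState θ φ ∧ spectralDist θ (eigenstate θ 0) φ = ⊤ := by
  obtain ⟨ξ, hξ⟩ := exists_superposition θ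
  have hre : ∀ (T : L2 →L[ℂ] L2) (d : ℕ → ℝ), (∀ k, T (oscL θ k) = (d k : ℂ) • oscL θ k) →
      HasSum (fun j : ℕ => 3 * (1 / 4 : ℝ) ^ (j + 1) * d (64 ^ j)) (inner ℂ ξ (T ξ)).re := by
    intro T d hT
    have h := (hξ T d hT).mapL Complex.reCLM
    simpa only [Complex.reCLM_apply, Complex.ofReal_re] using h
  have hnorm : ‖ξ‖ = 1 := by
    have h1 := hre (ContinuousLinearMap.id ℂ L2) (fun _ => 1) (fun k => by simp)
    simp only [mul_one] at h1
    have h2 := h1.unique hasSum_weights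
    have h3 : ‖ξ‖ ^ 2 = 1 := by
      rw [← h2]
      exact norm_sq_eq_re_inner (𝕜 := ℂ) ξ
    exact (pow_eq_one_iff_of_nonneg (norm_nonneg _) two_ne_zero).1 h3
  refine ⟨fun f => inner ℂ ξ (leftMul θ f ξ), isState_inner θ hnorm fun r hr => ?_, ?_⟩
  · obtain ⟨J, hJ⟩ := ((tendsto_order.1 hasSum_weights.tendsto_sum_nat).1 r hr).exists
    let c : ℕ → ℝ := fun k => if k < 64 ^ J then 1 else 0
    refine ⟨diagonal θ (64 ^ J) c, ?_, ?_⟩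
    · rw [leftMul_diagonal]
      refine norm_sum_smul_leftMul_matrixUnit_le θ _ (a := id) (b := id) Function.injective_id
        Function.injective_id zero_le_one fun k _ => ?_
      simp only [c]
      split_ifs <;> simp
    · have h1 := hre _ c (leftMul_diagonal_oscL θ (N := 64 ^ J) (c := c) fun k hk => by
        simp [c, not_lt.2 hk])
      have h2 := sum_le_hasSum (Finset.range J) (fun j _ => by
        simp only [c]
        split_ifs <;> positivity) h1
      refine le_trans ?_ (Complex.re_le_norm _)
      refine le_trans ?_ h2
      refine hJ.le.trans (Finset.sum_le_sum fun j hj => ?_)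
      have h3 : 64 ^ j < 64 ^ J := Nat.pow_lt_pow_right (by norm_num) (Finset.mem_range.1 hj)
      simp [c, h3]
  · refine ENNReal.eq_top_of_forall_nnreal_le fun C => ?_
    have h0 := hθ.out
    have hs : 0 < Real.sqrt (θ / 2) := Real.sqrt_pos.2 (by positivity)
    obtain ⟨J, hJ⟩ := pow_unbounded_of_one_lt (C / (3 / 4 * Real.sqrt (θ / 2)))
      (by norm_num : (1 : ℝ) < 2)
    rw [div_lt_iff₀ (by positivity)] at hJ
    obtain ⟨f, hf, hval⟩ := exists_diagonal_detector θ (64 ^ J)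
    refine le_iSup₂_of_le f hf ?_
    have h1 := hre (leftMul θ f) _ hval
    -- the weighted mean of the levels below the cut-off is the difference of the two states
    have h2 : HasSum (fun j : ℕ => 3 * (1 / 4 : ℝ) ^ (j + 1) * level θ (min (64 ^ j) (64 ^ J)))
        (level θ (64 ^ J) - (inner ℂ ξ (leftMul θ f ξ)).re) := by
      have h3 := (hasSum_weights.mul_right (level θ (64 ^ J))).sub h1
      rw [one_mul] at h3
      refine h3.congr_fun fun j => ?_
      ring
    have h4 := le_hasSum h2 J fun j _ => mul_nonneg (by positivity) (level_nonneg θ _)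
    rw [min_self] at h4
    have h5 := sqrt_mul_sqrt_le_level θ (64 ^ J)
    have h6 : Real.sqrt ((64 ^ J : ℕ) : ℝ) = 8 ^ J := by
      rw [show ((64 ^ J : ℕ) : ℝ) = (8 ^ J) ^ 2 by
        push_cast; rw [← pow_mul, mul_comm, pow_mul]; norm_num,
        Real.sqrt_sq (by positivity)]
    rw [h6] at h5
    have h7 : 3 * (1 / 4 : ℝ) ^ (J + 1) * (Real.sqrt (θ / 2) * 8 ^ J)
        = 2 ^ J * (3 / 4 * Real.sqrt (θ / 2)) := by
      have : (1 / 4 : ℝ) ^ J * 8 ^ J = 2 ^ J := by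
        rw [← mul_pow]
        norm_num
      rw [← this, pow_succ]
      ring
    have h8 : (C : ℝ) ≤ level θ (64 ^ J) - (inner ℂ ξ (leftMul θ f ξ)).re := by
      refine le_trans ?_ h4
      refine le_trans (hJ.le.trans_eq h7.symm) ?_
      gcongr
    have h9 : eigenstate θ 0 f = (level θ (64 ^ J) : ℂ) := by
      rw [eigenstate_eq, hval, inner_smul_right, inner_oscL, if_pos rfl, mul_one, Nat.zero_min,
        level_zero, sub_zero]
    have h10 : (C : ℝ) ≤ ‖eigenstate θ 0 f - inner ℂ ξ (leftMul θ f ξ)‖ := by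
      refine h8.trans (le_trans (le_of_eq ?_) (Complex.re_le_norm _))
      rw [h9, Complex.sub_re, Complex.ofReal_re]
    rw [← ofReal_norm]
    exact (ENNReal.ofReal_coe_nnreal (p := C)).symm.le.trans (ENNReal.ofReal_le_ofReal h10)

/-- The spectral distance takes all the values in `[0, ∞]`. -/
theorem exists_spectralDist_eq (r : ℝ≥0∞) :
    ∃ φ₁ φ₂, IsState θ φ₁ ∧ IsState θ φ₂ ∧ spectralDist θ φ₁ φ₂ = r := by
  have h0 := isState_eigenstate θ 0
  rcases eq_or_ne r ⊤ with rfl | hr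
  · obtain ⟨φ, hφ, h⟩ := exists_spectralDist_eq_top θ
    exact ⟨_, _, h0, hφ, h⟩
  · refine ⟨_, _, h0, h0.translateState θ (r.toReal • e 0), ?_⟩
    rw [spectralDist_translateState h0, norm_smul, PiLp.norm_single, norm_one, mul_one,
      Real.norm_of_nonneg ENNReal.toReal_nonneg, ENNReal.ofReal_toReal hr]

end

end Moyal

end

theorem mainTheorem2 (lP : ℝ) (hlP : 0 < lP) :
    (∀ φ : 𝓢(Moyal.Plane, ℂ) → ℂ, Moyal.IsState (lP ^ 2) φ → ∀ κ : Moyal.Plane,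
      Moyal.IsState (lP ^ 2) (Moyal.translateState κ φ) ∧
      Moyal.spectralDist (lP ^ 2) φ (Moyal.translateState κ φ) = ENNReal.ofReal ‖κ‖) ∧
    (∀ r : ℝ≥0∞, ∃ φ₁ φ₂ : 𝓢(Moyal.Plane, ℂ) → ℂ,
      Moyal.IsState (lP ^ 2) φ₁ ∧ Moyal.IsState (lP ^ 2) φ₂ ∧
      Moyal.spectralDist (lP ^ 2) φ₁ φ₂ = r) ∧
    (∀ m : ℕ, Moyal.IsState (lP ^ 2) (Moyal.eigenstate (lP ^ 2) m)) ∧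
    (∀ m n : ℕ, m ≤ n →
      Moyal.spectralDist (lP ^ 2) (Moyal.eigenstate (lP ^ 2) m) (Moyal.eigenstate (lP ^ 2) n) =
        ENNReal.ofReal (lP / Real.sqrt 2 * ∑ k ∈ Finset.Icc (m + 1) n, 1 / Real.sqrt k)) ∧
    (∀ m n p : ℕ, m ≤ n → n ≤ p →
      Moyal.spectralDist (lP ^ 2) (Moyal.eigenstate (lP ^ 2) m) (Moyal.eigenstate (lP ^ 2) p) =
        Moyal.spectralDist (lP ^ 2) (Moyal.eigenstate (lP ^ 2) m) (Moyal.eigenstate (lP ^ 2) n) +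
        Moyal.spectralDist (lP ^ 2) (Moyal.eigenstate (lP ^ 2) n)
          (Moyal.eigenstate (lP ^ 2) p)) := by
  have : Fact (0 < lP ^ 2) := ⟨by positivity⟩
  refine ⟨fun φ hφ κ => ⟨hφ.translateState _ κ, Moyal.spectralDist_translateState hφ κ⟩,
    Moyal.exists_spectralDist_eq _, Moyal.isState_eigenstate _, fun m n hmn => ?_,
    fun m n p hmn hnp => ?_⟩
  · rw [Moyal.spectralDist_eigenstate _ hmn, Moyal.level_sub_level _ hmn,
      Real.sqrt_div (by positivity), Real.sqrt_sq hlP.le]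
  · rw [Moyal.spectralDist_eigenstate _ hmn, Moyal.spectralDist_eigenstate _ hnp,
      Moyal.spectralDist_eigenstate _ (hmn.trans hnp), ← ENNReal.ofReal_add
      (sub_nonneg.2 (Moyal.level_mono _ hmn)) (sub_nonneg.2 (Moyal.level_mono _ hnp))]
    congr 1
    ring
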